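/- **Conventions.** Algorithms are deterministic word RAM programs: a finite program with registers and a random access memory, unit-cost arithmetic, bitwise, indirect load/store and comparison-jump instructions, where on an input of $L$ words all numbers occurring in the computation must stay below $(L+2)^k$ for a constant $k$ of the algorithm (words of $O(\log L)$ bits). "$a=b^\gamma$" for positive integers $a,b$ means $|a-b^\gamma|<1$ (equality up to rounding to an integer). *Orthogonal Vectors.* Given families $A,B$ of Boolean vectors of dimension $d$ with $|A|=n\ge 1$ and $|B|=m\ge 1$, decide whether there are $a\in A$, $b\in B$ with $\sum_{i=1}^d a_ib_i=0$. For $0<\gamma\le 1$, the *Orthogonal Vectors Hypothesis with exponent $\gamma$* says: for every $\delta>0$ there is a constant $\omega>0$ such that no algorithm solves Orthogonal Vectors on all instances with $m=n^\gamma$ and $d=\lceil\omega\log_2 n\rceil$ in $O((nm)^{1-\delta})$ time. *Discrete Fréchet distance.* Let $G$ be a connected graph with positive integer edge weights and shortest path metric $d$, and let $P=(p_1,\dots,p_n)$, $Q=(q_1,\dots,q_m)$ be paths in $G$ (consecutive vertices adjacent, no vertex repeated). Then $$D_{\mathcal F}(P,Q)=\min_F\max_{(i,j)\in F} d(p_i,q_j),$$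 where $F$ ranges over the sequences of lattice points from $(1,1)$ to $(n,m)$ in which every $(i,j)$ is followed by some $(k,l)$ with $k\in\{i,i+1\}$ and $l\in\{j,j+1\}$. **Theorem.** Let $0<\gamma\le 1$ and assume the Orthogonal Vectors Hypothesis with exponent $\gamma$. Then for every $\delta>0$ there is no algorithm that, given a connected planar graph $G$ with positive integer edge weights (as a weighted edge list) and two paths $P,Q$ in $G$ with $n\ge1$ and $m\ge1$ vertices, where $n=m^\gamma$, computes $D_{\mathcal F}(P,Q)$ in $O((nm)^{1-\delta})$ time; nor is there one that computes within this time a $1.01$-approximation, that is, a rational number $v$ with $D_{\mathcal F}(P,Q)\le v\le 1.01\cdot D_{\mathcal F}(P,Q)$. Both statements hold even if the algorithm only has to be correct and within the time bound on instances in which $G$ has $N\le 2(n+m)$ vertices and all edge weights are at most $N$. -/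

import Mathlib

/-! ### Word RAM with unit-cost instructions -/

namespace WordRAM

/-- Arithmetic and bitwise operations on words (`sub` is truncated). -/
inductive Op where
  | add | sub | mul | div | mod | land | lor | xor | shl | shr

/-- The value of an operation. -/
def Op.eval : Op → ℕ → ℕ → ℕ
  | .add, a, b => a + b
  | .sub, a, b => a - b
  | .mul, a, b => a * b
  | .div, a, b => a / b
  | .mod, a, b => a % b
  | .land, a, b => a &&& b
  | .lor, a, b => a ||| b
  | .xor, a, b => a ^^^ b
  | .shl, a, b => a <<< b
  | .shr, a, b => a >>> b

/-- Instructions; `R` stands for the registers and `M` for the random access memory. -/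
inductive Instr where
  /-- `R[dst] := c` -/
  | const (dst c : ℕ)
  /-- `R[dst] := o (R[a], R[b])` -/
  | op (o : Op) (dst a b : ℕ)
  /-- `R[dst] := M[R[a]]` -/
  | load (dst a : ℕ)
  /-- `M[R[a]] := R[b]` -/
  | store (a b : ℕ)
  /-- if `R[a] < R[b]`, go to instruction number `target` -/
  | jlt (a b target : ℕ)
  | halt

/-- A program is a finite list of instructions, numbered from `0`. -/
abbrev Program := List Instr

/-- A configuration: program counter, registers, memory. -/
structure Config where
  pc : ℕ
  reg : ℕ → ℕ
  mem : ℕ → ℕ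

/-- Effect of a single instruction. -/
def Instr.exec : Instr → Config → Config
  | .const dst c, s => ⟨s.pc + 1, Function.update s.reg dst c, s.mem⟩
  | .op o dst a b, s =>
      ⟨s.pc + 1, Function.update s.reg dst (o.eval (s.reg a) (s.reg b)), s.mem⟩
  | .load dst a, s => ⟨s.pc + 1, Function.update s.reg dst (s.mem (s.reg a)), s.mem⟩
  | .store a b, s => ⟨s.pc + 1, s.reg, Function.update s.mem (s.reg a) (s.reg b)⟩
  | .jlt a b target, s => ⟨if s.reg a < s.reg b then target else s.pc + 1, s.reg, s.mem⟩
  | .halt, s => s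

/-- The machine has halted when it stands at `halt` or outside of the program. -/
def Program.Halted (p : Program) (s : Config) : Prop :=
  p[s.pc]?.getD Instr.halt = Instr.halt

/-- One step of computation; halted configurations do not change. -/
def Program.step (p : Program) (s : Config) : Config :=
  (p[s.pc]?.getD Instr.halt).exec s

/-- Initially the input is stored in the first cells of the memory; everything else is `0`. -/
def startConfig (x : List ℕ) : Config :=
  ⟨0, fun _ => 0, fun i => x.getD i 0⟩

/-- The configuration after `t` steps on input `x`. -/
def Program.configAt (p : Program) (x : List ℕ) (t : ℕ) : Config :=
  (p.step)^[t] (startConfig x)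

/-- On input `x`, the program `p` halts after at most `t` steps, leaving `out` in registers `0` and
`1`, and up to then all registers and memory cells hold numbers below `(|x| + 2) ^ k`: the machine
works on words of `k * log₂ (|x| + 2)` bits, and no operation may overflow a word. -/
def Program.Computes (p : Program) (k : ℕ) (x : List ℕ) (t : ℕ) (out : ℕ × ℕ) : Prop :=
  p.Halted (p.configAt x t) ∧
  (∀ s ≤ t, ∀ i, (p.configAt x s).reg i < (x.length + 2) ^ k ∧
    (p.configAt x s).mem i < (x.length + 2) ^ k) ∧
  (p.configAt x t).reg 0 = out.1 ∧ (p.configAt x t).reg 1 = out.2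

end WordRAM

/-! ### Orthogonal Vectors -/

/-- There are vectors `a` in the family `A` and `b` in the family `B` with `∑ i, a i * b i = 0`. -/
def HasOrthogonalPair {n m d : ℕ} (A : Fin n → Fin d → Bool) (B : Fin m → Fin d → Bool) : Prop :=
  ∃ i j, ∑ l, (A i l).toNat * (B j l).toNat = 0

/-- Input words of an Orthogonal Vectors instance: `n, m, d`, then the entries of the vectors. -/
def encodeOV {n m d : ℕ} (A : Fin n → Fin d → Bool) (B : Fin m → Fin d → Bool) : List ℕ :=
  [n, m, d] ++ (List.ofFn A).flatMap (fun a => (List.ofFn a).map Bool.toNat)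
    ++ (List.ofFn B).flatMap (fun b => (List.ofFn b).map Bool.toNat)

/-- Orthogonal Vectors with `|A| = n`, `|B| = m = n ^ γ` (either rounding to an integer) and
dimension `d = ⌈ω log₂ n⌉` can be decided by a word RAM in `O((n m) ^ (1 - δ))` time. -/
def OVSolvable (γ ω δ : ℝ) : Prop :=
  ∃ (p : WordRAM.Program) (k : ℕ) (C : ℝ),
    ∀ (n m d : ℕ) (A : Fin n → Fin d → Bool) (B : Fin m → Fin d → Bool),
      1 ≤ n → 1 ≤ m → |(m : ℝ) - (n : ℝ) ^ γ| < 1 → d = ⌈ω * Real.logb 2 n⌉₊ →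
      ∃ (t : ℕ) (out : ℕ × ℕ), p.Computes k (encodeOV A B) t out ∧
        (t : ℝ) ≤ C * ((n : ℝ) * m) ^ (1 - δ) ∧
        (out.1 = 1 ↔ HasOrthogonalPair A B)

/-- The Orthogonal Vectors Hypothesis for instances with `|B| = |A| ^ γ`. -/
def OrthogonalVectorsHypothesis (γ : ℝ) : Prop :=
  ∀ δ : ℝ, 0 < δ → ∃ ω : ℝ, 0 < ω ∧ ¬ OVSolvable γ ω δ

/-! ### Planar graphs, weighted distance, discrete Fréchet distance -/

/-- A graph is planar if it can be drawn in the plane: the vertices are distinct points, every edge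
is a simple arc between its two ends, and an interior point of an edge neither is a vertex nor lies
on another edge. -/
def SimpleGraph.Planar {V : Type*} (G : SimpleGraph V) : Prop :=
  ∃ (pt : V → ℝ × ℝ) (arc : G.edgeSet → unitInterval → ℝ × ℝ),
    Function.Injective pt ∧
    (∀ e, Continuous (arc e) ∧ Function.Injective (arc e)) ∧
    (∀ e : G.edgeSet, ∃ u v, (e : Sym2 V) = s(u, v) ∧ arc e 0 = pt u ∧ arc e 1 = pt v) ∧
    (∀ e t, 0 < t → t < 1 → ∀ v, arc e t ≠ pt v) ∧
    (∀ e e', e ≠ e' → ∀ t t', 0 < t → t < 1 → 0 < t' → t' < 1 → arc e t ≠ arc e' t')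

/-- Shortest path distance in a graph with edge weights (`⊤` if there is no path). -/
noncomputable def SimpleGraph.weightedDist {V : Type*} (G : SimpleGraph V) (weight : Sym2 V → ℕ)
    (u v : V) : ℕ∞ :=
  ⨅ p : G.Walk u v, (((p.edges.map weight).sum : ℕ) : ℕ∞)

/-- `p 0, p 1, …` is a path: consecutive vertices are adjacent and no vertex is repeated. -/
def SimpleGraph.IsVertexPath {V : Type*} (G : SimpleGraph V) {n : ℕ} (p : Fin n → V) : Prop :=
  Function.Injective p ∧ ∀ i j : Fin n, (j : ℕ) = i + 1 → G.Adj (p i) (p j)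

/-- `F` is an `xy`-monotone discrete walk through the `n × m` lattice, from the first corner to the
last (indices start at `0`). -/
structure IsMonotoneWalk {n m : ℕ} (F : List (Fin n × Fin m)) : Prop where
  first : ∃ a, F.head? = some a ∧ (a.1 : ℕ) = 0 ∧ (a.2 : ℕ) = 0
  last : ∃ a, F.getLast? = some a ∧ (a.1 : ℕ) + 1 = n ∧ (a.2 : ℕ) + 1 = m
  step : F.IsChain fun a b =>
    ((b.1 : ℕ) = a.1 ∨ (b.1 : ℕ) = a.1 + 1) ∧ ((b.2 : ℕ) = a.2 ∨ (b.2 : ℕ) = a.2 + 1)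

/-- The (strong) discrete Fréchet distance of two vertex sequences with respect to `dist`. -/
noncomputable def discreteFrechetDist {V : Type*} {n m : ℕ} (dist : V → V → ℕ∞)
    (P : Fin n → V) (Q : Fin m → V) : ℕ∞ :=
  ⨅ F : {F : List (Fin n × Fin m) // IsMonotoneWalk F}, ⨆ a ∈ F.1, dist (P a.1) (Q a.2)

/-! ### The computational problem -/

/-- A connected planar graph with positive integer edge weights, each of which fits into a word of
`log₂ N` bits (that is, is at most the number `N` of vertices), and two paths in it with `n` and `m`
vertices. -/
structure PlanarPathPair (n m : ℕ) where
  N : ℕ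
  G : SimpleGraph (Fin N)
  weight : Sym2 (Fin N) → ℕ
  P : Fin n → Fin N
  Q : Fin m → Fin N
  planar : G.Planar
  connected : G.Connected
  weight_pos : ∀ e ∈ G.edgeSet, 1 ≤ weight e
  weight_le : ∀ e ∈ G.edgeSet, weight e ≤ N
  isPath_P : G.IsVertexPath P
  isPath_Q : G.IsVertexPath Q

namespace PlanarPathPair

variable {n m : ℕ} (I : PlanarPathPair n m)

/-- `D_F(P, Q)` with respect to the shortest path metric of the graph. -/
noncomputable def frechetDist : ℕ∞ :=
  discreteFrechetDist (I.G.weightedDist I.weight) I.P I.Q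

/-- `L` lists every edge of the graph exactly once, by its end points in some order. -/
def IsEdgeList (L : List (Fin I.N × Fin I.N)) : Prop :=
  (L.map fun e => s(e.1, e.2)).Nodup ∧ ∀ e, e ∈ L.map (fun e => s(e.1, e.2)) ↔ e ∈ I.G.edgeSet

/-- Input words: numbers of vertices, of edges, `n`, `m`; the weighted edge list; `P`; `Q`. -/
def encode (L : List (Fin I.N × Fin I.N)) : List ℕ :=
  [I.N, L.length, n, m] ++ L.flatMap (fun e => [(e.1 : ℕ), (e.2 : ℕ), I.weight s(e.1, e.2)])
    ++ List.ofFn (fun i => (I.P i : ℕ)) ++ List.ofFn (fun j => (I.Q j : ℕ))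

end PlanarPathPair

/-- The output `out` stands for the fraction `out.1 / out.2`, which equals `D`. -/
def IsExactOutput (D : ℕ∞) (out : ℕ × ℕ) : Prop :=
  0 < out.2 ∧ (out.1 : ℕ∞) = out.2 * D

/-- The output `out` stands for the fraction `out.1 / out.2`, and
`D ≤ out.1 / out.2 ≤ 1.01 * D`. -/
def IsApproxOutput (D : ℕ∞) (out : ℕ × ℕ) : Prop :=
  0 < out.2 ∧ out.2 * D ≤ out.1 ∧ 100 * (out.1 : ℕ∞) ≤ 101 * (out.2 * D)

/-- Some word RAM program produces, in `O((n m) ^ (1 - δ))` time, a `Correct` output for `D_F(P, Q)`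
on all instances with `n = m ^ γ` (either rounding to an integer) whose graph has at most
`2 (n + m)` vertices, whatever the order of the edge list. -/
def FrechetSolvable (Correct : ℕ∞ → ℕ × ℕ → Prop) (γ δ : ℝ) : Prop :=
  ∃ (p : WordRAM.Program) (k : ℕ) (C : ℝ),
    ∀ (n m : ℕ) (I : PlanarPathPair n m) (L : List (Fin I.N × Fin I.N)),
      1 ≤ n → 1 ≤ m → |(n : ℝ) - (m : ℝ) ^ γ| < 1 → I.N ≤ 2 * (n + m) → I.IsEdgeList L →
      ∃ (t : ℕ) (out : ℕ × ℕ), p.Computes k (I.encode L) t out ∧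
        (t : ℝ) ≤ C * ((n : ℝ) * m) ^ (1 - δ) ∧
        Correct I.frechetDist out

/-! The proof turns a fast algorithm for the Fréchet distance into a fast one for Orthogonal
Vectors. Let A and B be families of n and about n^γ vectors (m in the code) of dimension d = O(log
n). B is written into the path P with m vertices and A into the path Q with n vertices, so the two
size conditions are the same inequality.

Geometry. P and Q are disjoint pieces of one straight line of edges of weight 21. Two hubs, above
and below the line, are joined to every vertex of P and Q by edges of weights x and y between 7 and
14. Two distinct such vertices p, q are at distance at most 20 if x p + x q ≤ 20 or y p + y q ≤ 20
(`TwoHub.dist_le`), and at distance at least 21 otherwise (`TwoHub.le_dist`). Since 1.01 * 20 < 21,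
an approximation tells the two cases apart.

Gadgets. Coordinate vertices carry their bit in the x weight at even positions and in the y weight
at odd positions. A coordinate of P and one of Q are near exactly if their parities agree and their
bits are not both 1. Separators of P are far from every coordinate of Q. If a walk uses near pairs
only, the first separator of P forces Q to stand just before some vector i, and the last one forces
Q to have passed it. In between Q traverses the whole vector i; parity forces P to move in step with
Q inside a single vector j, and counting coordinates shows that the two are aligned
(`TwoHub.exists_orthogonal`). Conversely, an orthogonal pair gives a near walk: Q waits before i, P
comes to j, both advance together, then each runs to its end (`TwoHub.exists_walk`).

Lengths. Paths of the prescribed lengths hold only about n / d and m / d vectors. The families are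
therefore cut into windows, and one instance is solved for each of the at most (2d + 5)² pairs of
windows. If m is below d + 22, then n is bounded by a constant, and brute force suffices.

Machine. The reduction has to be an actual word RAM program that contains the assumed one.
Expressions and loops are compiled with a Hoare logic that tracks time and word size, and the
assumed program is embedded by translating each instruction into four (`WordRAM.Hoare.call`). Every
call gets a fresh zero memory, namely its own residue class of addresses modulo the number K of
calls, so nothing has to be erased (`Reduction.callCode_spec`).

Time. With s = n m there are O(s^(δ/2)) calls, each costing O(n + m + s^(1 - δ)). If δ ≤ γ / 2, then
n = O(s^(1 - δ)), so the total is O(s^(1 - δ/2)) for every ω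
(`Reduction.ovSolvable_of_frechetSolvable`), contrary to the hypothesis. -/

/-! ### A planar graph with two hubs -/

namespace TwoHub

/-- The edges, oriented: a vertex `u < M` is joined to the next one and to the hubs `M + 1` and
`M + 2`. -/
def Rel (M u v : ℕ) : Prop := u < M ∧ (v = u + 1 ∨ v = M + 1 ∨ v = M + 2)

/-- The path `0, …, M` with two hubs `M + 1`, `M + 2` joined to all its vertices but the last. -/
def graph (M : ℕ) : SimpleGraph (Fin (M + 3)) where
  Adj u v := Rel M u v ∨ Rel M v u
  symm := ⟨fun _ _ h => h.symm⟩
  loopless := ⟨fun u h => by unfold Rel at h; omega⟩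

/-- The position of a vertex in the plane. -/
def point (M v : ℕ) : ℝ × ℝ :=
  if v = M + 1 then (0, 1) else if v = M + 2 then (0, -1) else (v, 0)

theorem point_hub₁ (M : ℕ) : point M (M + 1) = (0, 1) := by simp [point]

theorem point_hub₂ (M : ℕ) : point M (M + 2) = (0, -1) := by simp [point]

theorem point_axis {M v : ℕ} (h : v ≤ M) : point M v = ((v : ℝ), 0) := by
  simp [point, show v ≠ M + 1 by omega, show v ≠ M + 2 by omega]

theorem point_injOn {M u v : ℕ} (hu : u < M + 3) (hv : v < M + 3) (h : point M u = point M v) :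
    u = v := by
  have key : ∀ w, w < M + 3 → w ≤ M ∨ w = M + 1 ∨ w = M + 2 := by omega
  rcases key u hu with hu | rfl | rfl <;> rcases key v hv with hv | rfl | rfl <;>
    simp only [point_hub₁, point_hub₂, point_axis, hu, hv, Prod.mk.injEq] at h ⊢ <;>
    first
      | (exact_mod_cast h.1)
      | (exfalso; norm_num at h)

theorem exists_edge_ends {M : ℕ} (e : (graph M).edgeSet) :
    ∃ u v : Fin (M + 3), (e : Sym2 (Fin (M + 3))) = s(u, v) ∧ Rel M u v := by
  obtain ⟨e, he⟩ := e
  induction e with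
  | _ u v =>
    rcases he with h | h
    · exact ⟨u, v, rfl, h⟩
    · exact ⟨v, u, Sym2.eq_swap, h⟩

/-- The straight segment from `point M u` to `point M v`. -/
noncomputable def segment (M u v : ℕ) (t : ℝ) : ℝ × ℝ :=
  ((1 - t) * (point M u).1 + t * (point M v).1, (1 - t) * (point M u).2 + t * (point M v).2)

/-- The height of the point at parameter t is 0, t or -t according to the kind of edge, so at
interior points its sign tells the three kinds apart. Injectivity and disjointness all reduce to
this. -/
theorem segment_cases {M u v : ℕ} (h : Rel M u v) (t : ℝ) :
    (v = u + 1 ∧ segment M u v t = (u + t, 0)) ∨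
    (v = M + 1 ∧ segment M u v t = ((1 - t) * u, t)) ∨
    (v = M + 2 ∧ segment M u v t = ((1 - t) * u, -t)) := by
  obtain ⟨hu, rfl | rfl | rfl⟩ := h
  · left
    refine ⟨rfl, ?_⟩
    simp only [segment, point_axis (show u ≤ M by omega), point_axis (show u + 1 ≤ M by omega)]
    ext <;> simp; ring
  · right; left
    refine ⟨rfl, ?_⟩
    simp [segment, point_axis (show u ≤ M by omega), point_hub₁]
  · right; right
    refine ⟨rfl, ?_⟩
    simp [segment, point_axis (show u ≤ M by omega), point_hub₂]

theorem natCast_add_inj {a b : ℕ} {s t : ℝ} (hs : 0 < s) (hs' : s < 1) (ht : 0 < t) (ht' : t < 1)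
    (h : (a : ℝ) + s = b + t) : a = b := by
  have h1 : (a : ℝ) < b + 1 := by linarith
  have h2 : (b : ℝ) < a + 1 := by linarith
  have h1' : a < b + 1 := by exact_mod_cast h1
  have h2' : b < a + 1 := by exact_mod_cast h2
  omega

theorem natCast_add_ne {a b : ℕ} {s : ℝ} (hs : 0 < s) (hs' : s < 1) : (a : ℝ) + s ≠ b := by
  intro h
  have h1 : (a : ℝ) < b := by linarith
  have h2 : (b : ℝ) < a + 1 := by linarith
  have h1' : a < b := by exact_mod_cast h1
  have h2' : b < a + 1 := by exact_mod_cast h2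
  omega

theorem segment_ne_point {M u v w : ℕ} (h : Rel M u v) (hw : w < M + 3) {t : ℝ} (ht : 0 < t)
    (ht' : t < 1) : segment M u v t ≠ point M w := by
  intro he
  have key : w ≤ M ∨ w = M + 1 ∨ w = M + 2 := by omega
  rcases segment_cases h t with ⟨-, h1⟩ | ⟨-, h1⟩ | ⟨-, h1⟩ <;> rw [h1] at he <;>
    rcases key with hw | rfl | rfl <;>
    simp only [point_hub₁, point_hub₂, point_axis, hw, Prod.mk.injEq] at he <;>
    obtain ⟨e1, e2⟩ := he <;> first | linarith | exact natCast_add_ne ht ht' e1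

theorem segment_disjoint {M u v u' v' : ℕ} (h : Rel M u v) (h' : Rel M u' v') {t t' : ℝ}
    (ht : 0 < t) (ht1 : t < 1) (ht' : 0 < t') (ht1' : t' < 1)
    (he : segment M u v t = segment M u' v' t') : u = u' ∧ v = v' := by
  rcases segment_cases h t with ⟨hv, h1⟩ | ⟨hv, h1⟩ | ⟨hv, h1⟩ <;>
    rcases segment_cases h' t' with ⟨hv', h1'⟩ | ⟨hv', h1'⟩ | ⟨hv', h1'⟩ <;>
    rw [h1, h1', Prod.mk.injEq] at he <;> obtain ⟨e1, e2⟩ := he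
  · have := natCast_add_inj ht ht1 ht' ht1' e1
    exact ⟨this, by omega⟩
  all_goals try (exfalso; linarith)
  · subst e2
    have : (u : ℝ) = u' := mul_left_cancel₀ (by linarith : (1 - t) ≠ 0) e1
    exact ⟨by exact_mod_cast this, by omega⟩
  · obtain rfl : t = t' := by linarith
    have : (u : ℝ) = u' := mul_left_cancel₀ (by linarith : (1 - t) ≠ 0) e1
    exact ⟨by exact_mod_cast this, by omega⟩

theorem segment_injective {M u v : ℕ} (h : Rel M u v) : Function.Injective (segment M u v) := by
  intro s t he
  rcases segment_cases h s with ⟨hv, h1⟩ | ⟨hv, h1⟩ | ⟨hv, h1⟩ <;>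
    rcases segment_cases h t with ⟨hv', h1'⟩ | ⟨hv', h1'⟩ | ⟨hv', h1'⟩ <;>
    first
      | (exfalso; have := h.1; omega)
      | (rw [h1, h1', Prod.mk.injEq] at he; obtain ⟨e1, e2⟩ := he; linarith)

theorem graph_planar (M : ℕ) : (graph M).Planar := by
  choose a b hab hR using exists_edge_ends (M := M)
  refine ⟨fun v => point M v, fun e t => segment M (a e) (b e) t, ?_, ?_, ?_, ?_, ?_⟩
  · intro u v h
    exact Fin.ext (point_injOn u.2 v.2 h)
  · intro e
    refine ⟨?_, ?_⟩
    · unfold segment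
      fun_prop
    · intro s t h
      exact Subtype.ext (segment_injective (hR e) h)
  · intro e
    refine ⟨a e, b e, hab e, ?_, ?_⟩ <;> simp [segment]
  · intro e t h0 h1 v
    exact segment_ne_point (hR e) v.2 h0 h1
  · intro e e' hne t t' h0 h1 h0' h1' h
    apply hne
    obtain ⟨h2, h3⟩ := segment_disjoint (hR e) (hR e') h0 h1 h0' h1' h
    apply Subtype.ext
    rw [hab e, hab e', Fin.ext h2, Fin.ext h3]

theorem graph_connected (M : ℕ) (hM : 1 ≤ M) : (graph M).Connected := by
  have h0 : ∀ v : ℕ, ∀ hv : v ≤ M, (graph M).Reachable ⟨0, by omega⟩ ⟨v, by omega⟩ := by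
    intro v
    induction v with
    | zero => intro _; rfl
    | succ v ih =>
      intro hv
      refine (ih (by omega)).trans (SimpleGraph.Adj.reachable ?_)
      exact Or.inl ⟨by simp; omega, by simp⟩
  have h1 : ∀ v : Fin (M + 3), (graph M).Reachable ⟨0, by omega⟩ v := by
    rintro ⟨v, hv⟩
    by_cases h : v ≤ M
    · exact h0 v h
    · refine SimpleGraph.Adj.reachable (Or.inl ⟨by simp; omega, ?_⟩)
      simp only
      omega
  exact { preconnected := fun u v => (h1 u).symm.trans (h1 v), nonempty := ⟨⟨0, by omega⟩⟩ }

/-! ### Edge weights and the gap between distances 20 and 21. -/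

/-- The weight of the edge from `u` to `v`, where `u < v`. -/
def orientedWeight (M : ℕ) (x y : ℕ → ℕ) (u v : ℕ) : ℕ :=
  if v = M + 1 then x u else if v = M + 2 then y u else 21

/-- The edge weights: `x u` and `y u` for the edges to the hubs, `21` for those of the path. -/
def weight (M : ℕ) (x y : ℕ → ℕ) : Sym2 (Fin (M + 3)) → ℕ :=
  Sym2.lift ⟨fun u v => orientedWeight M x y (min (u : ℕ) v) (max (u : ℕ) v),
    fun u v => by simp only [min_comm, max_comm]⟩

theorem Rel.lt {M u v : ℕ} (h : Rel M u v) : u < v := by unfold Rel at h; omega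

theorem weight_mk {M : ℕ} (x y : ℕ → ℕ) {u v : Fin (M + 3)} (h : Rel M u v) :
    weight M x y s(u, v) = orientedWeight M x y u v := by
  have : (u : ℕ) ≤ v := h.lt.le
  simp [weight, min_eq_left this, max_eq_right this]

theorem weight_bounds {M : ℕ} {x y : ℕ → ℕ} (hx : ∀ v < M, 7 ≤ x v ∧ x v ≤ 14)
    (hy : ∀ v < M, 7 ≤ y v ∧ y v ≤ 14) (e) (he : e ∈ (graph M).edgeSet) :
    1 ≤ weight M x y e ∧ weight M x y e ≤ 21 := by
  obtain ⟨u, v, h, hR⟩ := exists_edge_ends ⟨e, he⟩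
  simp only at h
  subst h
  rw [weight_mk x y hR]
  have := hx u hR.1
  have := hy u hR.1
  unfold orientedWeight
  split_ifs <;> omega

/-- The distance from `p`, cut off at `21`. -/
def potential (M : ℕ) (x y : ℕ → ℕ) (p v : ℕ) : ℕ :=
  if v = p then 0 else if v = M + 1 then x p else if v = M + 2 then y p else
    if v = M then 21 else min 21 (min (x p + x v) (y p + y v))

/-- The potential is 1-Lipschitz along edges. An edge of the line cannot violate this, as its weight
21 is the cutoff. At a hub the detour through the other hub must not be a shortcut: x p ≤ 14 = 7 + 7
≤ y p + y u, which is why weights lie between 7 and 14. -/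
theorem potential_le_add {M : ℕ} {x y : ℕ → ℕ} (hx : ∀ v < M, 7 ≤ x v ∧ x v ≤ 14)
    (hy : ∀ v < M, 7 ≤ y v ∧ y v ≤ 14) {p : ℕ} (hp : p < M) {u v : ℕ} (h : Rel M u v) :
    potential M x y p v ≤ potential M x y p u + orientedWeight M x y u v ∧
    potential M x y p u ≤ potential M x y p v + orientedWeight M x y u v := by
  have hxp := hx p hp
  have hyp := hy p hp
  have hxu := hx u h.1
  have hyu := hy u h.1
  obtain ⟨hu, rfl | rfl | rfl⟩ := h
  · have h1 : ∀ w, w ≤ M → potential M x y p w ≤ 21 := by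
      intro w hw
      unfold potential
      split_ifs <;> omega
    have := h1 u (by omega)
    have := h1 (u + 1) (by omega)
    have : orientedWeight M x y u (u + 1) = 21 := by
      unfold orientedWeight
      rw [if_neg (by omega), if_neg (by omega)]
    omega
  · have h1 : potential M x y p (M + 1) = x p := by
      unfold potential
      rw [if_neg (by omega), if_pos rfl]
    have h2 : orientedWeight M x y u (M + 1) = x u := by simp [orientedWeight]
    rw [h1, h2]
    unfold potential
    split_ifs <;> first | omega | (subst_vars; omega)
  · have h1 : potential M x y p (M + 2) = y p := by
      unfold potential
      rw [if_neg (by omega), if_neg (by omega), if_pos rfl]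
    have h2 : orientedWeight M x y u (M + 2) = y u := by simp [orientedWeight]
    rw [h1, h2]
    unfold potential
    split_ifs <;> first | omega | (subst_vars; omega)

theorem potential_le_walk {M : ℕ} {x y : ℕ → ℕ} (hx : ∀ v < M, 7 ≤ x v ∧ x v ≤ 14)
    (hy : ∀ v < M, 7 ≤ y v ∧ y v ≤ 14) {p : ℕ} (hp : p < M) {u v : Fin (M + 3)}
    (w : (graph M).Walk u v) :
    potential M x y p v ≤ potential M x y p u + (w.edges.map (weight M x y)).sum := by
  induction w with
  | nil => simp
  | cons h w ih =>
    rename_i a b c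
    rw [SimpleGraph.Walk.edges_cons, List.map_cons, List.sum_cons]
    rcases h with h | h
    · rw [weight_mk x y h]
      have := (potential_le_add hx hy hp h).1
      omega
    · rw [Sym2.eq_swap, weight_mk x y h]
      have := (potential_le_add hx hy hp h).2
      omega

theorem le_dist {M : ℕ} {x y : ℕ → ℕ} (hx : ∀ v < M, 7 ≤ x v ∧ x v ≤ 14)
    (hy : ∀ v < M, 7 ≤ y v ∧ y v ≤ 14) {p q : Fin (M + 3)} (hp : (p : ℕ) < M) (hq : (q : ℕ) < M)
    (hpq : p ≠ q) (h1 : 20 < x p + x q) (h2 : 20 < y p + y q) :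
    21 ≤ (graph M).weightedDist (weight M x y) p q := by
  refine le_iInf fun w => ?_
  have h := potential_le_walk hx hy hp w
  have hpq' : (q : ℕ) ≠ p := fun h => hpq (Fin.ext h.symm)
  have e1 : potential M x y p p = 0 := by simp [potential]
  have e2 : potential M x y p q = 21 := by
    unfold potential
    rw [if_neg hpq', if_neg (by omega), if_neg (by omega), if_neg (by omega)]
    omega
  rw [e1, e2, zero_add] at h
  exact_mod_cast h

theorem dist_le_of_hub {M : ℕ} {x y : ℕ → ℕ} {p q c : Fin (M + 3)} (hp : Rel M p c)
    (hq : Rel M q c) {r : ℕ} (h : orientedWeight M x y p c + orientedWeight M x y q c ≤ r) :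
    (graph M).weightedDist (weight M x y) p q ≤ r := by
  have hp' : (graph M).Adj p c := Or.inl hp
  have hq' : (graph M).Adj c q := Or.inr hq
  refine (iInf_le _ (.cons hp' (.cons hq' .nil))).trans ?_
  rw [SimpleGraph.Walk.edges_cons, SimpleGraph.Walk.edges_cons, SimpleGraph.Walk.edges_nil,
    List.map_cons, List.map_cons, List.map_nil, List.sum_cons, List.sum_cons, List.sum_nil,
    weight_mk x y hp, Sym2.eq_swap, weight_mk x y hq]
  exact_mod_cast h

theorem dist_le {M : ℕ} {x y : ℕ → ℕ} {p q : Fin (M + 3)} (hp : (p : ℕ) < M) (hq : (q : ℕ) < M)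
    (h : x p + x q ≤ 20 ∨ y p + y q ≤ 20) :
    (graph M).weightedDist (weight M x y) p q ≤ 20 := by
  rcases h with h | h
  · refine dist_le_of_hub (c := ⟨M + 1, by omega⟩) (r := 20) ⟨hp, by simp⟩ ⟨hq, by simp⟩ ?_
    simpa [orientedWeight] using h
  · refine dist_le_of_hub (c := ⟨M + 2, by omega⟩) (r := 20) ⟨hp, by simp⟩ ⟨hq, by simp⟩ ?_
    simpa [orientedWeight] using h

/-! ### The instance, its edge list and its input words. -/

/-- The instance with weights `x`, `y`: the paths `0, …, n - 1` and `n, …, n + m - 1`. -/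
def pathPair (n m : ℕ) (x y : ℕ → ℕ) (hM : 22 ≤ n + m)
    (hx : ∀ v < n + m, 7 ≤ x v ∧ x v ≤ 14) (hy : ∀ v < n + m, 7 ≤ y v ∧ y v ≤ 14) :
    PlanarPathPair n m where
  N := n + m + 3
  G := graph (n + m)
  weight := weight (n + m) x y
  P i := ⟨i, by omega⟩
  Q j := ⟨n + j, by omega⟩
  planar := graph_planar _
  connected := graph_connected _ (by omega)
  weight_pos e he := (weight_bounds hx hy e he).1
  weight_le e he := (weight_bounds hx hy e he).2.trans (by omega)
  isPath_P := ⟨fun i j h => by simpa [Fin.ext_iff] using h,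
    fun i j h => Or.inl ⟨by simp; omega, Or.inl (by simpa using h)⟩⟩
  isPath_Q := ⟨fun i j h => by simpa [Fin.ext_iff] using h,
    fun i j h => Or.inl ⟨by simp, Or.inl (by simp; omega)⟩⟩

/-- The edges leaving the path vertex `v` to larger vertices. -/
def edgesFrom (M : ℕ) (v : Fin M) : List (Fin (M + 3) × Fin (M + 3)) :=
  [(⟨v, by omega⟩, ⟨v + 1, by omega⟩), (⟨v, by omega⟩, ⟨M + 1, by omega⟩),
    (⟨v, by omega⟩, ⟨M + 2, by omega⟩)]

/-- All edges of the graph. -/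
def edgeList (M : ℕ) : List (Fin (M + 3) × Fin (M + 3)) :=
  (List.finRange M).flatMap (edgesFrom M)

theorem mem_edgeList {M : ℕ} (e : Fin (M + 3) × Fin (M + 3)) :
    e ∈ edgeList M ↔ Rel M e.1 e.2 := by
  obtain ⟨⟨u, hu⟩, ⟨v, hv⟩⟩ := e
  simp only [edgeList, List.mem_flatMap, List.mem_finRange, true_and, edgesFrom, List.mem_cons,
    Prod.mk.injEq, Fin.mk.injEq, List.not_mem_nil, or_false, Rel]
  constructor
  · rintro ⟨w, h⟩
    have := w.2
    omega
  · rintro ⟨h, h'⟩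
    refine ⟨⟨u, h⟩, ?_⟩
    simpa using h'

theorem edgeList_nodup (M : ℕ) : (edgeList M).Nodup := by
  rw [edgeList, List.nodup_flatMap]
  refine ⟨fun v _ => ?_, ?_⟩
  · have := v.2
    simp [edgesFrom]
    omega
  · refine (List.nodup_finRange M).imp ?_
    intro u v huv e h1 h2
    apply huv
    have e1 : (e.1 : ℕ) = u := by
      simp only [edgesFrom, List.mem_cons, List.not_mem_nil, or_false] at h1
      rcases h1 with rfl | rfl | rfl <;> rfl
    have e2 : (e.1 : ℕ) = v := by
      simp only [edgesFrom, List.mem_cons, List.not_mem_nil, or_false] at h2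
      rcases h2 with rfl | rfl | rfl <;> rfl
    exact Fin.ext (e1.symm.trans e2)

theorem edgeList_length (M : ℕ) : (edgeList M).length = 3 * M := by
  simp [edgeList, List.length_flatMap, edgesFrom, mul_comm]

theorem isEdgeList_edgeList {n m : ℕ} {x y : ℕ → ℕ} (hM : 22 ≤ n + m)
    (hx : ∀ v < n + m, 7 ≤ x v ∧ x v ≤ 14) (hy : ∀ v < n + m, 7 ≤ y v ∧ y v ≤ 14) :
    (pathPair n m x y hM hx hy).IsEdgeList (edgeList (n + m)) := by
  refine ⟨?_, ?_⟩
  · refine List.Nodup.map_on ?_ (edgeList_nodup (n + m))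
    rintro ⟨a, b⟩ h ⟨c, d⟩ h' he
    have h1 := ((mem_edgeList _).1 h).lt
    have h2 := ((mem_edgeList _).1 h').lt
    simp only at h1 h2 he
    rcases Sym2.eq_iff.1 he with ⟨rfl, rfl⟩ | ⟨rfl, rfl⟩
    · rfl
    · omega
  · intro e
    constructor
    · intro h
      obtain ⟨e', h1, rfl⟩ := List.mem_map.1 h
      exact Or.inl ((mem_edgeList e').1 h1)
    · intro h
      obtain ⟨u, v, h1, h2⟩ := exists_edge_ends ⟨e, h⟩
      exact List.mem_map.2 ⟨(u, v), (mem_edgeList (u, v)).2 h2, h1.symm⟩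

/-- The input words that describe the edges leaving the path vertex `v`. -/
def edgeWords (M : ℕ) (x y : ℕ → ℕ) (v : ℕ) : List ℕ :=
  [v, v + 1, 21, v, M + 1, x v, v, M + 2, y v]

/-- This is the list that the program has to write. The extra vertex n + m at the end of the line
lies on neither path; thanks to it every path vertex contributes the same pattern of nine words. -/
theorem encode_pathPair {n m : ℕ} {x y : ℕ → ℕ} (hM : 22 ≤ n + m)
    (hx : ∀ v < n + m, 7 ≤ x v ∧ x v ≤ 14) (hy : ∀ v < n + m, 7 ≤ y v ∧ y v ≤ 14) :
    (pathPair n m x y hM hx hy).encode (edgeList (n + m)) =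
      [n + m + 3, 3 * (n + m), n, m] ++ (List.range (n + m)).flatMap (edgeWords (n + m) x y)
        ++ List.range (n + m) := by
  have h1 : (edgeList (n + m)).flatMap
      (fun e => [(e.1 : ℕ), (e.2 : ℕ), weight (n + m) x y s(e.1, e.2)]) =
      (List.range (n + m)).flatMap (edgeWords (n + m) x y) := by
    rw [edgeList, List.flatMap_assoc, ← List.map_coe_finRange_eq_range, List.flatMap_map]
    congr 1
    funext v
    have hv := v.2
    simp only [edgesFrom, List.flatMap_cons, List.flatMap_nil, edgeWords]
    rw [weight_mk (u := ⟨v, by omega⟩) (v := ⟨v + 1, by omega⟩) x y ⟨hv, by simp⟩,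
      weight_mk (u := ⟨v, by omega⟩) (v := ⟨n + m + 1, by omega⟩) x y ⟨hv, by simp⟩,
      weight_mk (u := ⟨v, by omega⟩) (v := ⟨n + m + 2, by omega⟩) x y ⟨hv, by simp⟩]
    have : (v : ℕ) ≠ n + m := by omega
    have : (v : ℕ) ≠ n + m + 1 := by omega
    simp [orientedWeight, *]
  have h2 : List.ofFn (fun i : Fin n => (i : ℕ)) ++ List.ofFn (fun j : Fin m => n + (j : ℕ)) =
      List.range (n + m) := by
    rw [List.range_add]
    congr 1
    · rw [← List.map_coe_finRange_eq_range, List.ofFn_eq_map]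
    · rw [← List.map_coe_finRange_eq_range, List.map_map, List.ofFn_eq_map]; rfl
  rw [← h1, ← h2]
  simp only [PlanarPathPair.encode, pathPair, edgeList_length, List.append_assoc]

/-- If every monotone walk meets a far pair, the Fréchet distance is at least `21`. -/
theorem le_frechetDist {n m : ℕ} {x y : ℕ → ℕ} (hM : 22 ≤ n + m)
    (hx : ∀ v < n + m, 7 ≤ x v ∧ x v ≤ 14) (hy : ∀ v < n + m, 7 ≤ y v ∧ y v ≤ 14)
    (h : ∀ F : List (Fin n × Fin m), IsMonotoneWalk F → ∃ a ∈ F,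
      20 < x a.1 + x (n + a.2) ∧ 20 < y a.1 + y (n + a.2)) :
    21 ≤ (pathPair n m x y hM hx hy).frechetDist := by
  refine le_iInf fun F => ?_
  obtain ⟨a, ha, h1, h2⟩ := h F.1 F.2
  refine le_trans ?_ (le_iSup₂ (f := fun a _ => _) a ha)
  refine le_dist hx hy ?_ ?_ ?_ h1 h2
  · simp [pathPair]; omega
  · simp [pathPair]
  · simp [pathPair]; omega

/-- If some monotone walk meets near pairs only, the Fréchet distance is at most `20`. -/
theorem frechetDist_le {n m : ℕ} {x y : ℕ → ℕ} (hM : 22 ≤ n + m)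
    (hx : ∀ v < n + m, 7 ≤ x v ∧ x v ≤ 14) (hy : ∀ v < n + m, 7 ≤ y v ∧ y v ≤ 14)
    {F : List (Fin n × Fin m)} (hF : IsMonotoneWalk F)
    (h : ∀ a ∈ F, x a.1 + x (n + a.2) ≤ 20 ∨ y a.1 + y (n + a.2) ≤ 20) :
    (pathPair n m x y hM hx hy).frechetDist ≤ 20 := by
  refine (iInf_le _ ⟨F, hF⟩).trans (iSup₂_le fun a ha => ?_)
  refine dist_le ?_ ?_ (h a ha)
  · simp [pathPair]; omega
  · simp [pathPair]

end TwoHub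

/-! ### Paths that encode families of vectors -/

namespace TwoHub

/-- The two hub weights of the `t`-th vertex of a path for `r` vectors of dimension `d`: a vertex
near everything, then for every vector a separator and its coordinates, a last separator, and from
there on vertices near everything. -/
def pLabel (d r : ℕ) (bit : ℕ → ℕ → ℕ) (t : ℕ) : ℕ × ℕ :=
  if t < 1 then (9, 9) else
  if t < 2 then (13, 14) else
  if t - 1 < r * (d + 1) then
    if (t - 1) % (d + 1) < 1 then (13, 13) else
    if ((t - 1) % (d + 1) - 1) % 2 < 1 then
      (10 + bit ((t - 1) / (d + 1)) ((t - 1) % (d + 1) - 1), 12)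
    else (12, 10 + bit ((t - 1) / (d + 1)) ((t - 1) % (d + 1) - 1))
  else if t - 1 < r * (d + 1) + 1 then (14, 13) else (9, 9)

/-- The two hub weights of the `t`-th vertex of the other path, for `r` vectors of dimension `d`:
every vector has a separator before and another kind of separator behind it. -/
def qLabel (d r : ℕ) (bit : ℕ → ℕ → ℕ) (t : ℕ) : ℕ × ℕ :=
  if t < r * (d + 2) then
    if t % (d + 2) < 1 then (7, 11) else
    if t % (d + 2) < d + 1 then
      if (t % (d + 2) - 1) % 2 < 1 then (9 + bit (t / (d + 2)) (t % (d + 2) - 1), 11)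
      else (11, 9 + bit (t / (d + 2)) (t % (d + 2) - 1))
    else (11, 7)
  else (11, 7)

/-! ### Near pairs and the values of the labels. -/

/-- Two vertices with these hub weights are at distance at most `20`. -/
def Near (a b : ℕ × ℕ) : Prop := a.1 + b.1 ≤ 20 ∨ a.2 + b.2 ≤ 20

variable {d r : ℕ} {bit : ℕ → ℕ → ℕ}

theorem pLabel_bounds (hbit : ∀ i l, bit i l ≤ 1) (t : ℕ) :
    (7 ≤ (pLabel d r bit t).1 ∧ (pLabel d r bit t).1 ≤ 14) ∧
    (7 ≤ (pLabel d r bit t).2 ∧ (pLabel d r bit t).2 ≤ 14) := by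
  have := hbit ((t - 1) / (d + 1)) ((t - 1) % (d + 1) - 1)
  unfold pLabel
  split_ifs <;> simp only <;> omega

/-- The upper bound 11 makes the label (9, 9) near every vertex of the second path. The lower bound
7 makes (13, 14) near only to first weight 7, and (14, 13) only to second weight 7. -/
theorem qLabel_bounds (hbit : ∀ i l, bit i l ≤ 1) (t : ℕ) :
    (7 ≤ (qLabel d r bit t).1 ∧ (qLabel d r bit t).1 ≤ 11) ∧
    (7 ≤ (qLabel d r bit t).2 ∧ (qLabel d r bit t).2 ≤ 11) := by
  have := hbit (t / (d + 2)) (t % (d + 2) - 1)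
  unfold qLabel
  split_ifs <;> simp only <;> omega

theorem add_mul_mod_of_lt {k s i : ℕ} (h : s < k) : (i * k + s) % k = s := by
  rw [Nat.mul_add_mod', Nat.mod_eq_of_lt h]

theorem add_mul_div_of_lt {k s i : ℕ} (h : s < k) : (i * k + s) / k = i := by
  rw [mul_comm, Nat.mul_add_div (by omega), Nat.div_eq_of_lt h, add_zero]

theorem mul_add_lt_mul {k s i r : ℕ} (h : s < k) (hi : i < r) : i * k + s < r * k := by
  have : (i + 1) * k ≤ r * k := Nat.mul_le_mul_right _ hi
  rw [Nat.succ_mul] at this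
  omega

theorem pLabel_zero : pLabel d r bit 0 = (9, 9) := by simp [pLabel]

theorem pLabel_one : pLabel d r bit 1 = (13, 14) := by simp [pLabel]

theorem pLabel_last (hr : 1 ≤ r) : pLabel d r bit (1 + r * (d + 1)) = (14, 13) := by
  have : 1 * (d + 1) ≤ r * (d + 1) := Nat.mul_le_mul_right _ hr
  unfold pLabel
  rw [if_neg (by omega), if_neg (by omega), if_neg (by omega), if_pos (by omega)]

theorem pLabel_of_gt {t : ℕ} (hr : 1 ≤ r) (ht : 1 + r * (d + 1) < t) :
    pLabel d r bit t = (9, 9) := by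
  have : 1 * (d + 1) ≤ r * (d + 1) := Nat.mul_le_mul_right _ hr
  unfold pLabel
  rw [if_neg (by omega), if_neg (by omega), if_neg (by omega), if_neg (by omega)]

theorem pLabel_separator {j : ℕ} (hj : j < r) (hj' : j ≠ 0) :
    pLabel d r bit (1 + j * (d + 1)) = (13, 13) := by
  have h1 : 1 * (d + 1) ≤ j * (d + 1) := Nat.mul_le_mul_right _ (by omega)
  have h2 := mul_add_lt_mul (s := 0) (Nat.succ_pos d) hj
  have h3 := add_mul_mod_of_lt (i := j) (Nat.succ_pos d)
  simp only [Nat.succ_eq_add_one, add_zero] at h2 h3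
  unfold pLabel
  rw [if_neg (by omega), if_neg (by omega), Nat.add_sub_cancel_left, if_pos h2, if_pos (by omega)]

theorem pLabel_coord {j l : ℕ} (hj : j < r) (hl : l < d) :
    pLabel d r bit (1 + (j * (d + 1) + (1 + l))) =
      if l % 2 = 0 then (10 + bit j l, 12) else (12, 10 + bit j l) := by
  have h2 := mul_add_lt_mul (k := d + 1) (s := 1 + l) (by omega) hj
  have h3 := add_mul_mod_of_lt (k := d + 1) (i := j) (s := 1 + l) (by omega)
  have h4 := add_mul_div_of_lt (k := d + 1) (i := j) (s := 1 + l) (by omega)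
  unfold pLabel
  rw [if_neg (by omega), if_neg (by omega), Nat.add_sub_cancel_left, if_pos h2, h3, h4,
    if_neg (by omega), Nat.add_sub_cancel_left]
  split_ifs <;> first | rfl | omega

theorem qLabel_coord {i l : ℕ} (hi : i < r) (hl : l < d) :
    qLabel d r bit (i * (d + 2) + (1 + l)) =
      if l % 2 = 0 then (9 + bit i l, 11) else (11, 9 + bit i l) := by
  have h2 := mul_add_lt_mul (k := d + 2) (s := 1 + l) (by omega) hi
  have h3 := add_mul_mod_of_lt (k := d + 2) (i := i) (s := 1 + l) (by omega)
  have h4 := add_mul_div_of_lt (k := d + 2) (i := i) (s := 1 + l) (by omega)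
  unfold qLabel
  rw [if_pos h2, h3, h4, if_neg (by omega), if_pos (by omega), Nat.add_sub_cancel_left]
  split_ifs <;> first | rfl | omega

theorem qLabel_before {i : ℕ} (hi : i < r) : qLabel d r bit (i * (d + 2)) = (7, 11) := by
  have h2 := mul_add_lt_mul (k := d + 2) (s := 0) (by omega) hi
  have h3 := add_mul_mod_of_lt (k := d + 2) (i := i) (s := 0) (by omega)
  rw [add_zero] at h2 h3
  unfold qLabel
  rw [if_pos h2, if_pos (by omega)]

theorem qLabel_behind {i : ℕ} (hi : i < r) :
    qLabel d r bit (i * (d + 2) + (d + 1)) = (11, 7) := by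
  have h2 := mul_add_lt_mul (k := d + 2) (s := d + 1) (by omega) hi
  have h3 := add_mul_mod_of_lt (k := d + 2) (i := i) (s := d + 1) (by omega)
  unfold qLabel
  rw [if_pos h2, if_neg (by omega), if_neg (by omega)]

/-! ### Near walks force an orthogonal pair. -/

theorem exists_eq_of_qLabel_fst_le (hbit : ∀ i l, bit i l ≤ 1) {t : ℕ}
    (h : (qLabel d r bit t).1 ≤ 7) : ∃ i < r, t = i * (d + 2) := by
  by_cases h1 : t < r * (d + 2)
  · by_cases h2 : t % (d + 2) < 1
    · refine ⟨t / (d + 2), Nat.div_lt_of_lt_mul (by rwa [mul_comm]), ?_⟩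
      have := Nat.div_add_mod t (d + 2)
      rw [mul_comm] at this
      omega
    · have := hbit (t / (d + 2)) (t % (d + 2) - 1)
      unfold qLabel at h
      rw [if_pos h1, if_neg h2] at h
      split_ifs at h <;> simp only at h <;> omega
  · simp [qLabel, h1] at h

/-- Between the separator before vector i and the one behind it, second weights are at least 9.
Hence a walk that stands before i and later meets second weight 7 has passed all coordinates of i.
-/
theorem le_of_qLabel_snd_le {i t : ℕ} (hi : i < r)
    (h : (qLabel d r bit t).2 ≤ 7) (ht : i * (d + 2) ≤ t) : i * (d + 2) + (d + 1) ≤ t := by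
  by_contra hlt
  obtain ⟨s, rfl⟩ := Nat.exists_eq_add_of_le ht
  rcases s with _ | s
  · rw [add_zero, qLabel_before hi] at h
    simp at h
  · rw [show s + 1 = 1 + s by omega, qLabel_coord hi (by omega)] at h
    split_ifs at h
    · simp at h
    · have h' : 9 + bit i s ≤ 7 := h
      omega

/-- Separators of the first path have both weights at least 13, and 13 + 9 > 20 rules them out.
Coordinates of different parity give sums of at least 21 at both hubs. For equal parity one hub
gives at least 23 and the other 19 plus the two bits. -/
theorem coord_of_near {n₁ m₁ : ℕ} {bitA bitB : ℕ → ℕ → ℕ} (hA : ∀ i l, bitA i l ≤ 1)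
    {i l s : ℕ} (hi : i < n₁) (hl : l < d) (hm : 1 ≤ m₁) (hs : 1 ≤ s) (hs' : s ≤ 1 + m₁ * (d + 1))
    (h : Near (pLabel d m₁ bitB s) (qLabel d n₁ bitA (i * (d + 2) + (1 + l)))) :
    ∃ j < m₁, ∃ l' < d, s = 1 + (j * (d + 1) + (1 + l')) ∧ l' % 2 = l % 2 ∧
      (bitA i l = 0 ∨ bitB j l' = 0) := by
  have hb := hA i l
  have hq : ∀ a : ℕ × ℕ, 13 ≤ a.1 → 13 ≤ a.2 →
      ¬ Near a (if l % 2 = 0 then (9 + bitA i l, 11) else (11, 9 + bitA i l)) := by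
    intro a h1 h2 h3
    unfold Near at h3
    split_ifs at h3 <;> simp only at h3 <;> omega
  rw [qLabel_coord hi hl] at h
  rcases Nat.lt_or_ge (s - 1) (m₁ * (d + 1)) with hlt | hge
  · have hdm := Nat.div_add_mod (s - 1) (d + 1)
    rw [mul_comm] at hdm
    have hj : (s - 1) / (d + 1) < m₁ := Nat.div_lt_of_lt_mul (by rwa [mul_comm])
    have hmod : (s - 1) % (d + 1) < d + 1 := Nat.mod_lt _ (Nat.succ_pos d)
    generalize (s - 1) / (d + 1) = j at *
    generalize (s - 1) % (d + 1) = p at *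
    rcases p with _ | l'
    · exfalso
      obtain rfl : s = 1 + j * (d + 1) := by omega
      rcases Nat.eq_zero_or_pos j with rfl | hj'
      · rw [Nat.zero_mul, add_zero, pLabel_one] at h
        exact hq _ (by norm_num) (by norm_num) h
      · rw [pLabel_separator hj (by omega)] at h
        exact hq _ (by norm_num) (by norm_num) h
    · obtain rfl : s = 1 + (j * (d + 1) + (1 + l')) := by omega
      have hl' : l' < d := by omega
      refine ⟨j, hj, l', hl', rfl, ?_⟩
      rw [pLabel_coord hj hl'] at h
      unfold Near at h
      split_ifs at h <;> simp only at h <;> omega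
  · exfalso
    obtain rfl : s = 1 + m₁ * (d + 1) := by omega
    rw [pLabel_last hm] at h
    exact hq _ (by norm_num) (by norm_num) h

/-- Consecutive blocks are separated by one position that is not a coordinate, so a single step from
coordinate to coordinate stays in its block. -/
theorem block_step {k j j' a b : ℕ} (ha : a < k) (hb : b < k)
    (h1 : j * (k + 1) + (1 + a) ≤ j' * (k + 1) + (1 + b))
    (h2 : j' * (k + 1) + (1 + b) ≤ j * (k + 1) + (1 + a) + 1) : j' = j := by
  rcases Nat.lt_trichotomy j j' with h | h | h
  · have : (j + 1) * (k + 1) ≤ j' * (k + 1) := Nat.mul_le_mul_right _ h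
    rw [Nat.succ_mul] at this
    omega
  · exact h.symm
  · have : (j' + 1) * (k + 1) ≤ j * (k + 1) := Nat.mul_le_mul_right _ h
    rw [Nat.succ_mul] at this
    omega

/-- A discrete intermediate value theorem. -/
theorem exists_eq_of_step {f : ℕ → ℕ} (hf : ∀ t, f (t + 1) ≤ f t + 1) {a b c : ℕ} (hab : a ≤ b)
    (h1 : f a ≤ c) (h2 : c ≤ f b) : ∃ t, a ≤ t ∧ t ≤ b ∧ f t = c := by
  induction b, hab using Nat.le_induction with
  | base => exact ⟨a, le_rfl, le_rfl, by omega⟩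
  | succ b hab ih =>
    rcases Nat.lt_or_ge (f b) c with h | h
    · exact ⟨b + 1, by omega, le_rfl, by have := hf b; omega⟩
    · obtain ⟨t, h3, h4, h5⟩ := ih h
      exact ⟨t, h3, by omega, h5⟩

/-- A walk through near pairs only passes by an orthogonal pair of vectors. -/
theorem exists_orthogonal {n₁ m₁ : ℕ} {bitA bitB : ℕ → ℕ → ℕ} (hA : ∀ i l, bitA i l ≤ 1)
    (hm : 1 ≤ m₁) {f g : ℕ → ℕ}
    {T : ℕ} (hf : ∀ t, f t ≤ f (t + 1) ∧ f (t + 1) ≤ f t + 1)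
    (hg : ∀ t, g t ≤ g (t + 1) ∧ g (t + 1) ≤ g t + 1) (hf0 : f 0 = 0)
    (hfT : 1 + m₁ * (d + 1) ≤ f T)
    (hnear : ∀ t ≤ T, Near (pLabel d m₁ bitB (f t)) (qLabel d n₁ bitA (g t))) :
    ∃ i < n₁, ∃ j < m₁, ∀ l < d, bitA i l = 0 ∨ bitB j l = 0 := by
  have fmono : Monotone f := monotone_nat_of_le_succ fun t => (hf t).1
  have gmono : Monotone g := monotone_nat_of_le_succ fun t => (hg t).1
  -- Moments at which the first path is at its first separator (13, 14) and at its last one (14,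
  -- 13). They pin the second path before a vector i and then no earlier than behind it.
  obtain ⟨t₁, -, ht₁, hft₁⟩ := exists_eq_of_step (fun t => (hf t).2) (Nat.zero_le T)
    (c := 1) (by omega) (by omega)
  obtain ⟨t₂, h12, ht₂, hft₂⟩ := exists_eq_of_step (fun t => (hf t).2) ht₁
    (c := 1 + m₁ * (d + 1)) (by omega) hfT
  obtain ⟨i, hi, hgt₁⟩ : ∃ i < n₁, g t₁ = i * (d + 2) := by
    have h := hnear t₁ ht₁
    rw [hft₁, pLabel_one] at h
    refine exists_eq_of_qLabel_fst_le hA ?_ (bit := bitA)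
    have := (qLabel_bounds (d := d) (r := n₁) hA (g t₁)).2.1
    unfold Near at h
    simp only at h
    omega
  have hgt₂ : i * (d + 2) + (d + 1) ≤ g t₂ := by
    have h := hnear t₂ ht₂
    rw [hft₂, pLabel_last hm] at h
    refine le_of_qLabel_snd_le hi ?_ (hgt₁ ▸ gmono h12) (bit := bitA)
    have := (qLabel_bounds (d := d) (r := n₁) hA (g t₂)).1.1
    unfold Near at h
    simp only at h
    omega
  rcases Nat.eq_zero_or_pos d with rfl | hd
  · exact ⟨i, hi, 0, hm, fun l hl => by omega⟩
  have coord : ∀ t, t₁ ≤ t → t ≤ t₂ → ∀ l < d, g t = i * (d + 2) + (1 + l) →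
      ∃ j < m₁, ∃ l' < d, f t = 1 + (j * (d + 1) + (1 + l')) ∧ l' % 2 = l % 2 ∧
      (bitA i l = 0 ∨ bitB j l' = 0) := by
    intro t h1 h2 l hl hgt
    have h := hnear t (h2.trans ht₂)
    rw [hgt] at h
    exact coord_of_near hA hi hl hm (hft₁ ▸ fmono h1) (hft₂ ▸ fmono h2) h
  -- When the second path is at coordinate 0 of vector i, the first one is at some coordinate e of a
  -- vector j, with e even. A priori e need not be 0.
  obtain ⟨t₃, h13, h32, hgt₃⟩ := exists_eq_of_step (fun t => (hg t).2) h12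
    (c := i * (d + 2) + (1 + 0)) (by omega) (by omega)
  obtain ⟨j, hj, e, he, hft₃, he_even, -⟩ := coord t₃ h13 h32 0 hd hgt₃
  have lockstep : ∀ t, t₃ ≤ t → t ≤ t₂ → g t ≤ i * (d + 2) + d →
      ∃ l l', l < d ∧ l' < d ∧ g t = i * (d + 2) + (1 + l) ∧
        f t = 1 + (j * (d + 1) + (1 + l')) ∧ l' = l + e ∧ (bitA i l = 0 ∨ bitB j l' = 0) := by
    intro t h3
    induction t, h3 using Nat.le_induction with
    | base =>
      intro _ _
      obtain ⟨j', hj', l', hl', h1, -, h2⟩ := coord t₃ h13 h32 0 hd hgt₃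
      refine ⟨0, e, hd, he, hgt₃, hft₃, by omega, ?_⟩
      obtain rfl : j' = j := block_step he hl' (by omega) (by omega)
      obtain rfl : l' = e := by omega
      exact h2
    | succ t h3 ih =>
      intro ht hgt
      have hgs := hg t
      have hfs := hf t
      obtain ⟨l, l', hl, hl', h1, h2, h4, -⟩ := ih (by omega) (by omega)
      obtain ⟨l₂, hl₂⟩ : ∃ l₂, g (t + 1) = i * (d + 2) + (1 + l₂) :=
        ⟨g (t + 1) - (i * (d + 2) + 1), by omega⟩
      have hl₂d : l₂ < d := by omega
      obtain ⟨j₃, hj₃, l₃, hl₃, h5, h6, h7⟩ := coord (t + 1) (by omega) ht l₂ hl₂d hl₂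
      obtain rfl : j₃ = j := block_step hl' hl₃ (by omega) (by omega)
      have h8 : l₃ = l' ∨ l₃ = l' + 1 := by omega
      have h9 : l₂ = l ∨ l₂ = l + 1 := by omega
      -- Each index stays or grows by one, and their parities agree before and after the step, so
      -- both stay or both advance.
      have h10 : l₃ = l₂ + e := by
        clear * - h8 h9 h4 h6 he_even
        omega
      exact ⟨l₂, l₃, hl₂d, hl₃, hl₂, h5, h10, h7⟩
  have visit : ∀ l < d, l + e < d ∧ (bitA i l = 0 ∨ bitB j (l + e) = 0) := by
    intro l hl
    obtain ⟨t, h1, h2, h3⟩ := exists_eq_of_step (fun t => (hg t).2) h32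
      (c := i * (d + 2) + (1 + l)) (by omega) (by omega)
    obtain ⟨l₁, l', hl₁, hl', h4, -, h6, h7⟩ := lockstep t h1 h2 (by omega)
    obtain rfl : l = l₁ := by omega
    subst h6
    exact ⟨hl', h7⟩
  refine ⟨i, hi, j, hj, fun l hl => ?_⟩
  -- At the last coordinate the partner d - 1 + e still has to be below d, so the offset vanishes.
  have h1 := (visit (d - 1) (by omega)).1
  obtain rfl : e = 0 := by omega
  exact (visit l hl).2

/-! ### An orthogonal pair gives a near walk. -/

theorem ramps_step {a b c A B C : ℕ} (h₁ : a + A ≤ b) (h₂ : b + B ≤ c) (t : ℕ) :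
    min (t + 1 - a) A + min (t + 1 - b) B + min (t + 1 - c) C =
      min (t - a) A + min (t - b) B + min (t - c) C ∨
    min (t + 1 - a) A + min (t + 1 - b) B + min (t + 1 - c) C =
      min (t - a) A + min (t - b) B + min (t - c) C + 1 := by
  rcases Nat.lt_or_ge t b with h | h
  · have : t + 1 - b = 0 := by omega
    have : t - b = 0 := by omega
    have : t + 1 - c = 0 := by omega
    have : t - c = 0 := by omega
    simp only [*]
    omega
  · have : min (t + 1 - a) A = A := by omega
    have : min (t - a) A = A := by omega
    simp only [*]
    omega

/-- A monotone walk through near pairs only, along an orthogonal pair of vectors. -/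
theorem exists_walk {n m n₁ m₁ : ℕ} {bitA bitB : ℕ → ℕ → ℕ} (hA : ∀ i l, bitA i l ≤ 1)
    (hB : ∀ i l, bitB i l ≤ 1) (hn : m₁ * (d + 1) + 3 ≤ n) (hm : n₁ * (d + 2) ≤ m)
    {i j : ℕ} (hi : i < n₁) (hj : j < m₁) (h : ∀ l < d, bitA i l = 0 ∨ bitB j l = 0) :
    ∃ F : List (Fin n × Fin m), IsMonotoneWalk F ∧
      ∀ a ∈ F, Near (pLabel d m₁ bitB a.1) (qLabel d n₁ bitA a.2) := by
  have hm₁ : 1 ≤ m₁ := by omega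
  have hf₀ : (j + 1) * (d + 1) ≤ m₁ * (d + 1) := Nat.mul_le_mul_right _ hj
  have hg₀ : (i + 1) * (d + 2) ≤ n₁ * (d + 2) := Nat.mul_le_mul_right _ hi
  rw [Nat.succ_mul] at hf₀ hg₀
  obtain ⟨f₀, hf₀'⟩ : ∃ f₀, f₀ = j * (d + 1) := ⟨_, rfl⟩
  obtain ⟨g₀, hg₀'⟩ : ∃ g₀, g₀ = i * (d + 2) := ⟨_, rfl⟩
  rw [← hf₀'] at hf₀
  rw [← hg₀'] at hg₀
  -- The five phases: the second path advances g₀ steps, the first 1 + f₀ steps, both d + 1 steps,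
  -- the first to its end, the second to its end. Each position is a sum of three ramps that are
  -- active one after another.
  obtain ⟨f, hf⟩ : ∃ f : ℕ → ℕ, ∀ t, f t = min (t - g₀) (1 + f₀) +
      min (t - (g₀ + 1 + f₀)) (d + 1) +
      min (t - (g₀ + 1 + f₀ + (d + 1))) (n - 1 - (1 + f₀ + (d + 1))) := ⟨_, fun _ => rfl⟩
  obtain ⟨g, hg⟩ : ∃ g : ℕ → ℕ, ∀ t, g t = min t g₀ + min (t - (g₀ + 1 + f₀)) (d + 1) +
      min (t - (g₀ + 1 + f₀ + (d + 1) + (n - 1 - (1 + f₀ + (d + 1))))) (m - 1 - (g₀ + (d + 1))) :=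
    ⟨_, fun _ => rfl⟩
  have hfn : ∀ t, f t < n := fun t => by rw [hf]; omega
  have hgm : ∀ t, g t < m := fun t => by rw [hg]; omega
  obtain ⟨T, hT⟩ : ∃ T, T = g₀ + 1 + f₀ + (d + 1) + (n - 1 - (1 + f₀ + (d + 1))) +
      (m - 1 - (g₀ + (d + 1))) := ⟨_, rfl⟩
  refine ⟨(List.range (T + 1)).map fun t => (⟨f t, hfn t⟩, ⟨g t, hgm t⟩), ⟨?_, ?_, ?_⟩, ?_⟩
  · refine ⟨(⟨f 0, hfn 0⟩, ⟨g 0, hgm 0⟩), by simp [List.head?_range], ?_, ?_⟩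
    · simp only [hf]; omega
    · simp only [hg]; omega
  · refine ⟨(⟨f T, hfn T⟩, ⟨g T, hgm T⟩), by simp [List.getLast?_range], ?_, ?_⟩
    · simp only [hf]; omega
    · simp only [hg]; omega
  · rw [List.isChain_iff_getElem]
    intro t ht
    simp only [List.getElem_map, List.getElem_range, hf, hg]
    refine ⟨ramps_step (by omega) (by omega) t, ?_⟩
    simpa only [Nat.sub_zero] using ramps_step (a := 0) (A := g₀) (by omega) (by omega) t
  · intro a ha
    obtain ⟨t, -, rfl⟩ := List.mem_map.1 ha
    simp only
    have hq := qLabel_bounds (d := d) (r := n₁) hA (g t)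
    -- Only the last separator has first weight 14, and only the first separator has second weight
    -- 14. So (7, 11) is near everything up to vector j, and (11, 7) is near everything from
    -- position 2 on.
    have hfirst : ∀ s, s ≤ f₀ + 1 → (pLabel d m₁ bitB s).1 ≤ 13 := by
      intro s hs
      have := hB ((s - 1) / (d + 1)) ((s - 1) % (d + 1) - 1)
      unfold pLabel
      split_ifs <;> simp only <;> omega
    have hsecond : ∀ s, 2 ≤ s → (pLabel d m₁ bitB s).2 ≤ 13 := by
      intro s hs
      have := hB ((s - 1) / (d + 1)) ((s - 1) % (d + 1) - 1)
      unfold pLabel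
      split_ifs <;> simp only <;> omega
    rcases Nat.lt_or_ge g₀ t with h1 | h1
    · rcases Nat.lt_or_ge (g₀ + 1 + f₀) t with h2 | h2
      · rcases Nat.lt_or_ge t (g₀ + 1 + f₀ + (d + 1)) with h3 | h3
        · obtain ⟨l, rfl⟩ : ∃ l, t = g₀ + 1 + f₀ + (1 + l) := ⟨t - (g₀ + 1 + f₀ + 1), by omega⟩
          have e1 : f (g₀ + 1 + f₀ + (1 + l)) = 1 + (j * (d + 1) + (1 + l)) := by
            rw [hf, ← hf₀']; omega
          have e2 : g (g₀ + 1 + f₀ + (1 + l)) = i * (d + 2) + (1 + l) := by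
            rw [hg, ← hg₀']; omega
          have hl : l < d := by omega
          rw [e1, e2, pLabel_coord hj hl, qLabel_coord hi hl]
          have := h l hl
          have := hA i l
          have := hB j l
          unfold Near
          split_ifs <;> simp only <;> omega
        · rcases Nat.lt_or_ge (g₀ + 1 + f₀ + (d + 1) + (n - 1 - (1 + f₀ + (d + 1)))) t
            with h4 | h4
          · have e1 : f t = n - 1 := by rw [hf]; omega
            rw [e1, pLabel_of_gt hm₁ (by omega)]
            exact Or.inl (by simp only; omega)
          · have e2 : g t = i * (d + 2) + (d + 1) := by rw [hg, ← hg₀']; omega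
            rw [e2, qLabel_behind hi]
            have := hsecond (f t) (by rw [hf]; omega)
            exact Or.inr (by simp only; omega)
      · have e2 : g t = i * (d + 2) := by rw [hg, ← hg₀']; omega
        rw [e2, qLabel_before hi]
        have := hfirst (f t) (by rw [hf]; omega)
        exact Or.inl (by simp only; omega)
    · have e1 : f t = 0 := by rw [hf]; omega
      rw [e1, pLabel_zero]
      exact Or.inl (by simp only; omega)

/-- Every monotone walk through near pairs only passes by an orthogonal pair of vectors. -/
theorem exists_orthogonal_of_isMonotoneWalk {n m n₁ m₁ : ℕ} {bitA bitB : ℕ → ℕ → ℕ}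
    (hA : ∀ i l, bitA i l ≤ 1) (hn : m₁ * (d + 1) + 3 ≤ n) (hm₁ : 1 ≤ m₁)
    {F : List (Fin n × Fin m)} (hF : IsMonotoneWalk F)
    (hnear : ∀ a ∈ F, Near (pLabel d m₁ bitB a.1) (qLabel d n₁ bitA a.2)) :
    ∃ i < n₁, ∃ j < m₁, ∀ l < d, bitA i l = 0 ∨ bitB j l = 0 := by
  obtain ⟨a, ha, ha1, ha2⟩ := hF.first
  obtain ⟨b, hb, hb1, hb2⟩ := hF.last
  have hne : F ≠ [] := by rintro rfl; simp at ha
  have hlen : 0 < F.length := List.length_pos_of_ne_nil hne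
  obtain ⟨T, hT⟩ : ∃ T, F.length = T + 1 := ⟨F.length - 1, by omega⟩
  -- The walk is continued by repeating its last entry, which makes the two positions functions on
  -- all natural numbers.
  have hlt : ∀ t, min t T < F.length := fun t => by omega
  have hstep : ∀ t, (((F[min (t + 1) T]'(hlt _)).1 : ℕ) = (F[min t T]'(hlt _)).1 ∨
      ((F[min (t + 1) T]'(hlt _)).1 : ℕ) = (F[min t T]'(hlt _)).1 + 1) ∧
      (((F[min (t + 1) T]'(hlt _)).2 : ℕ) = (F[min t T]'(hlt _)).2 ∨
      ((F[min (t + 1) T]'(hlt _)).2 : ℕ) = (F[min t T]'(hlt _)).2 + 1) := by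
    intro t
    rcases Nat.lt_or_ge t T with h | h
    · have h1 : min t T = t := by omega
      have h2 : min (t + 1) T = t + 1 := by omega
      simp only [h1, h2]
      exact List.isChain_iff_getElem.1 hF.step t (by omega)
    · have h1 : min t T = T := by omega
      have h2 : min (t + 1) T = T := by omega
      simp only [h1, h2, true_or, and_self]
  refine exists_orthogonal (T := T) (f := fun t => (F[min t T]'(hlt _)).1)
    (g := fun t => (F[min t T]'(hlt _)).2) hA hm₁ ?_ ?_ ?_ ?_ ?_
  · intro t
    have := (hstep t).1
    omega
  · intro t
    have := (hstep t).2
    omega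
  · rw [List.head?_eq_getElem?, List.getElem?_eq_getElem hlen, Option.some.injEq] at ha
    simp only [Nat.zero_min, ha, ha1]
  · rw [List.getLast?_eq_getElem?, List.getElem?_eq_getElem (by omega), Option.some.injEq] at hb
    have h1 : F.length - 1 = T := by omega
    simp only [h1] at hb
    simp only [min_self, hb]
    omega
  · intro t _
    exact hnear _ (List.getElem_mem _)

end TwoHub

/-! ### Verified code for the word RAM -/

namespace WordRAM

/-- All registers and memory cells hold numbers below `W`. -/
def Bounded (W : ℕ) (r m : ℕ → ℕ) : Prop := (∀ i, r i < W) ∧ ∀ i, m i < W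

theorem forall_update_lt {W : ℕ} {r : ℕ → ℕ} (h : ∀ i, r i < W) {j x : ℕ} (hx : x < W) :
    ∀ i, Function.update r j x i < W := by
  intro i
  by_cases hi : i = j
  · rw [hi, Function.update_self]; exact hx
  · rw [Function.update_of_ne hi]; exact h i

/-- `t` steps of the program `P` lead from `c` to `c'`, through words below `W` only. -/
inductive Run (P : Program) (W : ℕ) : ℕ → Config → Config → Prop
  | refl {c : Config} (h : Bounded W c.reg c.mem) : Run P W 0 c c
  | step {t : ℕ} {c c' : Config} (h : Bounded W c.reg c.mem) (r : Run P W t (P.step c) c') :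
      Run P W (t + 1) c c'

namespace Run

variable {P : Program} {W : ℕ}

theorem trans {t t' : ℕ} {c c' c'' : Config} (h : Run P W t c c') (h' : Run P W t' c' c'') :
    Run P W (t + t') c c'' := by
  induction h with
  | refl _ => simpa using h'
  | step hb _ ih => rw [Nat.add_right_comm]; exact .step hb (ih h')

theorem bounded_right {t : ℕ} {c c' : Config} (h : Run P W t c c') :
    Bounded W c'.reg c'.mem := by
  induction h with
  | refl h => exact h
  | step _ _ ih => exact ih

theorem iterate_eq {t : ℕ} {c c' : Config} (h : Run P W t c c') : P.step^[t] c = c' := by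
  induction h with
  | refl _ => rfl
  | step _ _ ih => rw [Function.iterate_succ_apply, ih]

theorem bounded_iterate {t : ℕ} {c c' : Config} (h : Run P W t c c') :
    ∀ s ≤ t, Bounded W (P.step^[s] c).reg (P.step^[s] c).mem := by
  induction h with
  | refl h =>
    intro s hs
    obtain rfl : s = 0 := by omega
    exact h
  | step h _ ih =>
    intro s hs
    rcases s with _ | s
    · exact h
    · rw [Function.iterate_succ_apply]
      exact ih s (by omega)

end Run

/-- The instructions `l` are part of the program `P`, from number `b` on. -/
def HasCode (P : Program) (b : ℕ) (l : List Instr) : Prop :=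
  ∃ l₁ l₂, P = l₁ ++ l ++ l₂ ∧ l₁.length = b

namespace HasCode

variable {P : Program} {b : ℕ} {l l' : List Instr}

theorem left (h : HasCode P b (l ++ l')) : HasCode P b l := by
  obtain ⟨l₁, l₂, rfl, rfl⟩ := h
  exact ⟨l₁, l' ++ l₂, by simp, rfl⟩

theorem right (h : HasCode P b (l ++ l')) : HasCode P (b + l.length) l' := by
  obtain ⟨l₁, l₂, rfl, rfl⟩ := h
  exact ⟨l₁ ++ l, l₂, by simp, by simp⟩

theorem getElem? (h : HasCode P b l) {i : ℕ} (hi : i < l.length) : P[b + i]? = some l[i] := by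
  obtain ⟨l₁, l₂, rfl, rfl⟩ := h
  rw [List.append_assoc, List.getElem?_append_right (by omega), Nat.add_sub_cancel_left,
    List.getElem?_append_left hi, List.getElem?_eq_getElem hi]

theorem step_eq (h : HasCode P b l) {i : ℕ} (hi : i < l.length) (r m : ℕ → ℕ) :
    P.step ⟨b + i, r, m⟩ = l[i].exec ⟨b + i, r, m⟩ := by
  simp [Program.step, h.getElem? hi]

end HasCode

/-- A piece of code, depending on the number of its first instruction. -/
abbrev Frag := ℕ → List Instr

/-- Started with registers `r` and memory `m`, the code `f` runs for at most `T` steps to its end,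
through words below `W` only, and registers and memory satisfy `Q` then. -/
def Triple (W T : ℕ) (f : Frag) (r m : ℕ → ℕ) (Q : (ℕ → ℕ) → (ℕ → ℕ) → Prop) : Prop :=
  ∀ P b, HasCode P b (f b) → Bounded W r m → ∃ t ≤ T, ∃ r' m',
    Run P W t ⟨b, r, m⟩ ⟨b + (f b).length, r', m'⟩ ∧ Q r' m'

/-- Composition of code. -/
def Frag.seq (f g : Frag) : Frag := fun b => f b ++ g (b + (f b).length)

/-- A single instruction. -/
def Frag.instr (i : Instr) : Frag := fun _ => [i]

/-- `if R[x] < R[y] then f else g`, where the registers `z` and `z + 2` are scratch. -/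
def Frag.branch (x y z : ℕ) (f g : Frag) : Frag := fun b =>
  let k := (g (b + 1)).length
  [.jlt x y (b + 1 + k + 3)] ++ (g (b + 1) ++ ([.const z 0, .const (z + 2) 1,
    .jlt z (z + 2) (b + 1 + k + 3 + (f (b + 1 + k + 3)).length)] ++ f (b + 1 + k + 3)))

/-- `do f while R[x] < R[y]`. -/
def Frag.loop (x y : ℕ) (f : Frag) : Frag := fun b => f b ++ [.jlt x y b]

namespace Triple

variable {W T T' : ℕ} {f g : Frag} {r m : ℕ → ℕ} {Q Q' : (ℕ → ℕ) → (ℕ → ℕ) → Prop}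

theorem mono (h : Triple W T f r m Q) (hT : T ≤ T') (hQ : ∀ r m, Q r m → Q' r m) :
    Triple W T' f r m Q' := by
  intro P b hP hb
  obtain ⟨t, ht, r', m', h1, h2⟩ := h P b hP hb
  exact ⟨t, ht.trans hT, r', m', h1, hQ _ _ h2⟩

theorem seq (h : Triple W T f r m Q)
    (h' : ∀ r' m', Q r' m' → Triple W T' g r' m' Q') : Triple W (T + T') (f.seq g) r m Q' := by
  intro P b hP hb
  obtain ⟨t, ht, r', m', h1, h2⟩ := h P b hP.left hb
  obtain ⟨t', ht', r'', m'', h3, h4⟩ := h' r' m' h2 P _ hP.right h1.bounded_right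
  refine ⟨t + t', by omega, r'', m'', h1.trans ?_, h4⟩
  simpa [Frag.seq, add_assoc] using h3

theorem const {dst c : ℕ} (hc : c < W) (hQ : Q (Function.update r dst c) m) :
    Triple W 1 (.instr (.const dst c)) r m Q := by
  intro P b hP hb
  refine ⟨1, le_rfl, _, _, .step hb ?_, hQ⟩
  have := hP.step_eq (i := 0) (by simp [Frag.instr]) r m
  simp only [add_zero] at this
  rw [this]
  exact .refl ⟨forall_update_lt hb.1 hc, hb.2⟩

theorem op {o : Op} {dst x y : ℕ} (hc : o.eval (r x) (r y) < W)
    (hQ : Q (Function.update r dst (o.eval (r x) (r y))) m) :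
    Triple W 1 (.instr (.op o dst x y)) r m Q := by
  intro P b hP hb
  refine ⟨1, le_rfl, _, _, .step hb ?_, hQ⟩
  have := hP.step_eq (i := 0) (by simp [Frag.instr]) r m
  simp only [add_zero] at this
  rw [this]
  exact .refl ⟨forall_update_lt hb.1 hc, hb.2⟩

theorem load {dst x : ℕ} (hQ : Q (Function.update r dst (m (r x))) m) :
    Triple W 1 (.instr (.load dst x)) r m Q := by
  intro P b hP hb
  refine ⟨1, le_rfl, _, _, .step hb ?_, hQ⟩
  have := hP.step_eq (i := 0) (by simp [Frag.instr]) r m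
  simp only [add_zero] at this
  rw [this]
  exact .refl ⟨forall_update_lt hb.1 (hb.2 _), hb.2⟩

theorem store {x y : ℕ} (hQ : Q r (Function.update m (r x) (r y))) :
    Triple W 1 (.instr (.store x y)) r m Q := by
  intro P b hP hb
  refine ⟨1, le_rfl, _, _, .step hb ?_, hQ⟩
  have := hP.step_eq (i := 0) (by simp [Frag.instr]) r m
  simp only [add_zero] at this
  rw [this]
  exact .refl ⟨hb.1, forall_update_lt hb.2 (hb.1 _)⟩

/-- The code of `g` comes first and is followed by an unconditional jump over `f`, made from 0 < 1
in the scratch registers. This is why the condition on `g` mentions two updates. -/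
theorem branch {x y z : ℕ} (hW : 1 < W)
    (hf : r x < r y → Triple W T f r m Q)
    (hg : ¬ r x < r y → Triple W T g r m
      (fun r' m' => Q (Function.update (Function.update r' z 0) (z + 2) 1) m')) :
    Triple W (T + 4) (.branch x y z f g) r m Q := by
  intro P b hP hb
  have h0 := hP.left.step_eq (i := 0) (by simp) r m
  simp only [add_zero, List.getElem_cons_zero, Instr.exec] at h0
  have hPg := hP.right.left
  have hPj := hP.right.right.left
  have hPf := hP.right.right.right
  simp only [List.length_cons, List.length_nil, zero_add] at hPg hPj hPf
  by_cases h : r x < r y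
  · rw [if_pos h] at h0
    obtain ⟨t, ht, r', m', h1, h2⟩ := hf h P _ hPf hb
    refine ⟨t + 1, by omega, r', m', .step hb ?_, h2⟩
    rw [h0]
    convert h1 using 2
    simp [Frag.branch]
    omega
  · rw [if_neg h] at h0
    obtain ⟨t, ht, r', m', h1, h2⟩ := hg h P _ hPg hb
    refine ⟨t + 3 + 1, by omega, _, _, .step hb ?_, h2⟩
    rw [h0]
    refine h1.trans ?_
    have e0 := hPj.step_eq (i := 0) (by simp)
    have e1 := hPj.step_eq (i := 1) (by simp)
    have e2 := hPj.step_eq (i := 2) (by simp)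
    simp only [add_zero, List.getElem_cons_zero, List.getElem_cons_succ, Instr.exec] at e0 e1 e2
    have hb' := h1.bounded_right
    have hb1 : Bounded W (Function.update r' z 0) m' :=
      ⟨forall_update_lt hb'.1 (by omega), hb'.2⟩
    have hb2 : Bounded W (Function.update (Function.update r' z 0) (z + 2) 1) m' :=
      ⟨forall_update_lt hb1.1 hW, hb'.2⟩
    refine .step hb' ?_
    rw [e0]
    refine .step hb1 ?_
    rw [e1]
    refine .step hb2 ?_
    rw [show b + 1 + (g (b + 1)).length + 1 + 1 = b + 1 + (g (b + 1)).length + 2 from rfl, e2]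
    have : (Function.update (Function.update r' z 0) (z + 2) 1) z <
        (Function.update (Function.update r' z 0) (z + 2) 1) (z + 2) := by simp
    have hlen : b + (Frag.branch x y z f g b).length =
        b + 1 + (g (b + 1)).length + 3 + (f (b + 1 + (g (b + 1)).length + 3)).length := by
      simp [Frag.branch]
      omega
    rw [if_pos this, hlen]
    exact .refl hb2

/-- The invariant is indexed by the number of completed passes. The test comes after the body, so
there is at least one pass. -/
theorem loop {x y k : ℕ} {I : ℕ → (ℕ → ℕ) → (ℕ → ℕ) → Prop}
    (hbody : ∀ i < k, ∀ r m, I i r m → Triple W T f r m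
      (fun r' m' => I (i + 1) r' m' ∧ (r' x < r' y ↔ i + 1 < k))) (hk : 1 ≤ k) (h0 : I 0 r m) :
    Triple W (k * (T + 1)) (.loop x y f) r m (I k) := by
  intro P b hP hb
  have main : ∀ j, ∀ i, i + j = k → 1 ≤ j → ∀ r m, Bounded W r m → I i r m →
      ∃ t ≤ j * (T + 1), ∃ r' m', Run P W t ⟨b, r, m⟩ ⟨b + (Frag.loop x y f b).length, r', m'⟩ ∧
        I k r' m' := by
    intro j
    induction j with
    | zero => intro _ _ h; omega
    | succ j ih =>
      intro i hij _ r m hb hI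
      obtain ⟨t, ht, r', m', h1, h2, h3⟩ := hbody i (by omega) r m hI P b hP.left hb
      have h4 := hP.right.step_eq (i := 0) (by simp) r' m'
      simp only [add_zero, List.getElem_cons_zero, Instr.exec] at h4
      rcases Nat.eq_zero_or_pos j with rfl | hj
      · rw [if_neg (by omega)] at h4
        refine ⟨t + 1, by omega, r', m', h1.trans (.step h1.bounded_right ?_), ?_⟩
        · rw [h4]
          have hlen : b + (Frag.loop x y f b).length = b + (f b).length + 1 := by
            simp [Frag.loop, add_assoc]
          rw [hlen]
          exact .refl h1.bounded_right
        · rw [← hij]; exact h2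
      · rw [if_pos (by omega)] at h4
        obtain ⟨t', ht', r'', m'', h5, h6⟩ := ih (i + 1) (by omega) hj r' m' h1.bounded_right h2
        refine ⟨t + (t' + 1), ?_, r'', m'', h1.trans (.step h1.bounded_right ?_), h6⟩
        · rw [Nat.succ_mul]; omega
        · rw [h4]; exact h5
  exact main k 0 (by omega) hk r m hb h0

end Triple

/-! #### Expressions -/

/-- The arithmetic operations used in expressions. -/
inductive Arith where
  | add | sub | mul | div | mod

/-- The machine operation. -/
def Arith.op : Arith → Op
  | .add => .add
  | .sub => .sub
  | .mul => .mul
  | .div => .div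
  | .mod => .mod

/-- Expressions over variables and memory; `ite a b c d` is `if a < b then c else d`. -/
inductive Expr where
  | var (i : ℕ)
  | lit (c : ℕ)
  | app (o : Arith) (a b : Expr)
  | mem (a : Expr)
  | ite (a b c d : Expr)

namespace Expr

/-- The value of an expression. -/
def eval (v m : ℕ → ℕ) : Expr → ℕ
  | var i => v i
  | lit c => c
  | app o a b => o.op.eval (a.eval v m) (b.eval v m)
  | mem a => m (a.eval v m)
  | ite a b c d => if a.eval v m < b.eval v m then c.eval v m else d.eval v m

/-- All intermediate values are below `W`. -/
def Fits (W : ℕ) (v m : ℕ → ℕ) : Expr → Prop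
  | var _ => True
  | lit c => c < W
  | app o a b => a.Fits W v m ∧ b.Fits W v m ∧ o.op.eval (a.eval v m) (b.eval v m) < W
  | mem a => a.Fits W v m
  | ite a b c d => a.Fits W v m ∧ b.Fits W v m ∧ c.Fits W v m ∧ d.Fits W v m

/-- A bound for the number of instructions. -/
def cost : Expr → ℕ
  | var _ => 1
  | lit _ => 1
  | app _ a b => a.cost + (b.cost + 1)
  | mem a => a.cost + 1
  | ite a b c d => a.cost + (b.cost + (c.cost + d.cost + 4))

/-- The depth of an expression. -/
def depth : Expr → ℕ
  | var _ => 0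
  | lit _ => 0
  | app _ a b => max a.depth b.depth + 1
  | mem a => a.depth + 1
  -- A case distinction returns one of two values and creates no larger one, so it does not add to
  -- the depth.
  | ite a b c d => max (max a.depth b.depth) (max c.depth d.depth)

/-- The largest constant of an expression. -/
def maxLit : Expr → ℕ
  | var _ => 0
  | lit c => c
  | app _ a b => max a.maxLit b.maxLit
  | mem a => a.maxLit
  | ite a b c d => max (max a.maxLit b.maxLit) (max c.maxLit d.maxLit)

/-- Code that evaluates an expression into the `k`-th cell of a stack, which is kept in the
registers of odd number; the variables are the registers of even number. -/
def code : Expr → ℕ → Frag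
  -- The conjunction of a word with itself serves as a move between registers.
  | var i, k => .instr (.op .land (2 * k + 1) (2 * i) (2 * i))
  | lit c, k => .instr (.const (2 * k + 1) c)
  | app o a b, k => (a.code k).seq ((b.code (k + 1)).seq
      (.instr (.op o.op (2 * k + 1) (2 * k + 1) (2 * k + 3))))
  | mem a, k => (a.code k).seq (.instr (.load (2 * k + 1) (2 * k + 1)))
  | ite a b c d, k => (a.code k).seq ((b.code (k + 1)).seq
      (.branch (2 * k + 1) (2 * k + 3) (2 * k + 3) (c.code k) (d.code k)))

theorem arith_lt (o : Arith) {x y X : ℕ} (hX : 2 ≤ X) (hx : x < X) (hy : y < X) :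
    o.op.eval x y < X * X := by
  have h1 : 2 * X ≤ X * X := Nat.mul_le_mul_right _ hX
  cases o <;> simp only [Arith.op, Op.eval]
  · omega
  · omega
  · exact Nat.mul_lt_mul'' hx hy
  · have := Nat.div_le_self x y; omega
  · have := Nat.mod_le x y; omega

/-- Every arithmetic operation at most squares the bound, so depth D costs the exponent 2 ^ D.
Shifts to the left would break this; they are not among the operations of expressions. -/
theorem eval_lt_fits {B : ℕ} {v m : ℕ → ℕ} (hB : 2 ≤ B) (hv : ∀ i, v i < B) (hm : ∀ i, m i < B)
    {W : ℕ} {D : ℕ} (hW : B ^ 2 ^ D ≤ W) (e : Expr) (he : e.depth ≤ D) (hl : e.maxLit < B) :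
    e.eval v m < B ^ 2 ^ e.depth ∧ e.Fits W v m := by
  have hpow : ∀ {a b : ℕ}, a ≤ b → B ^ 2 ^ a ≤ B ^ 2 ^ b := fun h =>
    Nat.pow_le_pow_right (by omega) (Nat.pow_le_pow_right (by omega) h)
  have hbase : ∀ a, B ≤ B ^ 2 ^ a := fun a => by simpa using hpow (Nat.zero_le a)
  induction e with
  | var i => exact ⟨by simpa [depth, eval] using hv i, trivial⟩
  | lit c =>
    refine ⟨by simpa [depth, eval, maxLit] using hl, ?_⟩
    exact hl.trans_le ((hbase D).trans hW)
  | app o a b iha ihb =>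
    simp only [depth, maxLit] at he hl
    have ha := iha (by omega) (by omega)
    have hb := ihb (by omega) (by omega)
    have key : o.op.eval (a.eval v m) (b.eval v m) < B ^ 2 ^ (max a.depth b.depth + 1) := by
      rw [pow_succ 2, mul_two, pow_add]
      exact arith_lt o (hB.trans (hbase _)) (ha.1.trans_le (hpow (le_max_left _ _)))
        (hb.1.trans_le (hpow (le_max_right _ _)))
    exact ⟨key, ha.2, hb.2, key.trans_le ((hpow he).trans hW)⟩
  | mem a iha =>
    simp only [depth, maxLit] at he hl
    exact ⟨(hm _).trans_le (hbase _), (iha (by omega) (by omega)).2⟩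
  | ite a b c d iha ihb ihc ihd =>
    simp only [depth, maxLit] at he hl
    have ha := iha (by omega) (by omega)
    have hb := ihb (by omega) (by omega)
    have hc := ihc (by omega) (by omega)
    have hd := ihd (by omega) (by omega)
    refine ⟨?_, ha.2, hb.2, hc.2, hd.2⟩
    simp only [eval, depth]
    split_ifs
    · exact hc.1.trans_le (hpow (by omega))
    · exact hd.1.trans_le (hpow (by omega))

/-- Registers and memory agree with those before, but for stack cells from the `k`-th on. -/
def Frame (k : ℕ) (r m r' m' : ℕ → ℕ) : Prop :=
  m' = m ∧ (∀ i, r' (2 * i) = r (2 * i)) ∧ ∀ j < k, r' (2 * j + 1) = r (2 * j + 1)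

theorem Frame.refl (k : ℕ) (r m : ℕ → ℕ) : Frame k r m r m := ⟨rfl, fun _ => rfl, fun _ _ => rfl⟩

theorem Frame.trans {k k' : ℕ} {r m r' m' r'' m'' : ℕ → ℕ} (h : Frame k r m r' m')
    (h' : Frame k' r' m' r'' m'') (hk : k ≤ k') : Frame k r m r'' m'' :=
  ⟨h'.1.trans h.1, fun i => (h'.2.1 i).trans (h.2.1 i),
    fun j hj => (h'.2.2 j (by omega)).trans (h.2.2 j hj)⟩

theorem Frame.update {k j x : ℕ} {r m r' m' : ℕ → ℕ} (h : Frame k r m r' m') (hj : k ≤ j) :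
    Frame k r m (Function.update r' (2 * j + 1) x) m' := by
  refine ⟨h.1, fun i => ?_, fun i hi => ?_⟩
  · rw [Function.update_of_ne (by omega), h.2.1]
  · rw [Function.update_of_ne (by omega), h.2.2 i hi]

/-- Induction on the expression: a second operand is evaluated one stack cell higher, and the frame
condition keeps the first operand alive. -/
theorem code_spec {W : ℕ} (hW : 1 < W) (e : Expr) : ∀ (k : ℕ) (r m : ℕ → ℕ),
    e.Fits W (fun i => r (2 * i)) m → Triple W e.cost (e.code k) r m (fun r' m' =>
      Frame k r m r' m' ∧ r' (2 * k + 1) = e.eval (fun i => r (2 * i)) m) := by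
  induction e with
  | var i =>
    intro k r m _ P b hP hb
    refine Triple.op ?_ ⟨(Frame.refl k r m).update le_rfl, ?_⟩ P b hP hb
    · simpa [Op.eval] using hb.1 _
    · simp [Op.eval, eval]
  | lit c =>
    intro k r m hf
    refine Triple.const hf ⟨(Frame.refl k r m).update le_rfl, ?_⟩
    simp [eval]
  | app o a b iha ihb =>
    intro k r m hf
    refine (iha k r m hf.1).seq ?_
    rintro r₁ m₁ ⟨h1, h2⟩
    have e1 : (fun i => r₁ (2 * i)) = fun i => r (2 * i) := funext h1.2.1
    have e2 : m₁ = m := h1.1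
    have hf2 : b.Fits W (fun i => r₁ (2 * i)) m₁ := by rw [e1, e2]; exact hf.2.1
    refine (ihb (k + 1) r₁ m₁ hf2).seq ?_
    rintro r₂ m₂ ⟨h3, h4⟩
    rw [e1, e2] at h4
    have h5 := h3.2.2 k (by omega)
    rw [show 2 * (k + 1) + 1 = 2 * k + 3 by ring] at h4
    refine Triple.op ?_ ⟨(h1.trans h3 (by omega)).update le_rfl, ?_⟩
    · rw [h5, h2, h4]; exact hf.2.2
    · rw [h5, h2, h4, Function.update_self]; rfl
  | mem a iha =>
    intro k r m hf
    refine (iha k r m hf).seq ?_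
    rintro r₁ m₁ ⟨h1, h2⟩
    refine Triple.load ⟨h1.update le_rfl, ?_⟩
    rw [h2, h1.1, Function.update_self]; rfl
  | ite a b c d iha ihb ihc ihd =>
    intro k r m hf
    refine (iha k r m hf.1).seq ?_
    rintro r₁ m₁ ⟨h1, h2⟩
    have e1 : (fun i => r₁ (2 * i)) = fun i => r (2 * i) := funext h1.2.1
    have e2 : m₁ = m := h1.1
    have hf2 : b.Fits W (fun i => r₁ (2 * i)) m₁ := by rw [e1, e2]; exact hf.2.1
    refine (ihb (k + 1) r₁ m₁ hf2).seq ?_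
    rintro r₂ m₂ ⟨h3, h4⟩
    rw [e1, e2] at h4
    have h5 := h3.2.2 k (by omega)
    rw [show 2 * (k + 1) + 1 = 2 * k + 3 by ring] at h4
    have h6 := h1.trans h3 (by omega)
    have e3 : (fun i => r₂ (2 * i)) = fun i => r (2 * i) := funext h6.2.1
    have e4 : m₂ = m := h6.1
    refine Triple.branch hW (fun h => ?_) (fun h => ?_)
    · have hf3 : c.Fits W (fun i => r₂ (2 * i)) m₂ := by rw [e3, e4]; exact hf.2.2.1
      refine (ihc k r₂ m₂ hf3).mono (by omega) ?_
      rintro r₃ m₃ ⟨h7, h8⟩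
      refine ⟨h6.trans h7 le_rfl, ?_⟩
      rw [h5, h2, h4] at h
      rw [h8, e3, e4, eval, if_pos h]
    · have hf3 : d.Fits W (fun i => r₂ (2 * i)) m₂ := by rw [e3, e4]; exact hf.2.2.2
      refine (ihd k r₂ m₂ hf3).mono (by omega) ?_
      rintro r₃ m₃ ⟨h7, h8⟩
      rw [h5, h2, h4] at h
      refine ⟨((h6.trans h7 le_rfl).update (j := k + 1) (by omega)).update (j := k + 2) (by omega), ?_⟩
      rw [Function.update_of_ne (by omega), Function.update_of_ne (by omega), h8, e3, e4, eval,
        if_neg h]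

end Expr

/-! #### Commands -/

/-- Started with variables `v` and memory `m`, the code `f` runs for at most `T` steps, and
variables and memory satisfy `Q` then. -/
def Hoare (W T : ℕ) (f : Frag) (v m : ℕ → ℕ) (Q : (ℕ → ℕ) → (ℕ → ℕ) → Prop) : Prop :=
  ∀ r, (∀ i, r (2 * i) = v i) → Triple W T f r m (fun r' m' => Q (fun i => r' (2 * i)) m')

/-- `i := e` -/
def Frag.assign (i : ℕ) (e : Expr) : Frag := (e.code 0).seq (.instr (.op .land (2 * i) 1 1))

/-- `M[a] := e` -/
def Frag.put (a e : Expr) : Frag := (a.code 0).seq ((e.code 1).seq (.instr (.store 1 3)))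

/-- `if a < b then f else g` -/
def Frag.ifLt (a b : Expr) (f g : Frag) : Frag :=
  (a.code 0).seq ((b.code 1).seq (.branch 1 3 1 f g))

/-- `do f while a < b` -/
def Frag.doWhile (f : Frag) (a b : Expr) : Frag :=
  .loop 1 3 (f.seq ((a.code 0).seq (b.code 1)))

namespace Hoare

variable {W T T' : ℕ} {f g : Frag} {v m : ℕ → ℕ} {Q Q' : (ℕ → ℕ) → (ℕ → ℕ) → Prop}

theorem mono (h : Hoare W T f v m Q) (hT : T ≤ T') (hQ : ∀ v m, Q v m → Q' v m) :
    Hoare W T' f v m Q' :=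
  fun r hr => (h r hr).mono hT fun _ _ => hQ _ _

theorem seq (h : Hoare W T f v m Q) (h' : ∀ v' m', Q v' m' → Hoare W T' g v' m' Q') :
    Hoare W (T + T') (f.seq g) v m Q' :=
  fun r hr => (h r hr).seq fun _ _ hQ => h' _ _ hQ _ fun _ => rfl

theorem assign (hW : 1 < W) {i : ℕ} {e : Expr} (he : e.Fits W v m)
    (hQ : Q (Function.update v i (e.eval v m)) m) :
    Hoare W (e.cost + 1) (.assign i e) v m Q := by
  intro r hr
  have e1 : (fun i => r (2 * i)) = v := funext hr
  subst e1
  refine (e.code_spec hW 0 r m he).seq ?_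
  rintro r₁ m₁ ⟨h1, h2⟩ P b hP hb
  refine Triple.op ?_ ?_ P b hP hb
  · simpa [Op.eval] using hb.1 _
  · convert hQ using 1
    · funext j
      simp only [mul_zero, zero_add] at h2
      by_cases hj : j = i
      · subst hj; simp [Op.eval, h2]
      · rw [Function.update_of_ne (by omega), Function.update_of_ne hj, h1.2.1]
    · exact h1.1

theorem put (hW : 1 < W) {a e : Expr} (ha : a.Fits W v m) (he : e.Fits W v m)
    (hQ : Q v (Function.update m (a.eval v m) (e.eval v m))) :
    Hoare W (a.cost + (e.cost + 1)) (.put a e) v m Q := by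
  intro r hr
  have e1 : (fun i => r (2 * i)) = v := funext hr
  subst e1
  refine (a.code_spec hW 0 r m ha).seq ?_
  rintro r₁ m₁ ⟨h1, h2⟩
  have e1 : (fun i => r₁ (2 * i)) = fun i => r (2 * i) := funext h1.2.1
  have e2 : m₁ = m := h1.1
  have he' : e.Fits W (fun i => r₁ (2 * i)) m₁ := by rw [e1, e2]; exact he
  refine (e.code_spec hW 1 r₁ m₁ he').seq ?_
  rintro r₂ m₂ ⟨h3, h4⟩
  have h5 := h3.2.2 0 (by omega)
  simp only [mul_zero, zero_add, mul_one, Nat.reduceAdd] at h2 h4 h5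
  refine Triple.store ?_
  rw [h5, h2, h4, e1, e2, h3.1, e2]
  have e3 : (fun i => r₂ (2 * i)) = fun i => r (2 * i) := (funext h3.2.1).trans e1
  rw [e3]
  exact hQ

theorem ifLt (hW : 1 < W) {a b : Expr} (ha : a.Fits W v m) (hb : b.Fits W v m)
    (hf : a.eval v m < b.eval v m → Hoare W T f v m Q)
    (hg : ¬ a.eval v m < b.eval v m → Hoare W T g v m Q) :
    Hoare W (a.cost + (b.cost + (T + 4))) (.ifLt a b f g) v m Q := by
  intro r hr
  have e1 : (fun i => r (2 * i)) = v := funext hr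
  subst e1
  refine (a.code_spec hW 0 r m ha).seq ?_
  rintro r₁ m₁ ⟨h1, h2⟩
  have e1 : (fun i => r₁ (2 * i)) = fun i => r (2 * i) := funext h1.2.1
  have e2 : m₁ = m := h1.1
  have hb' : b.Fits W (fun i => r₁ (2 * i)) m₁ := by rw [e1, e2]; exact hb
  refine (b.code_spec hW 1 r₁ m₁ hb').seq ?_
  rintro r₂ m₂ ⟨h3, h4⟩
  have h5 := h3.2.2 0 (by omega)
  simp only [mul_zero, zero_add, mul_one, Nat.reduceAdd] at h2 h4 h5
  rw [e1, e2] at h4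
  have e3 : ∀ i, r₂ (2 * i) = r (2 * i) := fun i => (h3.2.1 i).trans (h1.2.1 i)
  have e4 : m₂ = m := h3.1.trans e2
  subst e4
  refine Triple.branch hW (fun h => ?_) (fun h => ?_)
  · rw [h5, h2, h4] at h
    exact hf h r₂ e3
  · rw [h5, h2, h4] at h
    refine (hg h r₂ e3).mono le_rfl ?_
    intro r₃ m₃ h6
    convert h6 using 1
    funext i
    rw [Function.update_of_ne (by omega), Function.update_of_ne (by omega)]

theorem doWhile (hW : 1 < W) {a b : Expr} {k : ℕ} {I : ℕ → (ℕ → ℕ) → (ℕ → ℕ) → Prop}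
    (hbody : ∀ i < k, ∀ v m, I i v m → Hoare W T f v m (fun v' m' => I (i + 1) v' m' ∧
      a.Fits W v' m' ∧ b.Fits W v' m' ∧ (a.eval v' m' < b.eval v' m' ↔ i + 1 < k)))
    (hk : 1 ≤ k) (h0 : I 0 v m) :
    Hoare W (k * (T + (a.cost + b.cost) + 1)) (.doWhile f a b) v m (I k) := by
  intro r hr
  have e1 : (fun i => r (2 * i)) = v := funext hr
  subst e1
  refine Triple.loop (I := fun i r m => I i (fun j => r (2 * j)) m) ?_ hk h0
  intro i hi r m hI
  refine (hbody i hi _ m hI r fun _ => rfl).seq ?_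
  rintro r₀ m₀ ⟨hI', ha, hb, hlt⟩
  refine (a.code_spec hW 0 r₀ m₀ ha).seq ?_
  rintro r₁ m₁ ⟨h1, h2⟩
  have e1 : (fun i => r₁ (2 * i)) = fun i => r₀ (2 * i) := funext h1.2.1
  have e2 : m₁ = m₀ := h1.1
  have hb' : b.Fits W (fun i => r₁ (2 * i)) m₁ := by rw [e1, e2]; exact hb
  refine (b.code_spec hW 1 r₁ m₁ hb').mono le_rfl ?_
  rintro r₂ m₂ ⟨h3, h4⟩
  have h5 := h3.2.2 0 (by omega)
  simp only [mul_zero, zero_add, mul_one, Nat.reduceAdd] at h2 h4 h5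
  rw [e1, e2] at h4
  have e3 : (fun i => r₂ (2 * i)) = fun i => r₀ (2 * i) :=
    funext fun i => (h3.2.1 i).trans (h1.2.1 i)
  have e4 : m₂ = m₀ := h3.1.trans e2
  rw [e3, e4, h5, h2, h4]
  exact ⟨hI', hlt⟩

end Hoare

end WordRAM

/-! #### Calling another program -/

namespace WordRAM

/-- The register that holds register `i` of the called program. -/
def calleeReg (i : ℕ) : ℕ := 2 * (32 + i)

/-- Four instructions with the effect of a single one of the called program, whose memory cell `a`
is the cell `R[24] + a * R[14]`; `len` is the length of that program, `b` the number of the first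
instruction of its translation. -/
def simInstr (len b : ℕ) : Instr → List Instr
  | .const dst c => [.const (calleeReg dst) c, .const 1 0, .const 1 0, .const 1 0]
  | .op o dst x y => [.op o (calleeReg dst) (calleeReg x) (calleeReg y), .const 1 0, .const 1 0,
      .const 1 0]
  | .load dst a => [.op .mul 1 (calleeReg a) 14, .op .add 1 1 24, .load (calleeReg dst) 1,
      .const 1 0]
  | .store a x => [.op .mul 1 (calleeReg a) 14, .op .add 1 1 24, .store 1 (calleeReg x),
      .const 1 0]
  -- All translations have length four, which makes jump targets computable. Targets beyond the
  -- program, where the machine counts as halted, become the end of the translation.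
  | .jlt x y target => [.jlt (calleeReg x) (calleeReg y) (b + 4 * min target len), .const 1 0,
      .const 1 0, .const 1 0]
  | .halt => [.const 1 0, .const 3 1, .jlt 1 3 (b + 4 * len), .const 1 0]

theorem length_simInstr (len b : ℕ) (i : Instr) : (simInstr len b i).length = 4 := by
  cases i <;> rfl

/-- The translation of a program. -/
def Frag.call (p : Program) : Frag := fun b => p.flatMap (simInstr p.length b)

theorem length_flatMap_simInstr (len b : ℕ) (l : List Instr) :
    (l.flatMap (simInstr len b)).length = 4 * l.length := by
  induction l with
  | nil => rfl
  | cons i l ih => simp [length_simInstr, ih]; ring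

theorem HasCode.simInstr {P p : Program} {b : ℕ} (h : HasCode P b (Frag.call p b)) {i : ℕ}
    (hi : i < p.length) : HasCode P (b + 4 * i) (WordRAM.simInstr p.length b p[i]) := by
  have e : Frag.call p b = (p.take i).flatMap (WordRAM.simInstr p.length b) ++
      (WordRAM.simInstr p.length b p[i] ++
        (p.drop (i + 1)).flatMap (WordRAM.simInstr p.length b)) := by
    rw [Frag.call, ← List.flatMap_cons, ← List.flatMap_append, List.getElem_cons_drop,
      List.take_append_drop]
  rw [e] at h
  have h' := h.right.left
  rw [length_flatMap_simInstr, List.length_take, min_eq_left hi.le] at h'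
  exact h'

/-- Registers `r` and memory `m` represent the registers `sr` and the memory `sm` of the called
program; everything else is as given by the variables `v` and the memory `m₀`. -/
structure Represents (v m₀ sr sm r m : ℕ → ℕ) : Prop where
  own : ∀ i < 32, r (2 * i) = v i
  reg : ∀ i, r (calleeReg i) = sr i
  mem : ∀ a, m (v 12 + a * v 7) = sm a
  rest : ∀ x, (∀ a, x ≠ v 12 + a * v 7) → m x = m₀ x

namespace Represents

variable {v m₀ sr sm r m : ℕ → ℕ}

theorem update_odd (h : Represents v m₀ sr sm r m) (j x : ℕ) :
    Represents v m₀ sr sm (Function.update r (2 * j + 1) x) m where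
  own i hi := by rw [Function.update_of_ne (by omega), h.own i hi]
  reg i := by rw [Function.update_of_ne (by unfold calleeReg; omega), h.reg]
  mem := h.mem
  rest := h.rest

theorem update_reg (h : Represents v m₀ sr sm r m) (j x : ℕ) :
    Represents v m₀ (Function.update sr j x) sm (Function.update r (calleeReg j) x) m where
  own i hi := by rw [Function.update_of_ne (by unfold calleeReg; omega), h.own i hi]
  reg i := by
    by_cases hi : i = j
    · rw [hi, Function.update_self, Function.update_self]
    · rw [Function.update_of_ne (by unfold calleeReg; omega), Function.update_of_ne hi, h.reg]
  mem := h.mem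
  rest := h.rest

theorem update_mem (h : Represents v m₀ sr sm r m) (hK : 0 < v 7) (a x : ℕ) :
    Represents v m₀ sr (Function.update sm a x) r
      (Function.update m (v 12 + a * v 7) x) where
  own := h.own
  reg := h.reg
  mem i := by
    by_cases hi : i = a
    · rw [hi, Function.update_self, Function.update_self]
    · rw [Function.update_of_ne, Function.update_of_ne hi, h.mem]
      intro h
      exact hi (Nat.eq_of_mul_eq_mul_right hK (Nat.add_left_cancel h))
  rest y hy := by rw [Function.update_of_ne (hy a), h.rest y hy]

/-- The called program uses addresses below X only, so the translated ones stay below `v 12 + X * v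
7`. -/
theorem address_lt (h : Represents v m₀ sr sm r m) {X W : ℕ} (hK : 0 < v 7)
    (hW : v 12 + X * v 7 ≤ W) {a : ℕ} (ha : sr a < X) :
    r (calleeReg a) * r 14 < W ∧ r (calleeReg a) * r 14 + r 24 < W ∧
      r (calleeReg a) * r 14 + r 24 = v 12 + sr a * v 7 := by
  have e1 : r 14 = v 7 := h.own 7 (by norm_num)
  have e2 : r 24 = v 12 := h.own 12 (by norm_num)
  rw [h.reg, e1, e2]
  have : (sr a + 1) * v 7 ≤ X * v 7 := Nat.mul_le_mul_right _ ha
  rw [Nat.succ_mul] at this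
  omega

end Represents

/-- The two programs run in lockstep, four steps to one. Odd registers hold the address computation
and the padding, and are invisible to the representation. -/
theorem sim_step {P p : Program} {b X W : ℕ} {v m₀ : ℕ → ℕ} (hcode : HasCode P b (Frag.call p b))
    (hK : 0 < v 7) (hXW : X ≤ W) (hW : v 12 + X * v 7 ≤ W) (hW1 : 1 < W) (s : Config)
    (hs : Bounded X s.reg s.mem) (hs' : Bounded X (p.step s).reg (p.step s).mem)
    (hhalt : ¬ p.Halted s) {r m : ℕ → ℕ} (hb : Bounded W r m)
    (h : Represents v m₀ s.reg s.mem r m) :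
    ∃ t ≤ 4, ∃ r' m', Run P W t ⟨b + 4 * min s.pc p.length, r, m⟩
      ⟨b + 4 * min (p.step s).pc p.length, r', m'⟩ ∧
      Represents v m₀ (p.step s).reg (p.step s).mem r' m' := by
  have hlt : s.pc < p.length := by
    by_contra hge
    apply hhalt
    simp [Program.Halted, List.getElem?_eq_none (Nat.le_of_not_lt hge)]
  have hc := hcode.simInstr hlt
  have hget : p[s.pc]?.getD Instr.halt = p[s.pc] := by simp [List.getElem?_eq_getElem hlt]
  have hpc : b + 4 * min (s.pc + 1) p.length = b + 4 * min s.pc p.length + 4 := by omega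
  have hmin : min s.pc p.length = s.pc := by omega
  unfold Program.Halted at hhalt
  unfold Program.step at hs' ⊢
  rw [hget] at hhalt hs' ⊢
  rw [hmin] at hpc ⊢
  generalize p[s.pc] = i at *
  have of_triple : ∀ {r₁ m₁ : ℕ → ℕ} {f : Frag}, f (b + 4 * s.pc) = simInstr p.length b i →
      Triple W (1 + (1 + (1 + 1))) f r m (Represents v m₀ r₁ m₁) → ∃ t ≤ 4, ∃ r' m', Run P W t ⟨b + 4 * s.pc, r, m⟩
      ⟨b + 4 * s.pc + 4, r', m'⟩ ∧ Represents v m₀ r₁ m₁ r' m' := by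
    intro r₁ m₁ f hf hT
    obtain ⟨t, ht, r', m', h1, h2⟩ := hT P _ (by rw [hf]; exact hc) hb
    rw [hf, length_simInstr] at h1
    exact ⟨t, ht, r', m', h1, h2⟩
  cases i with
  | const dst c =>
    simp only [Instr.exec] at hs' ⊢
    rw [hpc]
    -- The constant is bounded because the called program, which respects its own word size, has
    -- just stored it in a register.
    have hcX : c < W := by
      have := hs'.1 dst
      rw [Function.update_self] at this
      omega
    refine of_triple (f := (Frag.instr _).seq ((Frag.instr _).seq ((Frag.instr _).seq
      (Frag.instr _)))) rfl ?_
    refine (Triple.const (dst := calleeReg dst) hcX (Q := Represents v m₀ _ _) (h.update_reg dst c)).seq fun r₁ m₁ h₁ => ?_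
    refine (Triple.const (by omega) (Q := Represents v m₀ _ _)
      (h₁.update_odd 0 0)).seq fun r₂ m₂ h₂ => ?_
    refine (Triple.const (by omega) (Q := Represents v m₀ _ _)
      (h₂.update_odd 0 0)).seq fun r₃ m₃ h₃ => ?_
    exact Triple.const (by omega) (h₃.update_odd 0 0)
  | op o dst x y =>
    simp only [Instr.exec] at hs' ⊢
    rw [hpc]
    have hcX : o.eval (r (calleeReg x)) (r (calleeReg y)) < W := by
      have := hs'.1 dst
      rw [Function.update_self] at this
      rw [h.reg, h.reg]
      omega
    refine of_triple (f := (Frag.instr _).seq ((Frag.instr _).seq ((Frag.instr _).seq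
      (Frag.instr _)))) rfl ?_
    refine (Triple.op (dst := calleeReg dst) hcX (Q := Represents v m₀ (Function.update s.reg dst
      (o.eval (s.reg x) (s.reg y))) s.mem) ?_).seq fun r₁ m₁ h₁ => ?_
    · rw [h.reg, h.reg]
      exact h.update_reg dst _
    refine (Triple.const (by omega) (Q := Represents v m₀ _ _)
      (h₁.update_odd 0 0)).seq fun r₂ m₂ h₂ => ?_
    refine (Triple.const (by omega) (Q := Represents v m₀ _ _)
      (h₂.update_odd 0 0)).seq fun r₃ m₃ h₃ => ?_
    exact Triple.const (by omega) (h₃.update_odd 0 0)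
  | load dst a =>
    simp only [Instr.exec] at hs' ⊢
    rw [hpc]
    obtain ⟨ha1, ha2, ha3⟩ := h.address_lt hK hW (hs.1 a)
    refine of_triple (f := (Frag.instr _).seq ((Frag.instr _).seq ((Frag.instr _).seq
      (Frag.instr _)))) rfl ?_
    refine (Triple.op (o := .mul) (x := calleeReg a) (y := 14) (dst := 1)
      (Q := fun r' m' => Represents v m₀ s.reg s.mem r' m' ∧ r' 1 = r (calleeReg a) * r 14) ha1 ⟨h.update_odd 0 _, ?_⟩).seq fun r₁ m₁ ⟨h₁, e₁⟩ => ?_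
    · rw [Function.update_self]; rfl
    have e₂ : r₁ 24 = r 24 := (h₁.own 12 (by norm_num)).trans (h.own 12 (by norm_num)).symm
    refine (Triple.op (o := .add) (x := 1) (y := 24) (dst := 1)
      (Q := fun r' m' => Represents v m₀ s.reg s.mem r' m' ∧ r' 1 = v 12 + s.reg a * v 7) ?_ ⟨h₁.update_odd 0 _, ?_⟩).seq fun r₂ m₂ ⟨h₂, e₃⟩ => ?_
    · rw [e₁, e₂]; exact ha2
    · rw [Function.update_self, e₁, e₂]; exact ha3
    refine (Triple.load (Q := Represents v m₀ (Function.update s.reg dst (s.mem (s.reg a)))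
      s.mem) ?_).seq fun r₃ m₃ h₃ => ?_
    · rw [e₃, h₂.mem]
      exact h₂.update_reg dst _
    exact Triple.const (by omega) (h₃.update_odd 0 0)
  | store a x =>
    simp only [Instr.exec] at hs' ⊢
    rw [hpc]
    obtain ⟨ha1, ha2, ha3⟩ := h.address_lt hK hW (hs.1 a)
    refine of_triple (f := (Frag.instr _).seq ((Frag.instr _).seq ((Frag.instr _).seq
      (Frag.instr _)))) rfl ?_
    refine (Triple.op (o := .mul) (x := calleeReg a) (y := 14) (dst := 1)
      (Q := fun r' m' => Represents v m₀ s.reg s.mem r' m' ∧ r' 1 = r (calleeReg a) * r 14) ha1 ⟨h.update_odd 0 _, ?_⟩).seq fun r₁ m₁ ⟨h₁, e₁⟩ => ?_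
    · rw [Function.update_self]; rfl
    have e₂ : r₁ 24 = r 24 := (h₁.own 12 (by norm_num)).trans (h.own 12 (by norm_num)).symm
    refine (Triple.op (o := .add) (x := 1) (y := 24) (dst := 1)
      (Q := fun r' m' => Represents v m₀ s.reg s.mem r' m' ∧ r' 1 = v 12 + s.reg a * v 7) ?_ ⟨h₁.update_odd 0 _, ?_⟩).seq fun r₂ m₂ ⟨h₂, e₃⟩ => ?_
    · rw [e₁, e₂]; exact ha2
    · rw [Function.update_self, e₁, e₂]; exact ha3
    refine (Triple.store (Q := Represents v m₀ s.reg
      (Function.update s.mem (s.reg a) (s.reg x))) ?_).seq fun r₃ m₃ h₃ => ?_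
    · rw [e₃, h₂.reg]
      exact h₂.update_mem hK _ _
    exact Triple.const (by omega) (h₃.update_odd 0 0)
  | jlt x y target =>
    have e := hc.step_eq (i := 0) (by simp [length_simInstr]) r m
    simp only [add_zero, simInstr, List.getElem_cons_zero, Instr.exec, h.reg] at e
    simp only [Instr.exec]
    by_cases hxy : s.reg x < s.reg y
    · rw [if_pos hxy] at e ⊢
      refine ⟨1, by omega, r, m, .step hb ?_, h⟩
      rw [e]
      exact .refl hb
    · rw [if_neg hxy] at e ⊢
      rw [hpc]
      have e1 := hc.step_eq (i := 1) (by simp [length_simInstr])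
      have e2 := hc.step_eq (i := 2) (by simp [length_simInstr])
      have e3 := hc.step_eq (i := 3) (by simp [length_simInstr])
      simp only [simInstr, List.getElem_cons_succ, List.getElem_cons_zero, Instr.exec]
        at e1 e2 e3
      have hu : ∀ r' : ℕ → ℕ, Bounded W r' m → Bounded W (Function.update r' 1 0) m :=
        fun r' h' => ⟨forall_update_lt h'.1 (by omega), h'.2⟩
      refine ⟨4, by omega, _, m, .step hb ?_, ((h.update_odd 0 0).update_odd 0 0).update_odd 0 0⟩
      rw [e]
      refine .step hb ?_
      rw [e1]
      refine .step (hu _ hb) ?_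
      rw [show b + 4 * s.pc + 1 + 1 = b + 4 * s.pc + 2 from rfl, e2]
      refine .step (hu _ (hu _ hb)) ?_
      rw [show b + 4 * s.pc + 2 + 1 = b + 4 * s.pc + 3 from rfl, e3]
      exact .refl (hu _ (hu _ (hu _ hb)))
  | halt => exact absurd rfl hhalt

theorem sim_halt {P p : Program} {b W : ℕ} {v m₀ : ℕ → ℕ} (hcode : HasCode P b (Frag.call p b))
    (hW1 : 1 < W) (s : Config) (hhalt : p.Halted s) {r m : ℕ → ℕ} (hb : Bounded W r m)
    (h : Represents v m₀ s.reg s.mem r m) :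
    ∃ t ≤ 4, ∃ r' m', Run P W t ⟨b + 4 * min s.pc p.length, r, m⟩
      ⟨b + (Frag.call p b).length, r', m'⟩ ∧ Represents v m₀ s.reg s.mem r' m' := by
  rw [Frag.call, length_flatMap_simInstr]
  by_cases hlt : s.pc < p.length
  · have hc := hcode.simInstr hlt
    have hget : p[s.pc] = Instr.halt := by
      have : p[s.pc]?.getD Instr.halt = p[s.pc] := by simp [List.getElem?_eq_getElem hlt]
      rw [← this]; exact hhalt
    rw [hget] at hc
    rw [min_eq_left hlt.le]
    have e0 := hc.step_eq (i := 0) (by simp [length_simInstr])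
    have e1 := hc.step_eq (i := 1) (by simp [length_simInstr])
    have e2 := hc.step_eq (i := 2) (by simp [length_simInstr])
    simp only [add_zero, simInstr, List.getElem_cons_succ, List.getElem_cons_zero, Instr.exec]
      at e0 e1 e2
    have hb1 : Bounded W (Function.update r 1 0) m := ⟨forall_update_lt hb.1 (by omega), hb.2⟩
    have hb2 : Bounded W (Function.update (Function.update r 1 0) 3 1) m :=
      ⟨forall_update_lt hb1.1 hW1, hb.2⟩
    refine ⟨3, by omega, _, m, .step hb ?_, (h.update_odd 0 0).update_odd 1 1⟩
    rw [e0]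
    refine .step hb1 ?_
    rw [e1]
    refine .step hb2 ?_
    rw [show b + 4 * s.pc + 1 + 1 = b + 4 * s.pc + 2 from rfl, e2, if_pos (by simp)]
    exact .refl hb2
  · rw [min_eq_right (by omega)]
    exact ⟨0, by omega, r, m, .refl hb, h⟩

/-- The effect of calling a program: variables from `32` on are its registers, and the cells
`v 12 + a * v 7` its memory. -/
theorem Hoare.call {p : Program} {k t X W : ℕ} {x : List ℕ} {out : ℕ × ℕ} {v m : ℕ → ℕ}
    (hp : p.Computes k x t out) (hX : X = (x.length + 2) ^ k) (hK : 0 < v 7) (hXW : X ≤ W)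
    (hW : v 12 + X * v 7 ≤ W) (hW1 : 1 < W) (hv : ∀ i, v (32 + i) = 0)
    (hm : ∀ a, m (v 12 + a * v 7) = x.getD a 0) :
    Hoare W (4 * t + 4) (.call p) v m (fun v' m' => (∀ i < 32, v' i = v i) ∧
      (∀ i, v' (32 + i) = (p.configAt x t).reg i) ∧ v' 32 = out.1 ∧ v' 33 = out.2 ∧
      (∀ i, v' (32 + i) < X) ∧ (∀ a, m' (v 12 + a * v 7) < X) ∧
      (∀ y, (∀ a, y ≠ v 12 + a * v 7) → m' y = m y)) := by
  intro r hr P b hP hb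
  obtain ⟨hhalt, hbound, hout1, hout2⟩ := hp
  rw [← hX] at hbound
  have hbd : ∀ s ≤ t, Bounded X (p.configAt x s).reg (p.configAt x s).mem := fun s hs =>
    ⟨fun i => (hbound s hs i).1, fun i => (hbound s hs i).2⟩
  have h0 : Represents v m (p.configAt x 0).reg (p.configAt x 0).mem r m :=
    { own := fun i _ => hr i
      reg := fun i => (hr (32 + i)).trans (hv i)
      mem := hm
      rest := fun _ _ => rfl }
  have main : ∀ s ≤ t, ∃ u ≤ 4 * s, ∃ r' m', Run P W u ⟨b, r, m⟩
      ⟨b + 4 * min (p.configAt x s).pc p.length, r', m'⟩ ∧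
      Represents v m (p.configAt x s).reg (p.configAt x s).mem r' m' := by
    intro s
    induction s with
    | zero =>
      intro _
      refine ⟨0, le_rfl, r, m, ?_, h0⟩
      simpa [Program.configAt, startConfig] using
        Run.refl (P := P) (W := W) (c := ⟨b, r, m⟩) hb
    | succ s ih =>
      intro hs
      obtain ⟨u, hu, r', m', h1, h2⟩ := ih (by omega)
      have e : p.configAt x (s + 1) = p.step (p.configAt x s) := by
        simp only [Program.configAt, Function.iterate_succ_apply']
      have hb' := hbd (s + 1) hs
      rw [e] at hb' ⊢
      by_cases hh : p.Halted (p.configAt x s)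
      · have : p.step (p.configAt x s) = p.configAt x s := by
          unfold Program.Halted at hh
          rw [Program.step, hh, Instr.exec]
        rw [this]
        exact ⟨u, by omega, r', m', h1, h2⟩
      · obtain ⟨u', hu', r'', m'', h3, h4⟩ := sim_step hP hK hXW hW hW1 _ (hbd s (by omega)) hb' hh
          h1.bounded_right h2
        exact ⟨u + u', by omega, r'', m'', h1.trans h3, h4⟩
  obtain ⟨u, hu, r', m', h1, h2⟩ := main t le_rfl
  obtain ⟨u', hu', r'', m'', h3, h4⟩ := sim_halt hP hW1 _ hhalt h1.bounded_right h2
  refine ⟨u + u', by omega, r'', m'', h1.trans h3, h4.own, h4.reg, ?_, ?_, ?_, ?_, h4.rest⟩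
  · exact (h4.reg 0).trans hout1
  · exact (h4.reg 1).trans hout2
  · intro i
    exact (h4.reg i).trans_lt ((hbd t le_rfl).1 i)
  · intro a
    exact (h4.mem a).trans_lt ((hbd t le_rfl).2 a)

/-! ### Resetting the registers of the called program. -/

/-- The register written by an instruction, plus one. -/
def Instr.regBound : Instr → ℕ
  | .const dst _ => dst + 1
  | .op _ dst _ _ => dst + 1
  | .load dst _ => dst + 1
  | _ => 0

/-- The program writes to registers below this number only. -/
def Program.regBound (p : Program) : ℕ := (p.map Instr.regBound).foldr max 0

/-- A finite program names finitely many registers, so a constant number of assignments prepares the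
registers for the next call. -/
theorem Program.reg_eq_zero (p : Program) (x : List ℕ) (t : ℕ) {i : ℕ} (hi : p.regBound ≤ i) :
    (p.configAt x t).reg i = 0 := by
  induction t with
  | zero => rfl
  | succ t ih =>
    have e : p.configAt x (t + 1) = p.step (p.configAt x t) := by
      simp only [Program.configAt, Function.iterate_succ_apply']
    rw [e, Program.step]
    have key : ∀ j : Instr, j.regBound ≤ p.regBound → (j.exec (p.configAt x t)).reg i = 0 := by
      intro j hj
      cases j <;> simp only [Instr.regBound] at hj <;> simp only [Instr.exec] <;>
        first | exact ih | (rw [Function.update_of_ne (by omega)]; exact ih)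
    apply key
    rcases h : p[(p.configAt x t).pc]? with _ | j
    · simp [Instr.regBound]
    · have hmem : j ∈ p := List.mem_of_getElem? h
      simp only [Option.getD_some]
      clear key h ih e hi
      unfold Program.regBound
      induction p with
      | nil => cases hmem
      | cons a l ihl =>
        simp only [List.map_cons, List.foldr_cons]
        rcases List.mem_cons.1 hmem with rfl | h
        · exact le_max_left _ _
        · exact (ihl h).trans (le_max_right _ _)

/-- Sets the first `n` registers of the called program to `0`. -/
def Frag.reset : ℕ → Frag
  | 0 => fun _ => []
  | n + 1 => (Frag.reset n).seq (.instr (.const (2 * (32 + n)) 0))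

theorem Hoare.reset {W : ℕ} (hW : 0 < W) (n : ℕ) (v m : ℕ → ℕ) :
    Hoare W n (.reset n) v m (fun v' m' => m' = m ∧
      ∀ i, v' i = if 32 ≤ i ∧ i < 32 + n then 0 else v i) := by
  induction n with
  | zero =>
    intro r hr P b _ hb
    refine ⟨0, le_rfl, r, m, .refl hb, rfl, fun i => ?_⟩
    simp only
    rw [if_neg (by omega), hr]
  | succ n ih =>
    refine ih.seq fun v₁ m₁ ⟨h1, h2⟩ r hr => ?_
    refine Triple.const hW ⟨h1, fun i => ?_⟩
    simp only
    by_cases hi : i = 32 + n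
    · subst hi
      rw [Function.update_self, if_pos (by omega)]
    · rw [Function.update_of_ne (by omega), hr, h2]
      by_cases h3 : 32 ≤ i ∧ i < 32 + n
      · rw [if_pos h3, if_pos (by omega)]
      · rw [if_neg h3, if_neg (by omega)]

end WordRAM

/-! ### The reduction as a program -/

namespace WordRAM

namespace Expr

instance : Add Expr := ⟨app .add⟩
instance : Sub Expr := ⟨app .sub⟩
instance : Mul Expr := ⟨app .mul⟩
instance : Div Expr := ⟨app .div⟩
instance : Mod Expr := ⟨app .mod⟩
instance (n : ℕ) : OfNat Expr n := ⟨lit n⟩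

section

variable (v m : ℕ → ℕ)

@[simp] theorem eval_var (i : ℕ) : (var i).eval v m = v i := rfl
@[simp] theorem eval_ofNat (n : ℕ) : (ofNat(n) : Expr).eval v m = OfNat.ofNat n := rfl
@[simp] theorem eval_add (a b : Expr) : (a + b).eval v m = a.eval v m + b.eval v m := rfl
@[simp] theorem eval_sub (a b : Expr) : (a - b).eval v m = a.eval v m - b.eval v m := rfl
@[simp] theorem eval_mul (a b : Expr) : (a * b).eval v m = a.eval v m * b.eval v m := rfl
@[simp] theorem eval_div (a b : Expr) : (a / b).eval v m = a.eval v m / b.eval v m := rfl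
@[simp] theorem eval_mod (a b : Expr) : (a % b).eval v m = a.eval v m % b.eval v m := rfl
@[simp] theorem eval_mem (a : Expr) : (mem a).eval v m = m (a.eval v m) := rfl
@[simp] theorem eval_ite (a b c d : Expr) : (ite a b c d).eval v m =
    if a.eval v m < b.eval v m then c.eval v m else d.eval v m := rfl

end

/-- A bound for the size and the constants of the expressions of a program. -/
def Small (e : Expr) : Prop := e.depth ≤ 16 ∧ e.maxLit < 32 ∧ e.cost ≤ 499

instance (e : Expr) : Decidable e.Small := inferInstanceAs (Decidable (_ ∧ _))

theorem Small.fits {B W : ℕ} {v m : ℕ → ℕ} {e : Expr} (he : e.Small) (hB : 32 ≤ B)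
    (hW : B ^ 2 ^ 16 ≤ W) (hb : Bounded B v m) : e.Fits W v m :=
  (eval_lt_fits (by omega) hb.1 hb.2 hW e he.1 (by have := he.2.1; omega)).2

end Expr

open WordRAM.Expr

theorem sq_le_of_pow_le {B W : ℕ} (hB : 32 ≤ B) (hW : B ^ 2 ^ 16 ≤ W) : B ^ 2 ≤ W :=
  (Nat.pow_le_pow_right (by omega) (by norm_num)).trans hW

theorem one_lt_of_pow_le {B W : ℕ} (hB : 32 ≤ B) (hW : B ^ 2 ^ 16 ≤ W) : 1 < W := by
  have h1 := sq_le_of_pow_le hB hW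
  have h2 : B ≤ B ^ 2 := Nat.le_self_pow (by norm_num) B
  omega

namespace Hoare

variable {B W T T' : ℕ} {f g : Frag} {v m : ℕ → ℕ} {Q : (ℕ → ℕ) → (ℕ → ℕ) → Prop}

theorem set (hB : 32 ≤ B) (hW : B ^ 2 ^ 16 ≤ W) (hb : Bounded B v m) (i : ℕ) {e : Expr}
    (he : e.Small) (hlt : e.eval v m < B)
    (hQ : Bounded B (Function.update v i (e.eval v m)) m → Q (Function.update v i (e.eval v m)) m) :
    Hoare W 500 (.assign i e) v m Q :=
  (Hoare.assign (one_lt_of_pow_le hB hW) (he.fits hB hW hb)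
    (hQ ⟨forall_update_lt hb.1 hlt, hb.2⟩)).mono (by have := he.2.2; omega) fun _ _ h => h

theorem set_seq (hB : 32 ≤ B) (hW : B ^ 2 ^ 16 ≤ W) (hb : Bounded B v m) {i : ℕ} {e : Expr}
    (he : e.Small) (hlt : e.eval v m < B)
    (h : Bounded B (Function.update v i (e.eval v m)) m →
      Hoare W T f (Function.update v i (e.eval v m)) m Q) :
    Hoare W (500 + T) ((Frag.assign i e).seq f) v m Q := by
  refine (Hoare.set hB hW hb i he hlt (Q := fun v' m' =>
    v' = Function.update v i (e.eval v m) ∧ m' = m) fun _ => ⟨rfl, rfl⟩).seq ?_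
  rintro v' m' ⟨rfl, rfl⟩
  exact h ⟨forall_update_lt hb.1 hlt, hb.2⟩

end Hoare

/-- Stores words in the memory of the program to be called: `(i, e)` writes `e` to its cell `i`. -/
def Frag.puts : List (Expr × Expr) → Frag
  | [] => fun _ => []
  | q :: l => (Frag.put (var 12 + q.1 * var 7) q.2).seq (Frag.puts l)

/-- The cells `b + a * K` with `a` in `S` hold the words `w a`, those with `a` outside of `S` hold
`0`, and the rest of the memory is as in `m₀`. -/
structure Filled (b K : ℕ) (w m₀ : ℕ → ℕ) (S : ℕ → Prop) (m : ℕ → ℕ) : Prop where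
  mem : ∀ a, S a → m (b + a * K) = w a
  zero : ∀ a, ¬ S a → m (b + a * K) = 0
  rest : ∀ y, (∀ a, y ≠ b + a * K) → m y = m₀ y

theorem Filled.put {b K : ℕ} {w m₀ m : ℕ → ℕ} {S : ℕ → Prop} (h : Filled b K w m₀ S m)
    (hK : 0 < K) (a : ℕ) :
    Filled b K w m₀ (fun i => S i ∨ i = a) (Function.update m (b + a * K) (w a)) := by
  have hinj : ∀ i, i ≠ a → b + i * K ≠ b + a * K := fun i hi he =>
    hi (Nat.eq_of_mul_eq_mul_right hK (Nat.add_left_cancel he))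
  refine ⟨fun i hi => ?_, fun i hi => ?_, fun y hy => ?_⟩
  · by_cases hia : i = a
    · rw [hia, Function.update_self]
    · rw [Function.update_of_ne (hinj i hia)]
      exact h.mem i (hi.resolve_right hia)
  · push Not at hi
    rw [Function.update_of_ne (hinj i hi.2)]
    exact h.zero i hi.1
  · rw [Function.update_of_ne (hy a)]
    exact h.rest y hy

theorem Filled.congr {b K : ℕ} {w m₀ m : ℕ → ℕ} {S S' : ℕ → Prop} (h : Filled b K w m₀ S m)
    (hS : ∀ a, S a ↔ S' a) : Filled b K w m₀ S' m := by
  obtain rfl : S = S' := funext fun a => propext (hS a)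
  exact h

/-- The expressions must have values that do not depend on the memory, since the memory changes from
one write to the next; `idx` records the values of the addresses. -/
theorem Hoare.puts {B W : ℕ} {v w m₀ : ℕ → ℕ} (hB : 32 ≤ B) (hW : B ^ 2 ^ 16 ≤ W)
    (hv : ∀ i, v i < B) (hK : 0 < v 7) (l : List (Expr × Expr))
    (hs : ∀ q ∈ l, (var 12 + q.1 * var 7).Small ∧ q.2.Small) (idx : Expr → ℕ)
    (hi : ∀ q ∈ l, ∀ m, q.1.eval v m = idx q.1)
    (he : ∀ q ∈ l, ∀ m, q.2.eval v m = w (idx q.1)) (hw : ∀ q ∈ l, w (idx q.1) < B) :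
    ∀ (S : ℕ → Prop) (m : ℕ → ℕ), (∀ i, m i < B) → Filled (v 12) (v 7) w m₀ S m →
      Hoare W (1000 * l.length) (.puts l) v m (fun v' m' => v' = v ∧ (∀ i, m' i < B) ∧
        Filled (v 12) (v 7) w m₀ (fun a => S a ∨ ∃ q ∈ l, a = idx q.1) m') := by
  induction l with
  | nil =>
    intro S m hm hF r hr P b _ hb
    exact ⟨0, le_rfl, r, m, .refl hb, funext hr, hm, hF.congr fun a => by simp⟩
  | cons q l ih =>
    intro S m hm hF
    have hq : q ∈ q :: l := List.mem_cons_self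
    have e1 : (var 12 + q.1 * var 7).eval v m = v 12 + idx q.1 * v 7 := by
      simp [hi q hq]
    have hput : Hoare W 1000 (Frag.put (var 12 + q.1 * var 7) q.2) v m (fun v' m' => v' = v ∧
        m' = Function.update m (v 12 + idx q.1 * v 7) (w (idx q.1))) := by
      refine (Hoare.put (one_lt_of_pow_le hB hW) ((hs q hq).1.fits hB hW ⟨hv, hm⟩)
        ((hs q hq).2.fits hB hW ⟨hv, hm⟩) (Q := fun v' m' => v' = v ∧
        m' = Function.update m (v 12 + idx q.1 * v 7) (w (idx q.1))) ?_).mono ?_ fun _ _ h => h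
      · rw [e1, he q hq]; exact ⟨rfl, rfl⟩
      · have := (hs q hq).1.2.2
        have := (hs q hq).2.2.2
        omega
    refine (hput.seq (T' := 1000 * l.length) ?_).mono (by simp; omega) fun _ _ h => h
    rintro v' m' ⟨rfl, rfl⟩
    refine (ih (fun q hq => hs q (List.mem_cons_of_mem _ hq))
      (fun q hq => hi q (List.mem_cons_of_mem _ hq))
      (fun q hq => he q (List.mem_cons_of_mem _ hq))
      (fun q hq => hw q (List.mem_cons_of_mem _ hq)) _ _ (forall_update_lt hm (hw q hq))
      (hF.put hK (idx q.1))).mono le_rfl ?_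
    rintro v' m' ⟨h1, h2, h3⟩
    refine ⟨h1, h2, h3.congr fun a => ?_⟩
    simp only [List.mem_cons, exists_eq_or_imp, or_assoc]

end WordRAM

/-! ### Bits of the input, labels of a pair of windows, words to be written. -/

namespace Reduction

open WordRAM Expr

/-- Entry `l` of vector `i` of the first family, in the input. -/
def bitA (d : ℕ) (x : ℕ → ℕ) (i l : ℕ) : ℕ := x (3 + (i * d + l))

/-- Entry `l` of vector `j` of the second family, in the input. -/
def bitB (n d : ℕ) (x : ℕ → ℕ) (j l : ℕ) : ℕ := x (3 + ((n + j) * d + l))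

/-- The weights of the `t`-th path vertex: the vectors `j₀, …, j₀ + m₁ - 1` of the second family in
the first path, with `m` vertices, the vectors `i₀, …, i₀ + n₁ - 1` of the first family in the
second path; indices are modulo the size of the family. -/
def label (n m d n₁ m₁ i₀ j₀ : ℕ) (x : ℕ → ℕ) (t : ℕ) : ℕ × ℕ :=
  if t < m then TwoHub.pLabel d m₁ (fun j l => bitB n d x ((j₀ + j) % m) l) t
  else TwoHub.qLabel d n₁ (fun i l => bitA d x ((i₀ + i) % n) l) (t - m)

/-- The input of the program that is called. -/
def inputWords (n m d n₁ m₁ i₀ j₀ : ℕ) (x : ℕ → ℕ) : List ℕ :=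
  [m + n + 3, 3 * (m + n), m, n] ++
    (List.range (m + n)).flatMap (TwoHub.edgeWords (m + n)
      (fun t => (label n m d n₁ m₁ i₀ j₀ x t).1) (fun t => (label n m d n₁ m₁ i₀ j₀ x t).2))
    ++ List.range (m + n)

/-- Variables `1, …, 8` have these values. -/
structure Context (n m d n₁ m₁ k K L : ℕ) (v : ℕ → ℕ) : Prop where
  one : v 1 = n
  two : v 2 = m
  three : v 3 = d
  four : v 4 = n₁
  five : v 5 = m₁
  six : v 6 = k
  seven : v 7 = K
  eight : v 8 = L

theorem Context.update {n m d n₁ m₁ k K L : ℕ} {v : ℕ → ℕ} (h : Context n m d n₁ m₁ k K L v)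
    {i : ℕ} (hi : 9 ≤ i ∨ i = 0) (x : ℕ) : Context n m d n₁ m₁ k K L (Function.update v i x) where
  one := by rw [Function.update_of_ne (by omega), h.one]
  two := by rw [Function.update_of_ne (by omega), h.two]
  three := by rw [Function.update_of_ne (by omega), h.three]
  four := by rw [Function.update_of_ne (by omega), h.four]
  five := by rw [Function.update_of_ne (by omega), h.five]
  six := by rw [Function.update_of_ne (by omega), h.six]
  seven := by rw [Function.update_of_ne (by omega), h.seven]
  eight := by rw [Function.update_of_ne (by omega), h.eight]

end Reduction

/-! ### Input words by position, and the code that writes them. -/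

namespace Reduction

open WordRAM WordRAM.Expr

theorem getD_flatMap {α : Type*} (g : α → List ℕ) {k : ℕ} (hg : ∀ i, (g i).length = k) {s : ℕ}
    (hs : s < k) (l : List α) : ∀ t (ht : t < l.length),
    (l.flatMap g).getD (k * t + s) 0 = (g l[t]).getD s 0 := by
  induction l with
  | nil => intro t ht; simp at ht
  | cons a l ih =>
    intro t ht
    rw [List.flatMap_cons]
    rcases t with _ | t
    · rw [List.getD_append _ _ _ _ (by rw [hg]; omega)]
      simp
    · rw [List.getD_append_right _ _ _ _ (by rw [hg, Nat.mul_succ]; omega), hg, Nat.mul_succ,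
        show k * t + k + s - k = k * t + s by omega, ih t (by simpa using ht)]
      simp

theorem length_flatMap_const {α : Type*} (g : α → List ℕ) {k : ℕ} (hg : ∀ i, (g i).length = k)
    (l : List α) : (l.flatMap g).length = k * l.length := by
  induction l with
  | nil => simp
  | cons a l ih => rw [List.flatMap_cons, List.length_append, hg, ih, List.length_cons]; ring

section inputWords

variable {n m d n₁ m₁ i₀ j₀ : ℕ} {x : ℕ → ℕ}

theorem length_edgeWords (M : ℕ) (x y : ℕ → ℕ) (t : ℕ) : (TwoHub.edgeWords M x y t).length = 9 :=
  rfl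

theorem length_inputWords :
    (inputWords n m d n₁ m₁ i₀ j₀ x).length = 4 + 10 * (m + n) := by
  simp only [inputWords, List.length_append, List.length_range,
    length_flatMap_const _ (length_edgeWords _ _ _), List.length_cons, List.length_nil]
  ring

theorem inputWords_header {a : ℕ} (ha : a < 4) : (inputWords n m d n₁ m₁ i₀ j₀ x).getD a 0 =
    [m + n + 3, 3 * (m + n), m, n].getD a 0 := by
  rw [inputWords, List.append_assoc, List.getD_append _ _ _ _ (by simpa using ha)]

theorem inputWords_edge {t s : ℕ} (ht : t < m + n) (hs : s < 9) :
    (inputWords n m d n₁ m₁ i₀ j₀ x).getD (4 + 9 * t + s) 0 =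
      (TwoHub.edgeWords (m + n) (fun t => (label n m d n₁ m₁ i₀ j₀ x t).1)
        (fun t => (label n m d n₁ m₁ i₀ j₀ x t).2) t).getD s 0 := by
  rw [inputWords, List.append_assoc, List.getD_append_right _ _ _ _ (by simp; omega),
    List.getD_append _ _ _ _ ?_]
  · rw [show 4 + 9 * t + s - [m + n + 3, 3 * (m + n), m, n].length = 9 * t + s by simp; omega,
      getD_flatMap _ (length_edgeWords _ _ _) hs _ t (by simpa using ht), List.getElem_range]
  · rw [length_flatMap_const _ (length_edgeWords _ _ _)]
    simp
    omega

theorem inputWords_path {t : ℕ} (ht : t < m + n) :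
    (inputWords n m d n₁ m₁ i₀ j₀ x).getD (4 + 9 * (m + n) + t) 0 = t := by
  have hlen : ∀ y z : ℕ → ℕ, ([m + n + 3, 3 * (m + n), m, n] ++
      (List.range (m + n)).flatMap (TwoHub.edgeWords (m + n) y z)).length = 4 + 9 * (m + n) := by
    intro y z
    rw [List.length_append, length_flatMap_const _ (length_edgeWords _ _ _)]
    simp
  rw [inputWords, List.getD_append_right _ _ _ _ (by rw [hlen]; omega), hlen,
    Nat.add_sub_cancel_left, List.getD_eq_getElem _ _ (by simpa using ht), List.getElem_range]

theorem inputWords_beyond {a : ℕ} (ha : 4 + 10 * (m + n) ≤ a) :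
    (inputWords n m d n₁ m₁ i₀ j₀ x).getD a 0 = 0 :=
  List.getD_eq_default _ _ (by rw [length_inputWords]; exact ha)

end inputWords

/-- Labels read only cells of the original input. The program evaluates them in a memory that
earlier writes have changed beyond the input. -/
theorem label_congr {n m d n₁ m₁ i₀ j₀ : ℕ} {x y : ℕ → ℕ} (hn : 1 ≤ n) (hm : 1 ≤ m)
    (h : ∀ a < 3 + (n + m) * d, x a = y a) (t : ℕ) :
    label n m d n₁ m₁ i₀ j₀ x t = label n m d n₁ m₁ i₀ j₀ y t := by
  have hA : ∀ i l, l < d → bitA d x ((i₀ + i) % n) l = bitA d y ((i₀ + i) % n) l := by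
    intro i l hl
    have := TwoHub.mul_add_lt_mul hl (Nat.mod_lt (i₀ + i) hn)
    exact h _ (by rw [Nat.add_mul]; omega)
  have hB : ∀ j l, l < d → bitB n d x ((j₀ + j) % m) l = bitB n d y ((j₀ + j) % m) l := by
    intro j l hl
    have := TwoHub.mul_add_lt_mul hl (Nat.add_lt_add_left (Nat.mod_lt (j₀ + j) hm) n)
    exact h _ (by omega)
  have h1 : ∀ s, ¬ s % (d + 1) < 1 → s % (d + 1) - 1 < d := by
    intro s hs
    have := Nat.mod_lt s (Nat.succ_pos d)
    simp only [Nat.succ_eq_add_one] at this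
    omega
  unfold label
  split_ifs
  · unfold TwoHub.pLabel
    split_ifs with _ _ _ h2 <;> first | rfl | simp only [hB _ _ (h1 _ h2)]
  · unfold TwoHub.qLabel
    split_ifs with _ h2 h3 <;> first | rfl | simp only [hA _ _ (show (t - m) % (d + 2) - 1 < d by omega)]

/-- A component of the label of vertex number `t` of the first path. -/
def pExpr (t first mid last even odd : Expr) : Expr :=
  .ite t 1 9 (.ite t 2 first (.ite (t - 1) (var 5 * (var 3 + 1))
    (.ite ((t - 1) % (var 3 + 1)) 1 mid (.ite (((t - 1) % (var 3 + 1) - 1) % 2) 1 even odd))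
    (.ite (t - 1) (var 5 * (var 3 + 1) + 1) last 9)))

/-- A component of the label of vertex number `t` of the second path. -/
def qExpr (t before behind even odd : Expr) : Expr :=
  .ite t (var 4 * (var 3 + 2)) (.ite (t % (var 3 + 2)) 1 before
    (.ite (t % (var 3 + 2)) (var 3 + 1) (.ite ((t % (var 3 + 2) - 1) % 2) 1 even odd) behind))
    behind

/-- The entry that belongs to vertex number `t` of the first path. -/
def pBit (t : Expr) : Expr :=
  .mem (3 + ((var 1 + (var 11 + (t - 1) / (var 3 + 1)) % var 2) * var 3 +
    ((t - 1) % (var 3 + 1) - 1)))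

/-- The entry that belongs to vertex number `t` of the second path. -/
def qBit (t : Expr) : Expr :=
  .mem (3 + ((var 10 + t / (var 3 + 2)) % var 1 * var 3 + (t % (var 3 + 2) - 1)))

/-- The first hub weight of vertex number `var 13`. -/
def xExpr : Expr :=
  .ite (var 13) (var 2) (pExpr (var 13) 13 13 14 (10 + pBit (var 13)) 12)
    (qExpr (var 13 - var 2) 7 11 (9 + qBit (var 13 - var 2)) 11)

/-- The second hub weight of vertex number `var 13`. -/
def yExpr : Expr :=
  .ite (var 13) (var 2) (pExpr (var 13) 14 13 13 12 (10 + pBit (var 13)))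
    (qExpr (var 13 - var 2) 11 7 11 (9 + qBit (var 13 - var 2)))

/-- The expression copies the definition of the labels case by case. For this reason the labels are
defined with tests of the form a < b throughout, even where a = 0 is meant. -/
theorem eval_xExpr (v m : ℕ → ℕ) : xExpr.eval v m =
    (label (v 1) (v 2) (v 3) (v 4) (v 5) (v 10) (v 11) m (v 13)).1 := by
  simp only [xExpr, pExpr, qExpr, pBit, qBit, label, TwoHub.pLabel, TwoHub.qLabel, bitA, bitB,
    eval_var, eval_ofNat, eval_add, eval_sub, eval_mul, eval_div, eval_mod, eval_mem, eval_ite,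
    apply_ite Prod.fst]
  rfl

theorem eval_yExpr (v m : ℕ → ℕ) : yExpr.eval v m =
    (label (v 1) (v 2) (v 3) (v 4) (v 5) (v 10) (v 11) m (v 13)).2 := by
  simp only [yExpr, pExpr, qExpr, pBit, qBit, label, TwoHub.pLabel, TwoHub.qLabel, bitA, bitB,
    eval_var, eval_ofNat, eval_add, eval_sub, eval_mul, eval_div, eval_mod, eval_mem, eval_ite,
    apply_ite Prod.snd]
  rfl

/-- The header of the input. -/
def headerWords : List (Expr × Expr) :=
  [(0, var 2 + var 1 + 3), (1, 3 * (var 2 + var 1)), (2, var 2), (3, var 1)]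

/-- The words of the input for vertex number `var 13`. -/
def vertexWords : List (Expr × Expr) :=
  [(4 + 9 * var 13 + 0, var 13), (4 + 9 * var 13 + 1, var 13 + 1), (4 + 9 * var 13 + 2, 21),
    (4 + 9 * var 13 + 3, var 13), (4 + 9 * var 13 + 4, var 2 + var 1 + 1),
    (4 + 9 * var 13 + 5, var 16), (4 + 9 * var 13 + 6, var 13),
    (4 + 9 * var 13 + 7, var 2 + var 1 + 2), (4 + 9 * var 13 + 8, var 17),
    (4 + 9 * (var 2 + var 1) + var 13, var 13)]

/-- Writes the words of the input for vertex number `var 13` and goes to the next one. -/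
def vertexCode : Frag :=
  (Frag.assign 16 xExpr).seq ((Frag.assign 17 yExpr).seq ((Frag.puts vertexWords).seq
    (Frag.assign 13 (var 13 + 1))))

theorem label_le {n m d n₁ m₁ i₀ j₀ : ℕ} {x : ℕ → ℕ} (hx : ∀ a, x (3 + a) ≤ 1) (t : ℕ) :
    (7 ≤ (label n m d n₁ m₁ i₀ j₀ x t).1 ∧ (label n m d n₁ m₁ i₀ j₀ x t).1 ≤ 14) ∧
    (7 ≤ (label n m d n₁ m₁ i₀ j₀ x t).2 ∧ (label n m d n₁ m₁ i₀ j₀ x t).2 ≤ 14) := by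
  unfold label
  split_ifs
  · exact TwoHub.pLabel_bounds (fun i l => hx _) t
  · have := TwoHub.qLabel_bounds (d := d) (r := n₁)
      (bit := fun i l => bitA d x ((i₀ + i) % n) l) (fun i l => hx _) (t - m)
    omega

section spec

variable {n m d n₁ m₁ k K L B W : ℕ} {x : ℕ → ℕ}

/-- The cells of the input that are written before vertex number `t` is treated. -/
def Written (M t a : ℕ) : Prop := a < 4 + 9 * t ∨ 4 + 9 * M ≤ a ∧ a < 4 + 9 * M + t

/-- Vertex t owns nine words of the edge list and one word of the concatenated paths. After it both
written intervals have grown by exactly these. -/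
theorem vertexCode_spec (hB : 32 ≤ B) (hW : B ^ 2 ^ 16 ≤ W) (hn : 1 ≤ n) (hm : 1 ≤ m) (hK : 0 < K)
    (hL : L = 3 + (n + m) * d) (hx : ∀ a, x (3 + a) ≤ 1) (hBig : m + n + 3 < B)
    {b i₀ j₀ t : ℕ} (hb : L ≤ b) {m₀ : ℕ → ℕ} (hm₀ : ∀ a < L, m₀ a = x a) (ht : t < m + n)
    {v mem : ℕ → ℕ} (hv : Context n m d n₁ m₁ k K L v) (h10 : v 10 = i₀) (h11 : v 11 = j₀)
    (h12 : v 12 = b) (h13 : v 13 = t) (hbd : Bounded B v mem)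
    (hF : Filled b K (fun a => (inputWords n m d n₁ m₁ i₀ j₀ x).getD a 0) m₀
      (Written (m + n) t) mem) :
    Hoare W 12000 vertexCode v mem (fun v' mem' => (∀ i < 13, v' i = v i) ∧
      (∀ i, 32 ≤ i → v' i = v i) ∧ v' 13 = t + 1 ∧ Bounded B v' mem' ∧
      Filled b K (fun a => (inputWords n m d n₁ m₁ i₀ j₀ x).getD a 0) m₀
        (Written (m + n) (t + 1)) mem') := by
  have hmem : ∀ a < 3 + (n + m) * d, mem a = x a := by
    intro a ha
    rw [hF.rest a fun i => by omega, hm₀ a (by omega)]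
  have hlab := label_le (n := n) (m := m) (d := d) (n₁ := n₁) (m₁ := m₁) (i₀ := i₀) (j₀ := j₀) hx t
  have ex : xExpr.eval v mem = (label n m d n₁ m₁ i₀ j₀ x t).1 := by
    rw [eval_xExpr, hv.one, hv.two, hv.three, hv.four, hv.five, h10, h11, h13,
      label_congr hn hm hmem]
  refine (Hoare.set_seq hB hW hbd (by decide) (by rw [ex]; omega) (T := 11500) ?_).mono
    (by norm_num) fun _ _ h => h
  rw [ex]
  intro hbd
  have ey : yExpr.eval (Function.update v 16 (label n m d n₁ m₁ i₀ j₀ x t).1) mem =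
      (label n m d n₁ m₁ i₀ j₀ x t).2 := by
    rw [eval_yExpr]
    simp only [Function.update_apply, Nat.reduceEqDiff, if_false]
    rw [hv.one, hv.two, hv.three, hv.four, hv.five, h10, h11, h13, label_congr hn hm hmem]
  refine (Hoare.set_seq hB hW hbd (by decide) (by rw [ey]; omega) (T := 11000) ?_).mono
    (by norm_num) fun _ _ h => h
  rw [ey]
  intro hbd
  obtain ⟨w, hw⟩ : ∃ w, w = Function.update (Function.update v 16
    (label n m d n₁ m₁ i₀ j₀ x t).1) 17 (label n m d n₁ m₁ i₀ j₀ x t).2 := ⟨_, rfl⟩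
  rw [← hw] at hbd ⊢
  have w16 : w 16 = (label n m d n₁ m₁ i₀ j₀ x t).1 := by simp [hw]
  have w17 : w 17 = (label n m d n₁ m₁ i₀ j₀ x t).2 := by simp [hw]
  have wv : ∀ i, i ≠ 16 → i ≠ 17 → w i = v i := by
    intro i h1 h2
    rw [hw, Function.update_of_ne h2, Function.update_of_ne h1]
  have w1 : w 1 = n := by rw [wv 1 (by norm_num) (by norm_num), hv.one]
  have w2 : w 2 = m := by rw [wv 2 (by norm_num) (by norm_num), hv.two]
  have w7 : w 7 = K := by rw [wv 7 (by norm_num) (by norm_num), hv.seven]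
  have w12 : w 12 = b := by rw [wv 12 (by norm_num) (by norm_num), h12]
  have w13 : w 13 = t := by rw [wv 13 (by norm_num) (by norm_num), h13]
  have hval : ∀ q ∈ vertexWords, ∀ mem, q.2.eval w mem =
      (inputWords n m d n₁ m₁ i₀ j₀ x).getD (q.1.eval w 0) 0 ∧ q.2.eval w mem < B ∧
      q.1.eval w mem = q.1.eval w 0 := by
    intro q hq mem
    simp only [vertexWords, List.mem_cons, List.not_mem_nil, or_false] at hq
    rcases hq with rfl | rfl | rfl | rfl | rfl | rfl | rfl | rfl | rfl | rfl <;>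
      simp only [eval_var, eval_ofNat, eval_add, eval_mul, w1, w2, w13, w16, w17,
        inputWords_path ht] <;>
      (try rw [inputWords_edge ht (by norm_num)]) <;>
      refine ⟨?_, ?_, ?_⟩ <;> first | trivial | rfl | omega
  have hputs := Hoare.puts hB hW hbd.1 (by rw [w7]; exact hK) vertexWords (by decide)
    (w := fun a => (inputWords n m d n₁ m₁ i₀ j₀ x).getD a 0) (m₀ := m₀)
    (fun e => e.eval w 0) (fun q hq m' => (hval q hq m').2.2) (fun q hq m' => (hval q hq m').1)
    (fun q hq => by
      have := hval q hq 0
      rw [← this.1]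
      exact this.2.1) (Written (m + n) t) mem hbd.2 (by rw [w7, w12]; exact hF)
  refine (hputs.seq (T' := 500) ?_).mono (by simp [vertexWords]) fun _ _ h => h
  rintro v' mem' ⟨rfl, h1, h2⟩
  rw [w7, w12] at h2
  refine Hoare.set hB hW ⟨hbd.1, h1⟩ 13 (by decide) ?_ fun hbd' => ⟨fun i hi => ?_, fun i hi => ?_,
    ?_, hbd', h2.congr fun a => ?_⟩
  · simp only [eval_add, eval_var, eval_ofNat, w13]
    omega
  · rw [Function.update_of_ne (by omega), wv i (by omega) (by omega)]
  · rw [Function.update_of_ne (by omega), wv i (by omega) (by omega)]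
  · rw [Function.update_self]
    simp [w13]
  · simp only [vertexWords, List.mem_cons, List.not_mem_nil, or_false, exists_eq_or_imp,
      exists_eq_left, eval_add, eval_mul, eval_var, eval_ofNat, w1, w2, w13, Written]
    omega

end spec

end Reduction

/-! ### The program, and the correctness of one call. -/

namespace Reduction

open WordRAM WordRAM.Expr

/-- Writes the input of the program that is called, except for the header. -/
def fillCode : Frag := Frag.doWhile vertexCode (var 13) (var 2 + var 1)

/-- One call, for the windows that belong to number `var 9`. -/
def callCode (p : Program) : Frag :=
  (Frag.assign 10 (var 9 / var 6 * var 4)).seq <|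
  (Frag.assign 11 (var 9 % var 6 * var 5)).seq <|
  (Frag.assign 12 (var 8 + var 9)).seq <|
  (Frag.assign 13 0).seq <|
  (Frag.puts headerWords).seq <|
  fillCode.seq <|
  (Frag.call p).seq <|
  (Frag.assign 0 (.ite (var 32) (21 * var 33) 1 (var 0))).seq <|
  (Frag.reset p.regBound).seq <|
  Frag.assign 9 (var 9 + 1)

/-- The calls for all pairs of windows. -/
def mainCode (p : Program) : Frag :=
  (Frag.assign 4 (var 1 / (var 3 + 2))).seq <|
  (Frag.assign 5 ((var 2 - 3) / (var 3 + 1))).seq <|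
  (Frag.assign 6 (var 2 / var 5 + 1)).seq <|
  (Frag.assign 7 ((var 1 / var 4 + 1) * var 6)).seq <|
  (Frag.assign 8 (3 + (var 1 + var 2) * var 3)).seq <|
  Frag.doWhile (callCode p) (var 9) (var 7)

/-- Adds the product of two entries. -/
def productCode : Frag :=
  (Frag.assign 14 (var 14 + .mem (3 + (var 9 / var 2 * var 3 + var 15)) *
    .mem (3 + ((var 1 + var 9 % var 2) * var 3 + var 15)))).seq <|
  Frag.assign 15 (var 15 + 1)

/-- Checks the pair of vectors with number `var 9`. -/
def pairCode : Frag :=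
  (Frag.assign 14 0).seq <|
  (Frag.assign 15 0).seq <|
  (Frag.doWhile productCode (var 15) (var 3)).seq <|
  (Frag.assign 0 (.ite (var 14) 1 1 (var 0))).seq <|
  Frag.assign 9 (var 9 + 1)

/-- Checks all pairs of vectors. -/
def bruteCode : Frag := Frag.doWhile pairCode (var 9) (var 1 * var 2)

/-- The reduction. -/
def reductionCode (p : Program) : Frag :=
  (Frag.assign 1 (.mem 0)).seq <|
  (Frag.assign 2 (.mem 1)).seq <|
  (Frag.assign 3 (.mem 2)).seq <|
  Frag.ifLt (var 2) (var 3 + 22) bruteCode (mainCode p)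

section spec

variable {n m d n₁ m₁ k K L B W : ℕ} {x : ℕ → ℕ}

theorem fillCode_spec (hB : 32 ≤ B) (hW : B ^ 2 ^ 16 ≤ W) (hn : 1 ≤ n) (hm : 1 ≤ m) (hK : 0 < K)
    (hL : L = 3 + (n + m) * d) (hx : ∀ a, x (3 + a) ≤ 1) (hBig : m + n + 3 < B)
    {b i₀ j₀ : ℕ} (hb : L ≤ b) {m₀ : ℕ → ℕ} (hm₀ : ∀ a < L, m₀ a = x a)
    {v mem : ℕ → ℕ} (hv : Context n m d n₁ m₁ k K L v) (h10 : v 10 = i₀) (h11 : v 11 = j₀)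
    (h12 : v 12 = b) (h13 : v 13 = 0) (hbd : Bounded B v mem)
    (hF : Filled b K (fun a => (inputWords n m d n₁ m₁ i₀ j₀ x).getD a 0) m₀
      (Written (m + n) 0) mem) :
    Hoare W ((m + n) * 13000) fillCode v mem (fun v' mem' => (∀ i < 13, v' i = v i) ∧
      (∀ i, 32 ≤ i → v' i = v i) ∧ Bounded B v' mem' ∧
      Filled b K (fun a => (inputWords n m d n₁ m₁ i₀ j₀ x).getD a 0) m₀
        (Written (m + n) (m + n)) mem') := by
  have h := Hoare.doWhile (T := 12000) (f := vertexCode) (a := var 13) (b := var 2 + var 1)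
    (k := m + n) (one_lt_of_pow_le hB hW) (v := v) (m := mem)
    (I := fun t v' mem' => (∀ i < 13, v' i = v i) ∧ (∀ i, 32 ≤ i → v' i = v i) ∧ v' 13 = t ∧
      Bounded B v' mem' ∧ Filled b K (fun a => (inputWords n m d n₁ m₁ i₀ j₀ x).getD a 0) m₀
        (Written (m + n) t) mem') ?_ (by omega) ⟨fun _ _ => rfl, fun _ _ => rfl, h13, hbd, hF⟩
  · refine h.mono (Nat.mul_le_mul_left _ (by decide)) ?_
    rintro v' mem' ⟨h1, h2, -, h3, h4⟩
    exact ⟨h1, h2, h3, h4⟩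
  · rintro t ht v' mem' ⟨h1, h2, h3, h4, h5⟩
    have hv' : Context n m d n₁ m₁ k K L v' :=
      ⟨(h1 1 (by norm_num)).trans hv.one, (h1 2 (by norm_num)).trans hv.two,
        (h1 3 (by norm_num)).trans hv.three, (h1 4 (by norm_num)).trans hv.four,
        (h1 5 (by norm_num)).trans hv.five, (h1 6 (by norm_num)).trans hv.six,
        (h1 7 (by norm_num)).trans hv.seven, (h1 8 (by norm_num)).trans hv.eight⟩
    refine (vertexCode_spec hB hW hn hm hK hL hx hBig hb hm₀ ht hv'
      ((h1 10 (by norm_num)).trans h10) ((h1 11 (by norm_num)).trans h11)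
      ((h1 12 (by norm_num)).trans h12) h3 h4 h5).mono le_rfl ?_
    rintro v₂ mem₂ ⟨g1, g2, g3, g4, g5⟩
    refine ⟨⟨fun i hi => (g1 i hi).trans (h1 i hi), fun i hi => (g2 i hi).trans (h2 i hi), g3, g4,
      g5⟩, Small.fits (by decide) hB hW g4, Small.fits (by decide) hB hW g4, ?_⟩
    simp only [eval_var, eval_add]
    rw [g3, g1 2 (by norm_num), g1 1 (by norm_num), hv'.one, hv'.two]

/-- The state before call number `c`; `yes` says which calls so far had a positive answer. -/
structure CallState (n m d n₁ m₁ k K L B : ℕ) (x : ℕ → ℕ) (yes : ℕ → Prop) (c : ℕ)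
    (v mem : ℕ → ℕ) : Prop where
  context : Context n m d n₁ m₁ k K L v
  count : v 9 = c
  answer : v 0 = 1 ↔ ∃ c' < c, yes c'
  callee : ∀ i, v (32 + i) = 0
  bounded : Bounded B v mem
  input : ∀ a < L, mem a = x a
  free : ∀ c', c ≤ c' → c' < K → ∀ a, mem (L + c' + a * K) = 0

/-- Different calls live in different residue classes modulo K, so no call can spoil the zero memory
of a later one. -/
theorem add_mul_ne {L K c c' a a' : ℕ} (hc : c < K) (hc' : c' < K) (h : c ≠ c') :
    L + c + a * K ≠ L + c' + a' * K := by
  intro he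
  have h1 : a * K + c = a' * K + c' := by omega
  have h2 := TwoHub.add_mul_mod_of_lt (i := a) hc
  rw [h1, TwoHub.add_mul_mod_of_lt hc'] at h2
  exact h h2.symm

/-- One call fills its residue class with the input words, runs the called program, sets the answer
if the output is below 21, and resets the registers. The class is left dirty, since it is never used
again. -/
theorem callCode_spec (hB : 32 ≤ B) (hW : B ^ 2 ^ 16 ≤ W) (hn : 1 ≤ n) (hm : 1 ≤ m)
    (hL : L = 3 + (n + m) * d) (hx : ∀ a, x (3 + a) ≤ 1) {p : Program} {kp X T : ℕ}
    (hX : X = (4 + 10 * (m + n) + 2) ^ kp)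
    (hBig : L + K * (n + m + 10) + 3 * (m + n) + 50 + X < B) (hn₁ : n₁ ≤ n) (hm₁ : m₁ ≤ m)
    {yes : ℕ → Prop} {c : ℕ} (hc : c < K)
    (hp : ∃ t ≤ T, ∃ out, p.Computes kp (inputWords n m d n₁ m₁ (c / k * n₁) (c % k * m₁) x) t out ∧
      (out.1 < 21 * out.2 ↔ yes c))
    {v mem : ℕ → ℕ} (h : CallState n m d n₁ m₁ k K L B x yes c v mem) :
    Hoare W (8000 + p.regBound + (m + n) * 13000 + 4 * T) (callCode p) v mem
      (CallState n m d n₁ m₁ k K L B x yes (c + 1)) := by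
  have hKn : K ≤ K * (n + m + 10) := Nat.le_mul_of_pos_right _ (by omega)
  have hi₀ : c / k * n₁ < B := by
    have h1 : c / k * n₁ ≤ K * (n + m + 10) :=
      Nat.mul_le_mul ((Nat.div_le_self c k).trans hc.le) (by omega)
    omega
  have hj₀ : c % k * m₁ < B := by
    have h1 : c % k * m₁ ≤ K * (n + m + 10) :=
      Nat.mul_le_mul ((Nat.mod_le c k).trans hc.le) (by omega)
    omega
  have hK : 0 < K := by omega
  obtain ⟨i₀, hi₀'⟩ : ∃ i₀, i₀ = c / k * n₁ := ⟨_, rfl⟩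
  obtain ⟨j₀, hj₀'⟩ : ∃ j₀, j₀ = c % k * m₁ := ⟨_, rfl⟩
  rw [← hi₀'] at hi₀ hp
  rw [← hj₀'] at hj₀ hp
  have e10 : (var 9 / var 6 * var 4).eval v mem = i₀ := by
    simp only [eval_mul, eval_div, eval_var, h.count, h.context.six, h.context.four, hi₀']
  refine (Hoare.set_seq hB hW h.bounded (by decide) (by rw [e10]; exact hi₀)
    (T := 7500 + p.regBound + (m + n) * 13000 + 4 * T) ?_).mono (by omega) fun _ _ h => h
  rw [e10]
  intro hb
  have e11 : (var 9 % var 6 * var 5).eval (Function.update v 10 i₀) mem = j₀ := by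
    simp [h.count, h.context.six, h.context.five, hj₀']
  refine (Hoare.set_seq hB hW hb (by decide) (by rw [e11]; exact hj₀)
    (T := 7000 + p.regBound + (m + n) * 13000 + 4 * T) ?_).mono (by omega) fun _ _ h => h
  rw [e11]
  intro hb
  have e12 : (var 8 + var 9).eval (Function.update (Function.update v 10 i₀) 11 j₀) mem =
      L + c := by
    simp [h.count, h.context.eight]
  refine (Hoare.set_seq hB hW hb (by decide) (by rw [e12]; omega)
    (T := 6500 + p.regBound + (m + n) * 13000 + 4 * T) ?_).mono (by omega) fun _ _ h => h
  rw [e12]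
  intro hb
  refine (Hoare.set_seq hB hW hb (by decide) (by simp; omega)
    (T := 6000 + p.regBound + (m + n) * 13000 + 4 * T) ?_).mono (by omega) fun _ _ h => h
  rw [eval_ofNat]
  intro hb
  obtain ⟨w, hw⟩ : ∃ w, w = Function.update (Function.update (Function.update
    (Function.update v 10 i₀) 11 j₀) 12 (L + c)) 13 0 := ⟨_, rfl⟩
  rw [← hw] at hb ⊢
  have w10 : w 10 = i₀ := by simp [hw]
  have w11 : w 11 = j₀ := by simp [hw]
  have w12 : w 12 = L + c := by simp [hw]
  have w13 : w 13 = 0 := by simp [hw]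
  have wv : ∀ i, i < 10 ∨ 13 < i → w i = v i := by
    intro i hi
    rw [hw, Function.update_of_ne (by omega), Function.update_of_ne (by omega),
      Function.update_of_ne (by omega), Function.update_of_ne (by omega)]
  have wc : Context n m d n₁ m₁ k K L w := by
    rw [hw]
    exact (((h.context.update (by omega) _).update (by omega) _).update (by omega) _).update
      (by omega) _
  obtain ⟨words, hwords⟩ : ∃ words : ℕ → ℕ,
    words = fun a => (inputWords n m d n₁ m₁ i₀ j₀ x).getD a 0 := ⟨_, rfl⟩
  have hval : ∀ q ∈ headerWords, ∀ mem, q.2.eval w mem = words (q.1.eval w 0) ∧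
      q.2.eval w mem < B ∧ q.1.eval w mem = q.1.eval w 0 := by
    intro q hq mem
    simp only [headerWords, List.mem_cons, List.not_mem_nil, or_false] at hq
    rcases hq with rfl | rfl | rfl | rfl <;>
      simp only [eval_var, eval_ofNat, eval_add, eval_mul, wc.one, wc.two, hwords] <;>
      rw [inputWords_header (by norm_num)] <;>
      refine ⟨?_, ?_, ?_⟩ <;> first | trivial | rfl | omega
  have hF₀ : Filled (w 12) (w 7) words mem (fun _ => False) mem := by
    refine ⟨fun _ h => h.elim, fun a _ => ?_, fun _ _ => rfl⟩
    rw [w12, wc.seven]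
    exact h.free c le_rfl hc a
  have hputs := Hoare.puts hB hW hb.1 (by rw [wc.seven]; exact hK) headerWords (by decide)
    (w := words) (m₀ := mem) (fun e => e.eval w 0) (fun q hq m' => (hval q hq m').2.2)
    (fun q hq m' => (hval q hq m').1) (fun q hq => by
      have := hval q hq 0
      rw [← this.1]
      exact this.2.1) (fun _ => False) mem hb.2 hF₀
  refine (hputs.seq (T' := 2000 + p.regBound + (m + n) * 13000 + 4 * T) ?_).mono
    (by simp [headerWords]; omega) fun _ _ h => h
  rintro _ mem₁ ⟨rfl, hb₁, hF₁⟩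
  rw [w12, wc.seven] at hF₁
  have hF₁' : Filled (L + c) K words mem (Written (m + n) 0) mem₁ := by
    refine hF₁.congr fun a => ?_
    simp only [headerWords, List.mem_cons, List.not_mem_nil, or_false, exists_eq_or_imp,
      exists_eq_left, eval_ofNat, Written, false_or, Nat.reduceMul]
    omega
  subst hwords
  have hfill := fillCode_spec hB hW hn hm hK hL hx (by omega) (by omega) h.input wc w10 w11 w12
    w13 ⟨hb.1, hb₁⟩ hF₁'
  refine (hfill.seq (T' := 2000 + p.regBound + 4 * T) ?_).mono (by omega) fun _ _ h => h
  rintro v₂ mem₂ ⟨hv₂, hv₂', hb₂, hF₂⟩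
  obtain ⟨t, ht, out, hcomp, hyes⟩ := hp
  have s12 : v₂ 12 = L + c := (hv₂ 12 (by norm_num)).trans w12
  have s7 : v₂ 7 = K := (hv₂ 7 (by norm_num)).trans wc.seven
  have hsq := sq_le_of_pow_le hB hW
  -- The addresses of the embedded memory reach about X * K, where both factors are below B; they
  -- fit because B ^ 2 ≤ W.
  have hXK : X * K ≤ (B - 1) * B := Nat.mul_le_mul (by omega) (by omega)
  have hBB : (B - 1) * B + B = B ^ 2 := by
    obtain ⟨e, rfl⟩ : ∃ e, B = e + 1 := ⟨B - 1, by omega⟩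
    rw [Nat.add_sub_cancel]; ring
  have hcall := Hoare.call (W := W) (X := X) hcomp (by rw [length_inputWords]; exact hX)
    (v := v₂) (m := mem₂) (by rw [s7]; exact hK)
    (by omega) (by rw [s12, s7]; omega) (one_lt_of_pow_le hB hW)
    (fun i => by rw [hv₂' _ (by omega), wv _ (by omega), h.callee])
    (fun a => by
      rw [s12, s7]
      by_cases ha : a < 4 + 10 * (m + n)
      · exact hF₂.mem a (by unfold Written; omega)
      · rw [hF₂.zero a (by unfold Written; omega), inputWords_beyond (by omega)])
  refine (hcall.seq (T' := 1900 + p.regBound) ?_).mono (by omega) fun _ _ h => h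
  rintro v₃ mem₃ ⟨own, regs, hout1, hout2, hregs, hmemX, hrest⟩
  rw [s12, s7] at hmemX hrest
  have own' : ∀ i < 10, v₃ i = v i := fun i hi =>
    (own i (by omega)).trans ((hv₂ i (by omega)).trans (wv i (by omega)))
  have hb₃ : Bounded B v₃ mem₃ := by
    refine ⟨fun i => ?_, fun y => ?_⟩
    · rcases Nat.lt_or_ge i 32 with hi | hi
      · rw [own i hi]; exact hb₂.1 i
      · obtain ⟨e, rfl⟩ := Nat.exists_eq_add_of_le hi
        exact (hregs e).trans (by omega)
    · by_cases hy : ∀ a, y ≠ L + c + a * K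
      · rw [hrest y hy]; exact hb₂.2 y
      · push Not at hy
        obtain ⟨a, rfl⟩ := hy
        exact (hmemX a).trans (by omega)
  have hinput₃ : ∀ a < L, mem₃ a = x a := by
    intro a ha
    have hne : ∀ i, a ≠ L + c + i * K := fun i => by omega
    rw [hrest a hne, hF₂.rest a hne, h.input a ha]
  have hfree₃ : ∀ c', c + 1 ≤ c' → c' < K → ∀ a, mem₃ (L + c' + a * K) = 0 := by
    intro c' h1 h2 a
    have hne : ∀ i, L + c' + a * K ≠ L + c + i * K := fun i => add_mul_ne h2 hc (by omega)
    rw [hrest _ hne, hF₂.rest _ hne, h.free c' (by omega) h2]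
  have eans : (Expr.ite (var 32) (21 * var 33) 1 (var 0)).eval v₃ mem₃ =
      if out.1 < 21 * out.2 then 1 else v 0 := by
    simp only [eval_ite, eval_var, eval_mul, eval_ofNat, hout1, hout2, own' 0 (by norm_num)]
  have hans : (if out.1 < 21 * out.2 then 1 else v 0) < B := by
    split_ifs
    · omega
    · exact h.bounded.1 0
  refine (Hoare.set_seq hB hW hb₃ (by decide) (by rw [eans]; exact hans)
    (T := 1400 + p.regBound) ?_).mono (by omega) fun _ _ h => h
  rw [eans]
  intro hb₄
  refine ((Hoare.reset (by have := one_lt_of_pow_le hB hW; omega) p.regBound _ mem₃).seq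
    (T' := 500) ?_).mono (by omega) fun _ _ h => h
  rintro v₅ mem₅ ⟨hmem₅, hv₅⟩
  subst mem₅
  have hlow : ∀ i, 0 < i → i < 10 → v₅ i = v i := by
    intro i h1 h2
    rw [hv₅, if_neg (by omega), Function.update_of_ne (by omega), own' i h2]
  have hb₅ : Bounded B v₅ mem₃ := by
    refine ⟨fun i => ?_, hb₄.2⟩
    rw [hv₅]
    by_cases hi : 32 ≤ i ∧ i < 32 + p.regBound
    · rw [if_pos hi]; omega
    · rw [if_neg hi]; exact hb₄.1 i
  have hcallee : ∀ i, v₅ (32 + i) = 0 := by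
    intro i
    rw [hv₅]
    by_cases hi : 32 ≤ 32 + i ∧ 32 + i < 32 + p.regBound
    · rw [if_pos hi]
    · rw [if_neg hi, Function.update_of_ne (by omega), regs, p.reg_eq_zero _ _ (by omega)]
  have e9 : (var 9 + 1).eval v₅ mem₃ = c + 1 := by
    simp only [eval_add, eval_var, eval_ofNat, hlow 9 (by norm_num) (by norm_num), h.count]
  refine Hoare.set hB hW hb₅ 9 (by decide) (by rw [e9]; omega) fun hb₆ => ?_
  rw [e9] at hb₆ ⊢
  have hctx : Context n m d n₁ m₁ k K L v₅ :=
    ⟨(hlow 1 (by norm_num) (by norm_num)).trans h.context.one,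
      (hlow 2 (by norm_num) (by norm_num)).trans h.context.two,
      (hlow 3 (by norm_num) (by norm_num)).trans h.context.three,
      (hlow 4 (by norm_num) (by norm_num)).trans h.context.four,
      (hlow 5 (by norm_num) (by norm_num)).trans h.context.five,
      (hlow 6 (by norm_num) (by norm_num)).trans h.context.six,
      (hlow 7 (by norm_num) (by norm_num)).trans h.context.seven,
      (hlow 8 (by norm_num) (by norm_num)).trans h.context.eight⟩
  refine ⟨hctx.update (by omega) _, Function.update_self .., ?_, fun i => ?_, hb₆, hinput₃, hfree₃⟩
  · have e0 : v₅ 0 = if out.1 < 21 * out.2 then 1 else v 0 := by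
      rw [hv₅, if_neg (by omega), Function.update_self]
    rw [Function.update_of_ne (by omega), e0]
    constructor
    · intro h1
      split_ifs at h1 with h2
      · exact ⟨c, by omega, hyes.1 h2⟩
      · obtain ⟨c', h3, h4⟩ := h.answer.1 h1
        exact ⟨c', by omega, h4⟩
    · rintro ⟨c', h1, h2⟩
      split_ifs with h3
      · rfl
      · rcases Nat.lt_succ_iff_lt_or_eq.1 h1 with h4 | rfl
        · exact h.answer.2 ⟨c', h4, h2⟩
        · exact absurd (hyes.2 h2) h3
  · rw [Function.update_of_ne (by omega), hcallee]

end spec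

end Reduction

/-! ### All calls, brute force, and the choice between them. -/

namespace Reduction

open WordRAM WordRAM.Expr

section spec

variable {n m d n₁ m₁ k K L B W : ℕ} {x : ℕ → ℕ}

theorem mainCode_spec (hB : 32 ≤ B) (hW : B ^ 2 ^ 16 ≤ W) (hn : 1 ≤ n) (hm : 1 ≤ m)
    (hL : L = 3 + (n + m) * d) (hx : ∀ a, x (3 + a) ≤ 1) (hxL : ∀ a, L ≤ a → x a = 0)
    {p : Program} {kp X T : ℕ} (hX : X = (4 + 10 * (m + n) + 2) ^ kp)
    (hBig : L + K * (n + m + 10) + 3 * (m + n) + 50 + X < B) (hn₁ : n₁ = n / (d + 2))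
    (hm₁ : m₁ = (m - 3) / (d + 1)) (hk : k = m / m₁ + 1) (hK : K = (n / n₁ + 1) * k)
    {yes : ℕ → Prop}
    (hp : ∀ c < K, ∃ t ≤ T, ∃ out,
      p.Computes kp (inputWords n m d n₁ m₁ (c / k * n₁) (c % k * m₁) x) t out ∧
      (out.1 < 21 * out.2 ↔ yes c))
    {v : ℕ → ℕ} (hv : Bounded B v x) (h1 : v 1 = n) (h2 : v 2 = m) (h3 : v 3 = d)
    (h0 : ∀ i, i = 0 ∨ 4 ≤ i → v i = 0) :
    Hoare W (2500 + K * (8100 + p.regBound + (m + n) * 13000 + 4 * T)) (mainCode p) v x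
      (fun v' _ => v' 0 = 1 ↔ ∃ c < K, yes c) := by
  have hK0 : 1 ≤ K := by
    rw [hK, hk]
    exact Nat.mul_pos (Nat.succ_pos _) (Nat.succ_pos _)
  have hn₁' : n₁ ≤ n := hn₁ ▸ Nat.div_le_self _ _
  have hm₁' : m₁ ≤ m := hm₁ ▸ (Nat.div_le_self _ _).trans (Nat.sub_le _ _)
  have hKn : K ≤ K * (n + m + 10) := Nat.le_mul_of_pos_right _ (by omega)
  have hk' : k ≤ m + 1 := hk ▸ Nat.succ_le_succ (Nat.div_le_self _ _)
  have e4 : (var 1 / (var 3 + 2)).eval v x = n₁ := by simp [h1, h3, hn₁]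
  refine (Hoare.set_seq hB hW hv (by decide) (by rw [e4]; omega)
    (T := 2000 + K * (8100 + p.regBound + (m + n) * 13000 + 4 * T)) ?_).mono (by omega)
    fun _ _ h => h
  rw [e4]
  intro hv
  have e5 : ((var 2 - 3) / (var 3 + 1)).eval (Function.update v 4 n₁) x = m₁ := by
    simp [h2, h3, hm₁]
  refine (Hoare.set_seq hB hW hv (by decide) (by rw [e5]; omega)
    (T := 1500 + K * (8100 + p.regBound + (m + n) * 13000 + 4 * T)) ?_).mono (by omega)
    fun _ _ h => h
  rw [e5]
  intro hv
  have e6 : (var 2 / var 5 + 1).eval (Function.update (Function.update v 4 n₁) 5 m₁) x = k := by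
    simp [h2, hk]
  refine (Hoare.set_seq hB hW hv (by decide) (by rw [e6]; omega)
    (T := 1000 + K * (8100 + p.regBound + (m + n) * 13000 + 4 * T)) ?_).mono (by omega)
    fun _ _ h => h
  rw [e6]
  intro hv
  have e7 : ((var 1 / var 4 + 1) * var 6).eval (Function.update (Function.update
      (Function.update v 4 n₁) 5 m₁) 6 k) x = K := by
    simp [h1, hK]
  refine (Hoare.set_seq hB hW hv (by decide) (by rw [e7]; omega)
    (T := 500 + K * (8100 + p.regBound + (m + n) * 13000 + 4 * T)) ?_).mono (by omega)
    fun _ _ h => h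
  rw [e7]
  intro hv
  have e8 : (3 + (var 1 + var 2) * var 3).eval (Function.update (Function.update (Function.update
      (Function.update v 4 n₁) 5 m₁) 6 k) 7 K) x = L := by
    simp [h1, h2, h3, hL]
  refine (Hoare.set_seq hB hW hv (by decide) (by rw [e8]; omega)
    (T := K * (8100 + p.regBound + (m + n) * 13000 + 4 * T)) ?_).mono (by omega)
    fun _ _ h => h
  rw [e8]
  intro hv
  refine (Hoare.doWhile (one_lt_of_pow_le hB hW) (k := K)
    (I := CallState n m d n₁ m₁ k K L B x yes)
    (T := 8000 + p.regBound + (m + n) * 13000 + 4 * T) ?_ hK0 ?_).mono ?_ fun _ _ h => h.answer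
  · intro c hc w mem hw
    refine (callCode_spec hB hW hn hm hL hx hX hBig hn₁' hm₁' hc (hp c hc) hw).mono le_rfl ?_
    intro w' mem' hw'
    refine ⟨hw', Small.fits (by decide) hB hW hw'.bounded,
      Small.fits (by decide) hB hW hw'.bounded, ?_⟩
    rw [eval_var, eval_var, hw'.count, hw'.context.seven]
  -- At the start all residue classes are free, because memory beyond the input is zero.
  · refine ⟨⟨?_, ?_, ?_, ?_, ?_, ?_, ?_, ?_⟩, ?_, ?_, fun i => ?_, hv, fun _ _ => rfl,
      fun c' _ _ a => hxL _ (by omega)⟩ <;> try simp [h1, h2, h3, h0]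
    rw [Function.update_of_ne (by omega), Function.update_of_ne (by omega),
      Function.update_of_ne (by omega), Function.update_of_ne (by omega),
      Function.update_of_ne (by omega), h0 _ (by omega)]
  · refine Nat.mul_le_mul_left _ ?_
    simp only [cost]
    omega

/-- The state of the loops over all pairs. -/
structure PairState (n m d B : ℕ) (x : ℕ → ℕ) (c : ℕ) (v mem : ℕ → ℕ) : Prop where
  one : v 1 = n
  two : v 2 = m
  three : v 3 = d
  count : v 9 = c
  input : mem = x
  bounded : Bounded B v mem

theorem productCode_spec (hB : 32 ≤ B) (hW : B ^ 2 ^ 16 ≤ W) (hx : ∀ a, x (3 + a) ≤ 1)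
    (hdB : d + 2 < B) {c l : ℕ} (hl : l ≤ d) {v mem : ℕ → ℕ} (h : PairState n m d B x c v mem)
    (h14 : v 14 = 0 ↔ ∀ l' < l, bitA d x (c / m) l' = 0 ∨ bitB n d x (c % m) l' = 0)
    (hle : v 14 ≤ l) (h15 : v 15 = l) :
    Hoare W 1000 productCode v mem (fun v' mem' => PairState n m d B x c v' mem' ∧ v' 0 = v 0 ∧
      (v' 14 = 0 ↔ ∀ l' < l + 1, bitA d x (c / m) l' = 0 ∨ bitB n d x (c % m) l' = 0) ∧
      v' 14 ≤ l + 1 ∧ v' 15 = l + 1) := by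
  have hA : bitA d x (c / m) l ≤ 1 := hx _
  have hB' : bitB n d x (c % m) l ≤ 1 := hx _
  have hprod := Nat.mul_le_mul hA hB'
  obtain ⟨s, hs⟩ : ∃ s, s = v 14 + bitA d x (c / m) l * bitB n d x (c % m) l := ⟨_, rfl⟩
  have e14 : (var 14 + Expr.mem (3 + (var 9 / var 2 * var 3 + var 15)) *
      Expr.mem (3 + ((var 1 + var 9 % var 2) * var 3 + var 15))).eval v mem = s := by
    simp [h.one, h.two, h.three, h.count, h.input, h15, hs, bitA, bitB]
  refine (Hoare.set_seq hB hW h.bounded (by decide) (by rw [e14]; omega) (T := 500) ?_).mono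
    (by omega) fun _ _ h => h
  rw [e14]
  intro hb
  have e15 : (var 15 + 1).eval (Function.update v 14 s) mem = l + 1 := by simp [h15]
  refine Hoare.set hB hW hb 15 (by decide) (by rw [e15]; omega) fun hb' => ?_
  rw [e15] at hb' ⊢
  refine ⟨⟨?_, ?_, ?_, ?_, h.input, hb'⟩, ?_, ?_, ?_, ?_⟩
  · simp [h.one]
  · simp [h.two]
  · simp [h.three]
  · simp [h.count]
  · simp
  · have : (Function.update (Function.update v 14 s) 15 (l + 1)) 14 = s := by simp
    rw [this, hs, Nat.add_eq_zero_iff, h14, Nat.mul_eq_zero, Nat.forall_lt_succ_right]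
  · simp; omega
  · simp

theorem pairCode_spec (hB : 32 ≤ B) (hW : B ^ 2 ^ 16 ≤ W) (hx : ∀ a, x (3 + a) ≤ 1)
    (hd : d = 0 → x 3 = 0) (hdB : d + 2 < B) {c : ℕ} (hc : c + 1 < B) {v mem : ℕ → ℕ}
    (h : PairState n m d B x c v mem) {yes : ℕ → Prop} (hans : v 0 = 1 ↔ ∃ c' < c, yes c')
    (hyes : yes c ↔ ∀ l < d, bitA d x (c / m) l = 0 ∨ bitB n d x (c % m) l = 0) :
    Hoare W (2000 + (d + 1) * 1010) pairCode v mem (fun v' mem' =>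
      PairState n m d B x (c + 1) v' mem' ∧ (v' 0 = 1 ↔ ∃ c' < c + 1, yes c')) := by
  refine (Hoare.set_seq hB hW h.bounded (by decide) (by simp; omega)
    (T := 1500 + (d + 1) * 1010) ?_).mono (by omega) fun _ _ h => h
  rw [eval_ofNat]
  intro hb
  refine (Hoare.set_seq hB hW hb (by decide) (by simp; omega)
    (T := 1000 + (d + 1) * 1010) ?_).mono (by omega) fun _ _ h => h
  rw [eval_ofNat]
  intro hb
  -- The loop runs once even for d = 0. It then reads the cell behind the empty vectors, which holds
  -- 0, so the sum stays 0 and the answer is right.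
  have hloop := Hoare.doWhile (T := 1000) (f := productCode) (a := var 15) (b := var 3)
    (k := max d 1) (one_lt_of_pow_le hB hW)
    (v := Function.update (Function.update v 14 0) 15 0) (m := mem)
    (I := fun l v' mem' => PairState n m d B x c v' mem' ∧ v' 0 = v 0 ∧
      (v' 14 = 0 ↔ ∀ l' < l, bitA d x (c / m) l' = 0 ∨ bitB n d x (c % m) l' = 0) ∧
      v' 14 ≤ l ∧ v' 15 = l) ?_ (by omega) ?_
  · refine (hloop.seq (T' := 1000) ?_).mono ?_ fun _ _ h => h
    · rintro v' mem' ⟨h', h0, h14, -, -⟩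
      have hzero : v' 14 = 0 ↔ yes c := by
        rw [h14, hyes]
        rcases Nat.eq_zero_or_pos d with rfl | hd0
        · refine ⟨fun _ l hl => absurd hl (Nat.not_lt_zero l), fun _ l hl => Or.inl ?_⟩
          obtain rfl : l = 0 := by simpa using hl
          simpa [bitA] using hd rfl
        · rw [max_eq_left hd0]
      have e0 : (Expr.ite (var 14) 1 1 (var 0)).eval v' mem' = if v' 14 = 0 then 1 else v 0 := by
        simp [h0]
      have hlt : (if v' 14 = 0 then 1 else v 0) < B := by
        split_ifs
        · omega
        · exact h.bounded.1 0
      refine (Hoare.set_seq hB hW h'.bounded (by decide) (by rw [e0]; exact hlt)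
        (T := 500) ?_).mono (by omega) fun _ _ h => h
      rw [e0]
      intro hb'
      have e9 : (var 9 + 1).eval (Function.update v' 0 (if v' 14 = 0 then 1 else v 0)) mem' =
          c + 1 := by simp [h'.count]
      refine Hoare.set hB hW hb' 9 (by decide) (by rw [e9]; omega) fun hb'' => ?_
      rw [e9] at hb'' ⊢
      refine ⟨⟨by simp [h'.one], by simp [h'.two], by simp [h'.three], by simp, h'.input, hb''⟩, ?_⟩
      rw [Function.update_of_ne (by omega), Function.update_self]
      constructor
      · intro h1
        by_cases h2 : v' 14 = 0
        · exact ⟨c, by omega, hzero.1 h2⟩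
        · rw [if_neg h2] at h1
          obtain ⟨c', h3, h4⟩ := hans.1 h1
          exact ⟨c', by omega, h4⟩
      · rintro ⟨c', h1, h2⟩
        by_cases h3 : v' 14 = 0
        · rw [if_pos h3]
        · rw [if_neg h3]
          rcases Nat.lt_succ_iff_lt_or_eq.1 h1 with h4 | rfl
          · exact hans.2 ⟨c', h4, h2⟩
          · exact absurd (hzero.2 h2) h3
    · have : max d 1 * (1000 + ((var 15).cost + (var 3).cost) + 1) ≤ (d + 1) * 1010 :=
        Nat.mul_le_mul (by omega) (by decide)
      omega
  · rintro l hl v' mem' ⟨h', h0, h14, hle, h15⟩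
    refine (productCode_spec hB hW hx hdB (by omega) h' h14 hle h15).mono le_rfl ?_
    rintro v'' mem'' ⟨g', g0, g14, gle, g15⟩
    refine ⟨⟨g', g0.trans h0, g14, gle, g15⟩, Small.fits (by decide) hB hW g'.bounded,
      Small.fits (by decide) hB hW g'.bounded, ?_⟩
    rw [eval_var, eval_var, g15, g'.three]
    omega
  · exact ⟨⟨by simp [h.one], by simp [h.two], by simp [h.three], by simp [h.count], h.input, hb⟩,
      by simp, by simp, by simp, by simp⟩

theorem bruteCode_spec (hB : 32 ≤ B) (hW : B ^ 2 ^ 16 ≤ W) (hn : 1 ≤ n) (hm : 1 ≤ m)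
    (hx : ∀ a, x (3 + a) ≤ 1) (hd : d = 0 → x 3 = 0) (hdB : d + 2 < B) (hnm : n * m < B)
    {v : ℕ → ℕ} (hv : Bounded B v x) (h1 : v 1 = n) (h2 : v 2 = m) (h3 : v 3 = d) (h9 : v 9 = 0)
    (h0 : v 0 = 0) :
    Hoare W (n * m * (2010 + (d + 1) * 1010)) bruteCode v x (fun v' _ => v' 0 = 1 ↔
      ∃ c < n * m, ∀ l < d, bitA d x (c / m) l = 0 ∨ bitB n d x (c % m) l = 0) := by
  refine (Hoare.doWhile (one_lt_of_pow_le hB hW) (k := n * m)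
    (I := fun c v' mem' => PairState n m d B x c v' mem' ∧ (v' 0 = 1 ↔ ∃ c' < c,
      ∀ l < d, bitA d x (c' / m) l = 0 ∨ bitB n d x (c' % m) l = 0))
    (T := 2000 + (d + 1) * 1010) ?_ (Nat.mul_pos hn hm) ?_).mono ?_ fun _ _ h => h.2
  · rintro c hc w mem ⟨hw, hans⟩
    refine (pairCode_spec hB hW hx hd hdB (by omega) hw hans Iff.rfl).mono le_rfl ?_
    rintro w' mem' ⟨hw', hans'⟩
    refine ⟨⟨hw', hans'⟩, Small.fits (by decide) hB hW hw'.bounded,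
      Small.fits (by decide) hB hW hw'.bounded, ?_⟩
    rw [eval_var, eval_mul, eval_var, eval_var, hw'.count, hw'.one, hw'.two]
  · exact ⟨⟨h1, h2, h3, h9, rfl, hv⟩, by simp [h0]⟩
  · refine Nat.mul_le_mul_left _ ?_
    have e : (var 9).cost + (var 1 * var 2).cost = 4 := rfl
    omega

/-- There is a pair of orthogonal vectors. -/
def Orthogonal (n m d : ℕ) (x : ℕ → ℕ) : Prop :=
  ∃ i < n, ∃ j < m, ∀ l < d, bitA d x i l = 0 ∨ bitB n d x j l = 0

/-- There is a pair of orthogonal vectors in the windows that belong to number `c`. -/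
def OrthogonalWindow (n m d n₁ m₁ k : ℕ) (x : ℕ → ℕ) (c : ℕ) : Prop :=
  ∃ i < n₁, ∃ j < m₁, ∀ l < d, bitA d x ((c / k * n₁ + i) % n) l = 0 ∨
    bitB n d x ((c % k * m₁ + j) % m) l = 0

/-- The windows cover both families. The last window may run over the end and wraps around; this
only repeats genuine vectors, so no padding vectors are needed. -/
theorem exists_orthogonalWindow (hn : 1 ≤ n) (hm : 1 ≤ m) (hn₁ : 1 ≤ n₁) (hm₁ : 1 ≤ m₁)
    (hk : k = m / m₁ + 1) (hK : K = (n / n₁ + 1) * k) :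
    (∃ c < K, OrthogonalWindow n m d n₁ m₁ k x c) ↔ Orthogonal n m d x := by
  constructor
  · rintro ⟨c, -, i, -, j, -, h⟩
    exact ⟨_, Nat.mod_lt _ hn, _, Nat.mod_lt _ hm, h⟩
  · rintro ⟨i, hi, j, hj, h⟩
    have hjk : j / m₁ < k := by
      rw [hk]
      exact Nat.lt_succ_of_le (Nat.div_le_div_right hj.le)
    have hin : i / n₁ < n / n₁ + 1 := Nat.lt_succ_of_le (Nat.div_le_div_right hi.le)
    refine ⟨i / n₁ * k + j / m₁, hK ▸ TwoHub.mul_add_lt_mul hjk hin, i % n₁, Nat.mod_lt _ hn₁,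
      j % m₁, Nat.mod_lt _ hm₁, ?_⟩
    rw [TwoHub.add_mul_div_of_lt hjk, TwoHub.add_mul_mod_of_lt hjk, Nat.div_add_mod',
      Nat.div_add_mod', Nat.mod_eq_of_lt hi, Nat.mod_eq_of_lt hj]
    exact h

theorem exists_pair_iff (hm : 1 ≤ m) : (∃ c < n * m, ∀ l < d, bitA d x (c / m) l = 0 ∨
    bitB n d x (c % m) l = 0) ↔ Orthogonal n m d x := by
  constructor
  · rintro ⟨c, hc, h⟩
    exact ⟨c / m, Nat.div_lt_of_lt_mul (by rwa [Nat.mul_comm]), c % m, Nat.mod_lt _ hm, h⟩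
  · rintro ⟨i, hi, j, hj, h⟩
    refine ⟨i * m + j, TwoHub.mul_add_lt_mul hj hi, ?_⟩
    rwa [TwoHub.add_mul_div_of_lt hj, TwoHub.add_mul_mod_of_lt hj]

/-- The threshold d + 22 makes both windows nonempty and the graph large enough for the weight 21 to
be at most the number of vertices. -/
theorem reductionCode_spec (hB : 32 ≤ B) (hW : B ^ 2 ^ 16 ≤ W) (hn : 1 ≤ n) (hm : 1 ≤ m)
    (hmn : m ≤ n) (hL : L = 3 + (n + m) * d) (hx : ∀ a, x (3 + a) ≤ 1)
    (hxL : ∀ a, L ≤ a → x a = 0) (hx0 : x 0 = n) (hx1 : x 1 = m) (hx2 : x 2 = d)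
    {p : Program} {kp X T : ℕ} (hX : X = (4 + 10 * (m + n) + 2) ^ kp) (hn₁ : n₁ = n / (d + 2))
    (hm₁ : m₁ = (m - 3) / (d + 1)) (hk : k = m / m₁ + 1) (hK : K = (n / n₁ + 1) * k)
    (hBig : L + K * (n + m + 10) + 3 * (m + n) + 50 + X + n * m + d < B)
    (hp : d + 22 ≤ m → ∀ c < K, ∃ t ≤ T, ∃ out,
      p.Computes kp (inputWords n m d n₁ m₁ (c / k * n₁) (c % k * m₁) x) t out ∧
      (out.1 < 21 * out.2 ↔ OrthogonalWindow n m d n₁ m₁ k x c)) {T' : ℕ}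
    (hbrute : m < d + 22 → n * m * (2010 + (d + 1) * 1010) ≤ T')
    (hmain : d + 22 ≤ m → 2500 + K * (8100 + p.regBound + (m + n) * 13000 + 4 * T) ≤ T') :
    Hoare W (2000 + T') (reductionCode p) 0 x (fun v' _ => v' 0 = 1 ↔ Orthogonal n m d x) := by
  have hb : Bounded B 0 x := by
    refine ⟨fun i => by simp; omega, fun a => ?_⟩
    rcases (by omega : a = 0 ∨ a = 1 ∨ a = 2 ∨ 3 ≤ a) with rfl | rfl | rfl | h
    · omega
    · omega
    · omega
    · obtain ⟨e, rfl⟩ := Nat.exists_eq_add_of_le h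
      have := hx e
      omega
  have e1 : (Expr.mem 0).eval 0 x = n := by simp [hx0]
  refine (Hoare.set_seq hB hW hb (by decide) (by rw [e1]; omega) (T := 1500 + T') ?_).mono
    (by omega) fun _ _ h => h
  rw [e1]
  intro hb
  have e2 : (Expr.mem 1).eval (Function.update (0 : ℕ → ℕ) 1 n) x = m := by simp [hx1]
  refine (Hoare.set_seq hB hW hb (by decide) (by rw [e2]; omega) (T := 1000 + T') ?_).mono
    (by omega) fun _ _ h => h
  rw [e2]
  intro hb
  have e3 : (Expr.mem 2).eval (Function.update (Function.update (0 : ℕ → ℕ) 1 n) 2 m) x = d := by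
    simp [hx2]
  refine (Hoare.set_seq hB hW hb (by decide) (by rw [e3]; omega) (T := 500 + T') ?_).mono
    (by omega) fun _ _ h => h
  rw [e3]
  intro hb
  obtain ⟨w, hw⟩ : ∃ w : ℕ → ℕ,
    w = Function.update (Function.update (Function.update (0 : ℕ → ℕ) 1 n) 2 m) 3 d := ⟨_, rfl⟩
  rw [← hw] at hb ⊢
  have w1 : w 1 = n := by simp [hw]
  have w2 : w 2 = m := by simp [hw]
  have w3 : w 3 = d := by simp [hw]
  have w0 : ∀ i, i = 0 ∨ 4 ≤ i → w i = 0 := by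
    intro i hi
    rw [hw, Function.update_of_ne (by omega), Function.update_of_ne (by omega),
      Function.update_of_ne (by omega)]
    rfl
  have hcond : (var 2).eval w x < (var 3 + 22).eval w x ↔ m < d + 22 := by simp [w2, w3]
  refine (Hoare.ifLt (T := T') (one_lt_of_pow_le hB hW) (Small.fits (by decide) hB hW hb)
    (Small.fits (by decide) hB hW hb) (fun h => ?_) fun h => ?_).mono (by simp [cost]; omega)
    fun _ _ h => h
  · rw [hcond] at h
    refine (bruteCode_spec hB hW hn hm hx (fun hd => hxL 3 (by simp [hL, hd])) (by omega)
      (by omega) hb w1 w2 w3 (w0 9 (by omega)) (w0 0 (by omega))).mono (hbrute h) fun _ _ h => ?_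
    rwa [exists_pair_iff hm] at h
  · rw [hcond] at h
    have hdm : d + 22 ≤ m := by omega
    refine (mainCode_spec hB hW hn hm hL hx hxL hX (by omega) hn₁ hm₁ hk hK (hp hdm) hb w1 w2 w3
      w0).mono (hmain hdm) fun _ _ h => ?_
    rwa [exists_orthogonalWindow hn hm ?_ ?_ hk hK] at h
    · rw [hn₁]
      exact Nat.div_pos (by omega) (by omega)
    · rw [hm₁]
      exact Nat.div_pos (by omega) (by omega)

end spec

end Reduction

/-! ### The instance of a pair of windows, and the encoding of the input. -/

namespace Reduction

open WordRAM

section window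

variable {n m d n₁ m₁ i₀ j₀ : ℕ} {x : ℕ → ℕ}

/-- The graph and the two paths for a pair of windows. -/
noncomputable def windowPair (hM : 22 ≤ m + n) (hx : ∀ a, x (3 + a) ≤ 1) (d n₁ m₁ i₀ j₀ : ℕ) :
    PlanarPathPair m n :=
  TwoHub.pathPair m n (fun t => (label n m d n₁ m₁ i₀ j₀ x t).1)
    (fun t => (label n m d n₁ m₁ i₀ j₀ x t).2) hM (fun t _ => (label_le hx t).1)
    (fun t _ => (label_le hx t).2)

theorem encode_windowPair (hM : 22 ≤ m + n) (hx : ∀ a, x (3 + a) ≤ 1) :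
    (windowPair hM hx d n₁ m₁ i₀ j₀).encode (TwoHub.edgeList (m + n)) =
      inputWords n m d n₁ m₁ i₀ j₀ x :=
  TwoHub.encode_pathPair _ _ _

theorem near_label_iff {s t : ℕ} (hs : s < m) :
    ((label n m d n₁ m₁ i₀ j₀ x s).1 + (label n m d n₁ m₁ i₀ j₀ x (m + t)).1 ≤ 20 ∨
      (label n m d n₁ m₁ i₀ j₀ x s).2 + (label n m d n₁ m₁ i₀ j₀ x (m + t)).2 ≤ 20) ↔
    TwoHub.Near (TwoHub.pLabel d m₁ (fun j l => bitB n d x ((j₀ + j) % m) l) s)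
      (TwoHub.qLabel d n₁ (fun i l => bitA d x ((i₀ + i) % n) l) t) := by
  rw [label, if_pos hs, label, if_neg (by omega), Nat.add_sub_cancel_left]
  rfl

/-- The bound on m leaves room for the starting vertex, the last separator and at least one final
vertex near everything, on which the first path can wait. -/
theorem frechetDist_windowPair_le (hM : 22 ≤ m + n) (hx : ∀ a, x (3 + a) ≤ 1)
    (hm : m₁ * (d + 1) + 3 ≤ m) (hn : n₁ * (d + 2) ≤ n)
    (h : ∃ i < n₁, ∃ j < m₁, ∀ l < d, bitA d x ((i₀ + i) % n) l = 0 ∨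
      bitB n d x ((j₀ + j) % m) l = 0) :
    (windowPair hM hx d n₁ m₁ i₀ j₀).frechetDist ≤ 20 := by
  obtain ⟨i, hi, j, hj, h⟩ := h
  obtain ⟨F, hF, hnear⟩ := TwoHub.exists_walk (bitA := fun i l => bitA d x ((i₀ + i) % n) l)
    (bitB := fun j l => bitB n d x ((j₀ + j) % m) l) (fun _ _ => hx _) (fun _ _ => hx _) hm hn
    hi hj h
  exact TwoHub.frechetDist_le _ _ _ hF fun a ha => (near_label_iff a.1.2).2 (hnear a ha)

theorem le_frechetDist_windowPair (hM : 22 ≤ m + n) (hx : ∀ a, x (3 + a) ≤ 1)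
    (hm : m₁ * (d + 1) + 3 ≤ m) (hm₁ : 1 ≤ m₁)
    (h : ¬ ∃ i < n₁, ∃ j < m₁, ∀ l < d, bitA d x ((i₀ + i) % n) l = 0 ∨
      bitB n d x ((j₀ + j) % m) l = 0) :
    21 ≤ (windowPair hM hx d n₁ m₁ i₀ j₀).frechetDist := by
  refine TwoHub.le_frechetDist _ _ _ fun F hF => ?_
  by_contra hcon
  push Not at hcon
  refine h (TwoHub.exists_orthogonal_of_isMonotoneWalk
    (bitA := fun i l => bitA d x ((i₀ + i) % n) l) (fun _ _ => hx _) hm hm₁ hF fun a ha => ?_)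
  refine (near_label_iff a.1.2).1 ?_
  rcases Nat.lt_or_ge 20 ((label n m d n₁ m₁ i₀ j₀ x a.1).1 +
    (label n m d n₁ m₁ i₀ j₀ x (m + a.2)).1) with h1 | h1
  · exact Or.inr (hcon a ha h1)
  · exact Or.inl h1

/-- An approximation with factor `1.01` distinguishes the distances `20` and `21`. -/
theorem approx_lt_iff {D : ℕ∞} {out : ℕ × ℕ} (h : IsApproxOutput D out) {yes : Prop}
    (h1 : yes → D ≤ 20) (h2 : ¬ yes → 21 ≤ D) : out.1 < 21 * out.2 ↔ yes := by
  obtain ⟨hpos, hle, hge⟩ := h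
  constructor
  · intro hlt
    by_contra hno
    have h3 : (out.2 : ℕ∞) * 21 ≤ out.1 := (mul_le_mul_right (h2 hno) _).trans hle
    have h4 : out.2 * 21 ≤ out.1 := by exact_mod_cast h3
    omega
  · intro hyes
    have h3 : 100 * (out.1 : ℕ∞) ≤ 101 * (out.2 * 20) :=
      hge.trans (mul_le_mul_right (mul_le_mul_right (h1 hyes) _) _)
    have h4 : 100 * out.1 ≤ 101 * (out.2 * 20) := by exact_mod_cast h3
    omega

/-- What the assumed algorithm computes on the instance of a pair of windows: an output below 21 is
equivalent to an orthogonal pair in the windows. -/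
theorem computes_window {p : Program} {kp T : ℕ} (hM : 22 ≤ m + n) (hx : ∀ a, x (3 + a) ≤ 1)
    (hm : m₁ * (d + 1) + 3 ≤ m) (hm₁ : 1 ≤ m₁) (hn : n₁ * (d + 2) ≤ n)
    (hsolve : ∀ (I : PlanarPathPair m n) (l : List (Fin I.N × Fin I.N)), I.N ≤ 2 * (m + n) →
      I.IsEdgeList l → ∃ t ≤ T, ∃ out, p.Computes kp (I.encode l) t out ∧
        IsApproxOutput I.frechetDist out) :
    ∃ t ≤ T, ∃ out, p.Computes kp (inputWords n m d n₁ m₁ i₀ j₀ x) t out ∧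
      (out.1 < 21 * out.2 ↔ ∃ i < n₁, ∃ j < m₁, ∀ l < d, bitA d x ((i₀ + i) % n) l = 0 ∨
        bitB n d x ((j₀ + j) % m) l = 0) := by
  obtain ⟨t, ht, out, hc, ho⟩ := hsolve (windowPair hM hx d n₁ m₁ i₀ j₀)
    (TwoHub.edgeList (m + n)) (show m + n + 3 ≤ _ by omega) (TwoHub.isEdgeList_edgeList _ _ _)
  refine ⟨t, ht, out, ?_, approx_lt_iff ho (frechetDist_windowPair_le hM hx hm hn)
    (le_frechetDist_windowPair hM hx hm hm₁)⟩
  rwa [encode_windowPair] at hc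

end window

section input

variable {n m d : ℕ} (A : Fin n → Fin d → Bool) (B : Fin m → Fin d → Bool)

theorem length_encodeOV : (encodeOV A B).length = 3 + (n + m) * d := by
  simp only [encodeOV, List.length_append]
  rw [length_flatMap_const (k := d) _ (fun _ => by simp),
    length_flatMap_const (k := d) _ (fun _ => by simp)]
  simp
  ring

theorem getD_encodeOV_le (a : ℕ) : (encodeOV A B).getD (3 + a) 0 ≤ 1 := by
  rw [encodeOV, List.append_assoc, List.getD_append_right _ _ _ _ (by simp)]
  generalize 3 + a - [n, m, d].length = i
  rcases Nat.lt_or_ge i ((List.ofFn A).flatMap (fun a => (List.ofFn a).map Bool.toNat) ++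
    (List.ofFn B).flatMap (fun b => (List.ofFn b).map Bool.toNat)).length with h | h
  · rw [List.getD_eq_getElem _ _ h]
    have := List.getElem_mem h
    generalize (List.flatMap _ _ ++ List.flatMap _ _)[i] = y at this
    simp only [List.mem_append, List.mem_flatMap, List.mem_map] at this
    rcases this with ⟨_, _, b, _, rfl⟩ | ⟨_, _, b, _, rfl⟩ <;> exact Bool.toNat_le b
  · rw [List.getD_eq_default _ _ h]
    omega

theorem bitA_encodeOV (i : Fin n) (l : Fin d) :
    bitA d (fun a => (encodeOV A B).getD a 0) i l = (A i l).toNat := by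
  have h := TwoHub.mul_add_lt_mul l.2 i.2
  have hlen := length_flatMap_const (k := d) (fun a : Fin d → Bool => (List.ofFn a).map Bool.toNat)
    (fun _ => by simp) (List.ofFn A)
  rw [List.length_ofFn] at hlen
  simp only [bitA, encodeOV]
  rw [List.append_assoc, List.getD_append_right _ _ _ _ (by simp),
    show 3 + ((i : ℕ) * d + l) - [n, m, d].length = d * i + l by simp [Nat.mul_comm],
    List.getD_append _ _ _ _ (by rw [hlen, Nat.mul_comm d i, Nat.mul_comm d n]; exact h),
    getD_flatMap (k := d) _ (fun _ => by simp) l.2 _ i (by simp)]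
  simp

theorem bitB_encodeOV (j : Fin m) (l : Fin d) :
    bitB n d (fun a => (encodeOV A B).getD a 0) j l = (B j l).toNat := by
  have hlen := length_flatMap_const (k := d) (fun a : Fin d → Bool => (List.ofFn a).map Bool.toNat)
    (fun _ => by simp) (List.ofFn A)
  rw [List.length_ofFn] at hlen
  simp only [bitB, encodeOV]
  rw [List.append_assoc, List.getD_append_right _ _ _ _ (by simp),
    show 3 + ((n + j) * d + l) - [n, m, d].length = d * n + (d * j + l) by
      simp [Nat.mul_comm, Nat.mul_add, Nat.add_assoc],
    List.getD_append_right _ _ _ _ (by rw [hlen]; omega), hlen, Nat.add_sub_cancel_left,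
    getD_flatMap (k := d) _ (fun _ => by simp) l.2 _ j (by simp)]
  simp

theorem orthogonal_encodeOV :
    Orthogonal n m d (fun a => (encodeOV A B).getD a 0) ↔ HasOrthogonalPair A B := by
  have hbit : ∀ (i : Fin n) (j : Fin m), ∑ l, (A i l).toNat * (B j l).toNat = 0 ↔
      ∀ l < d, bitA d (fun a => (encodeOV A B).getD a 0) i l = 0 ∨
        bitB n d (fun a => (encodeOV A B).getD a 0) j l = 0 := by
    intro i j
    rw [Finset.sum_eq_zero_iff]
    constructor
    · intro h l hl
      have := h ⟨l, hl⟩ (Finset.mem_univ _)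
      rw [Nat.mul_eq_zero, ← bitA_encodeOV A B, ← bitB_encodeOV A B] at this
      exact this
    · intro h l _
      rw [Nat.mul_eq_zero, ← bitA_encodeOV A B, ← bitB_encodeOV A B]
      exact h l l.2
  constructor
  · rintro ⟨i, hi, j, hj, h⟩
    exact ⟨⟨i, hi⟩, ⟨j, hj⟩, (hbit ⟨i, hi⟩ ⟨j, hj⟩).2 h⟩
  · rintro ⟨i, j, h⟩
    exact ⟨i, i.2, j, j.2, (hbit i j).1 h⟩

end input

/-! ### Word size and total correctness of the reduction. -/

/-- The number of calls. -/
def numCalls (n m d : ℕ) : ℕ := (n / (n / (d + 2)) + 1) * (m / ((m - 3) / (d + 1)) + 1)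

/-- With s = L + 2 ≥ 5, the called input has length at most s³ - 2, so its words of exponent kp
become s^(3 kp); the other terms are O(s³). The remaining factor s² absorbs the constants. -/
theorem wordBound {n m d L K kp : ℕ} (hL : L = 3 + (n + m) * d) (hlen : n + m ≤ L) (hn : 1 ≤ n)
    (hm : 1 ≤ m) (hK : K ≤ (n + 1) * (m + 1)) :
    L + K * (n + m + 10) + 3 * (m + n) + 50 + (4 + 10 * (m + n) + 2) ^ kp + n * m + d <
      (L + 2) ^ (3 * kp + 5) := by
  obtain ⟨s, hs⟩ : ∃ s, s = L + 2 := ⟨_, rfl⟩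
  have hs5 : 5 ≤ s := by omega
  have hd : d ≤ (n + m) * d := Nat.le_mul_of_pos_left _ (by omega)
  have h3 : s ≤ s ^ 3 := Nat.le_self_pow (by norm_num) s
  have h125 : 5 ^ 3 ≤ s ^ 3 := Nat.pow_le_pow_left hs5 3
  have hKs : K ≤ s * s := hK.trans (Nat.mul_le_mul (by omega) (by omega))
  have h1 : K * (n + m + 10) ≤ 3 * s ^ 3 :=
    (Nat.mul_le_mul hKs (show n + m + 10 ≤ 3 * s by omega)).trans (by ring_nf; rfl)
  have hnm : n * m ≤ s ^ 3 := (Nat.mul_le_mul (show n ≤ s by omega) (show m ≤ s by omega)).trans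
    (by rw [← sq]; exact Nat.pow_le_pow_right (by omega) (by norm_num))
  have h2 : (4 + 10 * (m + n) + 2) ^ kp ≤ s ^ (3 * kp) := by
    rw [pow_mul]
    refine Nat.pow_le_pow_left ?_ kp
    have : 5 * 5 * s ≤ s * s * s := Nat.mul_le_mul_right _ (Nat.mul_le_mul hs5 hs5)
    have e : s * s * s = s ^ 3 := by ring
    omega
  have h4 : 1 ≤ s ^ (3 * kp) := Nat.one_le_pow _ _ (by omega)
  have h5 : s ^ 3 * 1 ≤ s ^ 3 * s ^ (3 * kp) := Nat.mul_le_mul_left _ h4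
  have h6 : 1 * s ^ (3 * kp) ≤ s ^ 3 * s ^ (3 * kp) := Nat.mul_le_mul_right _ (by omega)
  have h7 : 5 * 5 * (s ^ 3 * s ^ (3 * kp)) ≤ s * s * (s ^ 3 * s ^ (3 * kp)) :=
    Nat.mul_le_mul_right _ (Nat.mul_le_mul hs5 hs5)
  have e : s * s * (s ^ 3 * s ^ (3 * kp)) = s ^ (3 * kp + 5) := by ring
  rw [← hs, ← e]
  omega

/-- The exponent of the word size is that of `wordBound` times 2 ^ 16, the price of expressions of
depth up to 16. -/
theorem computes_reduction {p : Program} {kp n m d : ℕ} (A : Fin n → Fin d → Bool)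
    (B : Fin m → Fin d → Bool) (hn : 1 ≤ n) (hm : 1 ≤ m) (hmn : m ≤ n)
    (hlen : n + m ≤ 3 + (n + m) * d) {T T' : ℕ}
    (hsolve : ∀ (I : PlanarPathPair m n) (l : List (Fin I.N × Fin I.N)), I.N ≤ 2 * (m + n) →
      I.IsEdgeList l → ∃ t ≤ T, ∃ out, p.Computes kp (I.encode l) t out ∧
        IsApproxOutput I.frechetDist out)
    (hbrute : m < d + 22 → n * m * (2010 + (d + 1) * 1010) ≤ T')
    (hmain : d + 22 ≤ m →
      2500 + numCalls n m d * (8100 + p.regBound + (m + n) * 13000 + 4 * T) ≤ T') :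
    ∃ t ≤ 2000 + T', ∃ out, Program.Computes (reductionCode p 0) ((3 * kp + 5) * 2 ^ 16)
      (encodeOV A B) t out ∧ (out.1 = 1 ↔ HasOrthogonalPair A B) := by
  have hlen' := length_encodeOV A B
  obtain ⟨L, hL⟩ : ∃ L, L = 3 + (n + m) * d := ⟨_, rfl⟩
  obtain ⟨x, hxdef⟩ : ∃ x : ℕ → ℕ, x = fun a => (encodeOV A B).getD a 0 := ⟨_, rfl⟩
  have hK : numCalls n m d ≤ (n + 1) * (m + 1) :=
    Nat.mul_le_mul (Nat.succ_le_succ (Nat.div_le_self _ _))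
      (Nat.succ_le_succ (Nat.div_le_self _ _))
  have hBig := wordBound (kp := kp) hL (by omega) hn hm hK
  have hx : ∀ a, x (3 + a) ≤ 1 := fun a => by rw [hxdef]; exact getD_encodeOV_le A B a
  have hspec := reductionCode_spec (B := (L + 2) ^ (3 * kp + 5)) (by omega) le_rfl hn hm hmn hL hx
    (fun a ha => by rw [hxdef]; exact List.getD_eq_default _ _ (by omega))
    (by rw [hxdef]; simp [encodeOV]) (by rw [hxdef]; simp [encodeOV])
    (by rw [hxdef]; simp [encodeOV]) rfl rfl rfl rfl rfl hBig (p := p) (T := T)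
    (fun hdm c _ => computes_window (by omega) hx
      (by have := Nat.div_mul_le_self (m - 3) (d + 1); omega)
      (Nat.div_pos (by omega) (by omega)) (Nat.div_mul_le_self _ _) hsolve) hbrute hmain
  have hbound : Bounded (((L + 2) ^ (3 * kp + 5)) ^ 2 ^ 16) (fun _ => 0) x := by
    have hle : (L + 2) ^ (3 * kp + 5) ≤ ((L + 2) ^ (3 * kp + 5)) ^ 2 ^ 16 :=
      Nat.le_self_pow (by norm_num) _
    refine ⟨fun i => by beta_reduce; omega, fun a => ?_⟩
    have hd : d ≤ (n + m) * d := Nat.le_mul_of_pos_left _ (by omega)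
    rcases (by omega : a = 0 ∨ a = 1 ∨ a = 2 ∨ 3 ≤ a) with rfl | rfl | rfl | h
    · have : x 0 = n := by rw [hxdef]; simp [encodeOV]
      omega
    · have : x 1 = m := by rw [hxdef]; simp [encodeOV]
      omega
    · have : x 2 = d := by rw [hxdef]; simp [encodeOV]
      omega
    · obtain ⟨e, rfl⟩ := Nat.exists_eq_add_of_le h
      have := hx e
      omega
  obtain ⟨t, ht, r', m', hrun, hans⟩ := hspec (fun _ => 0) (fun _ => rfl) (reductionCode p 0) 0
    ⟨[], [], by simp, rfl⟩ hbound
  have hconf : Program.configAt (reductionCode p 0) (encodeOV A B) t =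
      ⟨0 + (reductionCode p 0).length, r', m'⟩ := by
    rw [← hrun.iterate_eq, hxdef]
    rfl
  refine ⟨t, ht, (r' 0, r' 1), ⟨?_, fun s hs i => ?_, by rw [hconf], by rw [hconf]⟩, ?_⟩
  · rw [hconf]
    simp [Program.Halted]
  · have hb := hrun.bounded_iterate s hs
    rw [hlen', ← hL, pow_mul]
    rw [hxdef] at hb
    exact ⟨hb.1 i, hb.2 i⟩
  · rw [← orthogonal_encodeOV, ← hxdef]
    exact hans

end Reduction

/-! ### Running time. -/

namespace Reduction

open WordRAM

/-- If q = ⌊n / (d + 2)⌋ ≥ 1, then n < (q + 1)(d + 2) ≤ 2 q (d + 2), so n / q < 2d + 4. The count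
for m is alike, where the subtracted 3 turns 2d + 2 into 2d + 5. -/
theorem numCalls_le {n m d : ℕ} (hm : d + 22 ≤ m) (hmn : m ≤ n) :
    numCalls n m d ≤ (2 * d + 5) ^ 2 := by
  have h1 : n / (n / (d + 2)) < 2 * d + 4 := by
    have h2 : 1 ≤ n / (d + 2) := Nat.div_pos (by omega) (by omega)
    have h3 := Nat.div_add_mod n (d + 2)
    have h4 := Nat.mod_lt n (show d + 2 > 0 by omega)
    refine Nat.div_lt_of_lt_mul ?_
    have h5 : (d + 2) * 1 ≤ (d + 2) * (n / (d + 2)) := Nat.mul_le_mul_left _ h2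
    have h6 : n / (d + 2) * (2 * d + 4) = 2 * ((d + 2) * (n / (d + 2))) := by ring
    omega
  have h1' : m / ((m - 3) / (d + 1)) < 2 * d + 5 := by
    have h2 : 1 ≤ (m - 3) / (d + 1) := Nat.div_pos (by omega) (by omega)
    have h3 := Nat.div_add_mod (m - 3) (d + 1)
    have h4 := Nat.mod_lt (m - 3) (show d + 1 > 0 by omega)
    refine Nat.div_lt_of_lt_mul ?_
    have h5 : (d + 4) * 1 ≤ (d + 4) * ((m - 3) / (d + 1)) := Nat.mul_le_mul_left _ h2
    have h6 : (m - 3) / (d + 1) * (2 * d + 5) =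
        (d + 1) * ((m - 3) / (d + 1)) + (d + 4) * ((m - 3) / (d + 1)) := by ring
    omega
  rw [sq]
  exact Nat.mul_le_mul (by omega) (by omega)

section

variable {γ : ℝ} {n m : ℕ}

theorem le_of_abs_sub_rpow_lt (hγ1 : γ ≤ 1) (hn : 1 ≤ n) (h : |(m : ℝ) - (n : ℝ) ^ γ| < 1) :
    m ≤ n := by
  have h1 : (n : ℝ) ^ γ ≤ n := Real.rpow_le_self_of_one_le (by exact_mod_cast hn) hγ1
  have h2 := (abs_lt.1 h).2
  have h3 : (m : ℝ) < n + 1 := by linarith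
  exact Nat.lt_succ_iff.1 (by exact_mod_cast h3)

/-- Writing the instances takes time linear in n, which has to be sublinear in s = n m up to the
exponent 1 - δ. Since s is at least n^(1 + γ) / 2, this holds for δ ≤ γ / 2. -/
theorem le_two_mul_rpow (hγ0 : 0 < γ) (hγ1 : γ ≤ 1) (hn : 1 ≤ n) (hm : 1 ≤ m)
    (h : |(m : ℝ) - (n : ℝ) ^ γ| < 1) {δ : ℝ} (hδ : δ ≤ γ / 2) :
    (n : ℝ) ≤ 2 * ((n : ℝ) * m) ^ (1 - δ) := by
  have hn' : (1 : ℝ) ≤ n := by exact_mod_cast hn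
  have hm' : (1 : ℝ) ≤ m := by exact_mod_cast hm
  have hs : (1 : ℝ) ≤ (n : ℝ) * m := one_le_mul_of_one_le_of_one_le hn' hm'
  have h1 : (n : ℝ) ^ γ ≤ 2 * m := by linarith [(abs_lt.1 h).1]
  have h2 : (n : ℝ) ^ (1 + γ) ≤ 2 * ((n : ℝ) * m) := by
    rw [Real.rpow_add (by linarith), Real.rpow_one]
    nlinarith
  calc (n : ℝ) = (n : ℝ) ^ (1 : ℝ) := (Real.rpow_one _).symm
    -- The exponent is 1 + γ (1 - γ) / 2, hence at least 1 because γ ≤ 1.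
    _ ≤ (n : ℝ) ^ ((1 + γ) * (1 - γ / 2)) := Real.rpow_le_rpow_of_exponent_le hn' (by nlinarith)
    _ = ((n : ℝ) ^ (1 + γ)) ^ (1 - γ / 2) := Real.rpow_mul (by linarith) _ _
    _ ≤ (2 * ((n : ℝ) * m)) ^ (1 - γ / 2) :=
      Real.rpow_le_rpow (by positivity) h2 (by linarith)
    _ = 2 ^ (1 - γ / 2) * ((n : ℝ) * m) ^ (1 - γ / 2) :=
      Real.mul_rpow (by norm_num) (by positivity)
    _ ≤ 2 * ((n : ℝ) * m) ^ (1 - δ) := by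
      refine mul_le_mul ?_ (Real.rpow_le_rpow_of_exponent_le hs (by linarith)) (by positivity)
        (by norm_num)
      exact Real.rpow_le_self_of_one_le (by norm_num) (by linarith)

/-- The dimension is bounded by any positive power of the number of vectors. -/
theorem ceil_logb_le {ω ε : ℝ} (hω : 0 < ω) (hε : 0 < ε) (hn : 1 ≤ n) :
    (⌈ω * Real.logb 2 n⌉₊ : ℝ) ≤ (ω / (ε * Real.log 2) + 1) * (n : ℝ) ^ ε := by
  have hn' : (1 : ℝ) ≤ n := by exact_mod_cast hn
  have hlog2 : 0 < Real.log 2 := Real.log_pos (by norm_num)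
  have h0 : 0 ≤ ω * Real.logb 2 n := mul_nonneg hω.le (Real.logb_nonneg (by norm_num) hn')
  have h1 := (Nat.ceil_lt_add_one h0).le
  have h2 : Real.logb 2 n ≤ (n : ℝ) ^ ε / ε / Real.log 2 :=
    div_le_div_of_nonneg_right (Real.log_le_rpow_div (by linarith) hε) hlog2.le
  have h3 : 1 ≤ (n : ℝ) ^ ε := Real.one_le_rpow hn' hε.le
  have h4 : ω * Real.logb 2 n ≤ ω / (ε * Real.log 2) * (n : ℝ) ^ ε :=
    (mul_le_mul_of_nonneg_left h2 hω.le).trans (le_of_eq (by field_simp))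
  linarith

theorem exists_dim_le {ω : ℝ} (hω : 0 < ω) {ε : ℝ} (hε : 0 < ε) : ∃ c : ℝ, 0 ≤ c ∧
    ∀ n : ℕ, 1 ≤ n → 2 * (⌈ω * Real.logb 2 n⌉₊ : ℝ) + 5 ≤ c * (n : ℝ) ^ ε := by
  have hlog2 : 0 < Real.log 2 := Real.log_pos (by norm_num)
  refine ⟨2 * (ω / (ε * Real.log 2) + 1) + 5, by positivity, fun n hn => ?_⟩
  have h1 := ceil_logb_le hω hε hn
  have h2 : 1 ≤ (n : ℝ) ^ ε := Real.one_le_rpow (by exact_mod_cast hn) hε.le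
  linarith

/-- If the second family is smaller than the dimension, the size of the instance is bounded. -/
theorem exists_bound_of_lt {ω : ℝ} (hω : 0 < ω) (hγ0 : 0 < γ) : ∃ N : ℝ, ∀ n m : ℕ, 1 ≤ n →
    |(m : ℝ) - (n : ℝ) ^ γ| < 1 → m < ⌈ω * Real.logb 2 n⌉₊ + 22 → (n : ℝ) ≤ N := by
  obtain ⟨c, hc, hd⟩ := exists_dim_le hω (half_pos hγ0)
  -- From n^γ < m + 1 ≤ d + 22 and d ≤ c n^(γ/2) follows n^(γ/2) ≤ c + 22, which is solved for n.
  refine ⟨(c + 22) ^ (2 / γ), fun n m hn h hm => ?_⟩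
  have hn' : (1 : ℝ) ≤ n := by exact_mod_cast hn
  have hm' : (m : ℝ) + 1 ≤ (⌈ω * Real.logb 2 n⌉₊ : ℝ) + 22 := by exact_mod_cast hm
  have h1 : 1 ≤ (n : ℝ) ^ (γ / 2) := Real.one_le_rpow hn' (by linarith)
  have h2 : (n : ℝ) ^ (γ / 2) * (n : ℝ) ^ (γ / 2) = (n : ℝ) ^ γ := by
    rw [← Real.rpow_add (by linarith), add_halves]
  have h3 := hd n hn
  have h4 : (0 : ℝ) ≤ (⌈ω * Real.logb 2 n⌉₊ : ℝ) := Nat.cast_nonneg _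
  have h5 : (n : ℝ) ^ (γ / 2) * (n : ℝ) ^ (γ / 2) ≤ (c + 22) * (n : ℝ) ^ (γ / 2) := by
    linarith [(abs_lt.1 h).1]
  have h6 : (n : ℝ) ^ (γ / 2) ≤ c + 22 := le_of_mul_le_mul_right h5 (by linarith)
  calc (n : ℝ) = ((n : ℝ) ^ (γ / 2)) ^ (2 / γ) := by
        rw [← Real.rpow_mul (by linarith), div_mul_div_comm, mul_comm γ 2,
          div_self (by positivity), Real.rpow_one]
    _ ≤ (c + 22) ^ (2 / γ) := Real.rpow_le_rpow (by positivity) h6 (by positivity)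

end

/-- A fast algorithm for the Fréchet distance yields one for Orthogonal Vectors. -/
theorem ovSolvable_of_frechetSolvable {γ δ ω : ℝ} (hγ0 : 0 < γ) (hγ1 : γ ≤ 1) (hδ0 : 0 < δ)
    (hδ : δ ≤ γ / 2) (hω : 0 < ω) (h : FrechetSolvable IsApproxOutput γ δ) :
    OVSolvable γ ω (δ / 2) := by
  obtain ⟨p, kp, C, hp⟩ := h
  -- The number of calls is quadratic in d, so the exponent δ / 4 for d costs δ / 2 in total and
  -- leaves a saving of δ / 2.
  obtain ⟨c, hc, hdim⟩ := exists_dim_le hω (show 0 < δ / 4 by linarith)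
  obtain ⟨N, hN⟩ := exists_bound_of_lt hω hγ0
  obtain ⟨C', hC'⟩ : ∃ C', C' = max C 0 := ⟨_, rfl⟩
  have hC0 : 0 ≤ C' := hC' ▸ le_max_right _ _
  obtain ⟨R, hR⟩ : ∃ R : ℝ, R = c ^ 2 * (60100 + p.regBound + 4 * C') := ⟨_, rfl⟩
  have hR0 : 0 ≤ R := by rw [hR]; positivity
  obtain ⟨S, hS⟩ : ∃ S : ℝ, S = N ^ 2 * (2010 + c * N * 1010) := ⟨_, rfl⟩
  refine ⟨reductionCode p 0, (3 * kp + 5) * 2 ^ 16, 4500 + R + |S|, ?_⟩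
  intro n m d A B hn hm hnm hd
  have hmn := le_of_abs_sub_rpow_lt hγ1 hn hnm
  have hn' : (1 : ℝ) ≤ n := by exact_mod_cast hn
  have hm' : (1 : ℝ) ≤ m := by exact_mod_cast hm
  have hmn' : (m : ℝ) ≤ n := by exact_mod_cast hmn
  obtain ⟨s, hs⟩ : ∃ s : ℝ, s = (n : ℝ) * m := ⟨_, rfl⟩
  have hs1 : 1 ≤ s := hs ▸ one_le_mul_of_one_le_of_one_le hn' hm'
  have hns : (n : ℝ) ≤ s := by rw [hs]; nlinarith
  -- Words are powers of the input length, so this length has to dominate n and m. It does if d ≥ 1,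
  -- and for n = 1 also m = 1, and the three header words suffice.
  have hlen : n + m ≤ 3 + (n + m) * d := by
    rcases Nat.lt_or_ge 1 n with h1 | h1
    · have hd1 : 1 ≤ d := by
        rw [hd]
        exact Nat.ceil_pos.2 (mul_pos hω (Real.logb_pos (by norm_num) (by exact_mod_cast h1)))
      have := Nat.mul_le_mul_left (n + m) hd1
      omega
    · omega
  have hdim' : 2 * (d : ℝ) + 5 ≤ c * s ^ (δ / 4) := by
    have h1 : (n : ℝ) ^ (δ / 4) ≤ s ^ (δ / 4) := Real.rpow_le_rpow (by linarith) hns (by linarith)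
    rw [hd]
    exact (hdim n hn).trans (mul_le_mul_of_nonneg_left h1 hc)
  obtain ⟨T, hT⟩ : ∃ T, T = ⌊C' * s ^ (1 - δ)⌋₊ := ⟨_, rfl⟩
  have hTle : (T : ℝ) ≤ C' * s ^ (1 - δ) := by
    rw [hT]
    exact Nat.floor_le (by positivity)
  have hsolve : ∀ (I : PlanarPathPair m n) (l : List (Fin I.N × Fin I.N)), I.N ≤ 2 * (m + n) →
      I.IsEdgeList l → ∃ t ≤ T, ∃ out, p.Computes kp (I.encode l) t out ∧
        IsApproxOutput I.frechetDist out := by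
    intro I l hI hl
    obtain ⟨t, out, h1, h2, h3⟩ := hp m n I l hm hn hnm hI hl
    refine ⟨t, ?_, out, h1, h3⟩
    rw [hT]
    refine Nat.le_floor (h2.trans ?_)
    rw [hs, mul_comm (n : ℝ), hC']
    exact mul_le_mul_of_nonneg_right (le_max_left _ _) (by positivity)
  have hpow1 : 1 ≤ s ^ (1 - δ / 2) := Real.one_le_rpow hs1 (by linarith)
  by_cases hcase : m < d + 22
  · obtain ⟨t, ht, out, h1, h2⟩ := computes_reduction (p := p) (kp := kp) A B hn hm hmn hlen
      hsolve (T' := n * m * (2010 + (d + 1) * 1010)) (fun _ => le_rfl) (fun h => by omega)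
    refine ⟨t, out, h1, ?_, h2⟩
    have ht' : (t : ℝ) ≤ 2000 + (n : ℝ) * m * (2010 + (d + 1) * 1010) := by exact_mod_cast ht
    have hnN : (n : ℝ) ≤ N := hN n m hn hnm (by rwa [← hd])
    have hN0 : 0 ≤ N := by linarith
    have hd' : (d : ℝ) + 1 ≤ c * N := by
      have h3 : (n : ℝ) ^ (δ / 4) ≤ n := Real.rpow_le_self_of_one_le hn' (by linarith)
      have h4 := hdim n hn
      rw [← hd] at h4
      have h5 : c * (n : ℝ) ^ (δ / 4) ≤ c * N := mul_le_mul_of_nonneg_left (h3.trans hnN) hc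
      have h6 : (0 : ℝ) ≤ d := Nat.cast_nonneg d
      linarith
    have hnm' : (n : ℝ) * m ≤ N ^ 2 := by
      rw [sq]
      exact mul_le_mul hnN (hmn'.trans hnN) (by linarith) hN0
    have hS' : (n : ℝ) * m * (2010 + (d + 1) * 1010) ≤ |S| := by
      refine le_trans ?_ (le_abs_self S)
      rw [hS]
      exact mul_le_mul hnm' (by linarith) (by positivity) (by positivity)
    rw [← hs]
    calc (t : ℝ) ≤ 4500 + R + |S| := by linarith
      _ ≤ (4500 + R + |S|) * s ^ (1 - δ / 2) :=
        le_mul_of_one_le_right (by positivity) hpow1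
  · obtain ⟨t, ht, out, h1, h2⟩ := computes_reduction (p := p) (kp := kp) A B hn hm hmn hlen
      hsolve (T' := 2500 + numCalls n m d * (8100 + p.regBound + (m + n) * 13000 + 4 * T))
      (fun h => absurd h hcase) (fun _ => le_rfl)
    refine ⟨t, out, h1, ?_, h2⟩
    have ht' : (t : ℝ) ≤ 2000 + (2500 + (numCalls n m d : ℝ) *
        (8100 + p.regBound + ((m : ℝ) + n) * 13000 + 4 * T)) := by exact_mod_cast ht
    have hn2 : (n : ℝ) ≤ 2 * s ^ (1 - δ) := hs ▸ le_two_mul_rpow hγ0 hγ1 hn hm hnm hδ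
    have hpow : 1 ≤ s ^ (1 - δ) := Real.one_le_rpow hs1 (by linarith)
    have hreg : (0 : ℝ) ≤ p.regBound := Nat.cast_nonneg _
    have hcalls : (numCalls n m d : ℝ) ≤ c ^ 2 * s ^ (δ / 2) := by
      have h3 : (numCalls n m d : ℝ) ≤ (2 * (d : ℝ) + 5) ^ 2 := by
        exact_mod_cast numCalls_le (by omega) hmn
      have h4 : (2 * (d : ℝ) + 5) ^ 2 ≤ (c * s ^ (δ / 4)) ^ 2 :=
        pow_le_pow_left₀ (by positivity) hdim' 2
      have h5 : (s ^ (δ / 4)) ^ 2 = s ^ (δ / 2) := by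
        rw [sq, ← Real.rpow_add (by linarith)]
        congr 1
        ring
      rw [mul_pow, h5] at h4
      exact h3.trans h4
    have hone : (8100 + p.regBound + ((m : ℝ) + n) * 13000 + 4 * T) ≤
        (60100 + p.regBound + 4 * C') * s ^ (1 - δ) := by
      have h6 : (p.regBound : ℝ) ≤ p.regBound * s ^ (1 - δ) := le_mul_of_one_le_right hreg hpow
      linarith
    have hmul : (numCalls n m d : ℝ) * (8100 + p.regBound + ((m : ℝ) + n) * 13000 + 4 * T) ≤
        R * s ^ (1 - δ / 2) := by
      refine (mul_le_mul hcalls hone (by positivity) (by positivity)).trans (le_of_eq ?_)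
      rw [hR, show 1 - δ / 2 = δ / 2 + (1 - δ) by ring, Real.rpow_add (by linarith)]
      ring
    rw [← hs]
    have h7 : 0 ≤ |S| * s ^ (1 - δ / 2) := by positivity
    linarith

/-- An algorithm stays fast if the exponent is relaxed. -/
theorem frechetSolvable_mono {Correct Correct' : ℕ∞ → ℕ × ℕ → Prop}
    (hC : ∀ D out, Correct D out → Correct' D out) {γ δ δ' : ℝ} (hδ : δ' ≤ δ)
    (h : FrechetSolvable Correct γ δ) : FrechetSolvable Correct' γ δ' := by
  obtain ⟨p, k, C, hp⟩ := h
  refine ⟨p, k, max C 0, fun n m I L hn hm hnm hN hL => ?_⟩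
  obtain ⟨t, out, h1, h2, h3⟩ := hp n m I L hn hm hnm hN hL
  refine ⟨t, out, h1, h2.trans ?_, hC _ _ h3⟩
  have hs : (1 : ℝ) ≤ (n : ℝ) * m :=
    one_le_mul_of_one_le_of_one_le (by exact_mod_cast hn) (by exact_mod_cast hm)
  exact mul_le_mul (le_max_left _ _) (Real.rpow_le_rpow_of_exponent_le hs (by linarith))
    (by positivity) (le_max_right _ _)

theorem isApproxOutput_of_isExactOutput {D : ℕ∞} {out : ℕ × ℕ} (h : IsExactOutput D out) :
    IsApproxOutput D out := by
  refine ⟨h.1, h.2.ge, ?_⟩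
  rw [h.2]
  exact mul_le_mul_left (by norm_num) _

/-- A large δ is first reduced to at most γ / 2, which only weakens the assumption on the algorithm.
-/
theorem not_frechetSolvable {γ δ : ℝ} (hγ0 : 0 < γ) (hγ1 : γ ≤ 1)
    (hOVH : OrthogonalVectorsHypothesis γ) (hδ : 0 < δ) :
    ¬ FrechetSolvable IsApproxOutput γ δ := by
  intro h
  have hδ' : 0 < min δ (γ / 2) := lt_min hδ (half_pos hγ0)
  obtain ⟨ω, hω, hno⟩ := hOVH (min δ (γ / 2) / 2) (half_pos hδ')
  exact hno (ovSolvable_of_frechetSolvable hγ0 hγ1 hδ' (min_le_right _ _) hω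
    (frechetSolvable_mono (fun _ _ => id) (min_le_left _ _) h))

end Reduction

theorem mainTheorem5 (γ : ℝ) (hγ0 : 0 < γ) (hγ1 : γ ≤ 1)
    (hOVH : OrthogonalVectorsHypothesis γ) (δ : ℝ) (hδ : 0 < δ) :
    ¬ FrechetSolvable IsExactOutput γ δ ∧ ¬ FrechetSolvable IsApproxOutput γ δ :=
  ⟨fun h => Reduction.not_frechetSolvable hγ0 hγ1 hOVH hδ (Reduction.frechetSolvable_mono
    (fun _ _ => Reduction.isApproxOutput_of_isExactOutput) le_rfl h),
    Reduction.not_frechetSolvable hγ0 hγ1 hOVH hδ⟩
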